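/- Let $K\subset\mathbb C$ be an imaginary quadratic field with ring of integers $\mathcal O_K$ and discriminant $\Delta_K$. All ideals denoted $\mathfrak p$ are nonzero prime ideals of $\mathcal O_K$, $\mathfrak N$ is the absolute norm, $\omega_K(\mathfrak a)$ is the number of prime ideals dividing $\mathfrak a$, $\mu_K$ is the Möbius function on nonzero ideals, and $\phi_K^*(\mathfrak a)=\prod_{\mathfrak p\mid\mathfrak a}(1-1/\mathfrak N\mathfrak p)$. An element $x\in K$ is invertible modulo $\mathfrak a$ if $v_{\mathfrak p}(x)=0$ for all $\mathfrak p\mid\mathfrak a$, and $x\equiv_{\mathfrak a}y$ means $v_{\mathfrak p}(x-y)\ge v_{\mathfrak p}(\mathfrak a)$ for all $\mathfrak p\mid\mathfrak a$. A compact set $S\subset\mathbb C=\mathbb R^2$ is of class $m$ if every line intersects $S$ in at most $m$ single points and intervals and the same holds for all projections of $S$ on linear subspaces. Let $r,s,t\ge 0$ be integers with $r+s\ge 1$, and let $a_0,\dots,a_r,\ b_0,\dots,b_s,\ c_1,\dots,c_t$ be positive integers. Let $G=(V,E)$ be the graph with vertices $A_0,\dots,A_r,B_0,\dots,B_s,C_0,\dots,C_t,D$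 whose edges are those of the triangle $A_0B_0C_0$ and of the paths $A_0-A_r-A_{r-1}-\cdots-A_1-D$, $B_0-B_s-\cdots-B_1-D$ and $C_0-C_t-\cdots-C_1-D$ (a path is $X_0-D$ if it has no further vertices). Let $G'=(V',E')$ be obtained from $G$ by deleting $B_0$ and $C_0$. For $v\in V$ let $\mathcal O_v$ be a nonzero fractional ideal of $K$, such that $$\mathcal O_{A_0}^{a_0}\cdots\mathcal O_{A_r}^{a_r}=\mathcal O_{B_0}^{b_0}\cdots\mathcal O_{B_s}^{b_s}=\mathcal O_{C_0}\mathcal O_{C_1}^{c_1}\cdots\mathcal O_{C_t}^{c_t}=:\mathcal O .$$ Let $\mathcal O_{v*}=\mathcal O_v$ for $v\in\{B_0,C_0\}$, $\mathcal O_{v*}=\mathcal O_v\smallsetminus\{0\}$ for $v\notin\{A_0,B_0,C_0\}$, and let $\mathcal O_{A_0*}$ be either $\mathcal O_{A_0}$ or $\mathcal O_{A_0}\smallsetminus\{0\}$. For $\eta_v\in\mathcal O_v$ write $I_v:=\eta_v\mathcal O_v^{-1}$; write $\eta':=(\eta_v)_{v\in V'}$ and $I':=(I_v)_{v\in V'}$.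 Let $k,m$ be fixed. For every $B>0$ let $\mathcal R(B)\subset\mathbb C^{V'}\times\mathbb C$ be such that for every $\eta'\in\prod_{v\in V'}\mathcal O_{v*}$ the set $\mathcal R(\eta';B)$ of all $z\in\mathbb C$ with $(\eta',z)\in\mathcal R(B)$ is of class $m$ and contained in a union of $k$ closed balls of radius $R(\eta';B)$. Let $M(B)$ be the set of all $(\eta_v)_{v\in V}\in\prod_{v\in V}\mathcal O_{v*}$ such that * $\eta_{A_0}^{a_0}\cdots\eta_{A_r}^{a_r}+\eta_{B_0}^{b_0}\cdots\eta_{B_s}^{b_s}+\eta_{C_0}\eta_{C_1}^{c_1}\cdots\eta_{C_t}^{c_t}=0$; * $\eta_{B_0}\in\mathcal R(\eta';B)$; * $I_v+I_w=\mathcal O_K$ for any two distinct vertices $v,w\in V$ that are not adjacent in $G$, and each prime ideal dividing $I_D$ divides at most one of $I_{A_0},I_{B_0},I_{C_0}$. Put $\Pi(I_A)=\prod_{i=1}^rI_{A_i}^{a_i}$, $\Pi(I_B)=\prod_{i=1}^sI_{B_i}^{b_i}$, $\Pi(I_C)=\prod_{i=1}^tI_{C_i}^{c_i}$, and similarly $\Pi(\eta_A),\Pi(\eta_B)$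 for elements. Put $\Pi'(I_D,I_B)=I_DI_{B_1}\cdots I_{B_{s-1}}$ if $s\ge1$ and $\mathcal O_K$ if $s=0$; put $\Pi'(I_D,I_C)=I_DI_{C_1}\cdots I_{C_{t-1}}$ if $t\ge1$ and $\mathcal O_K$ if $t=0$. Let $\theta_0(I')=\prod_{\mathfrak p}\theta_{0,\mathfrak p}$, where $\theta_{0,\mathfrak p}=1$ if the set $\{v\in V':\mathfrak p\mid I_v\}$ is empty, a single vertex or an edge of $G'$, and $\theta_{0,\mathfrak p}=0$ otherwise. For every $\eta'\in\prod_{v\in V'}\mathcal O_{v*}$ let $\mathfrak A=\mathfrak A(\eta')$ be a nonzero ideal of $\mathcal O_K$, relatively prime to $\Pi'(I_D,I_C)\Pi(I_C)$, and let $\Pi_2=\Pi_2(\eta')\in\mathfrak A\mathcal O_{B_0}$ and $\Pi_1=\Pi_1(\eta')\in\mathcal O(\mathfrak A\mathcal O_{B_0})^{-b_0}$ be such that $\eta_{A_0}^{a_0}\Pi(\eta_A)=\Pi_1\Pi_2^{b_0}$. Then $\Pi_1/\Pi(\eta_B)$ is invertible modulo $\mathfrak c\,\Pi(I_C)$ whenever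 $\theta_0(I')\ne0$, $\mathfrak c\mid\Pi'(I_D,I_C)$ and $\mathfrak c+I_{A_0}\Pi(I_A)\Pi(I_B)=\mathcal O_K$. Moreover, for every $B>0$, $$|M(B)|=\frac{2}{\sqrt{|\Delta_K|}}\sum_{\eta'\in\prod_{v\in V'}\mathcal O_{v*}}\theta_1(\eta')V_1(\eta';B)+O\Bigl(\sum_{\eta'}2^{\omega_K(\Pi'(I_D,I_C))+\omega_K(\Pi'(I_D,I_B)\Pi(I_A))}\,b_0^{\omega_K(I_D\Pi(I_C))}\Bigl(\frac{R(\eta';B)}{\mathfrak N\Pi(I_C)^{1/2}}+1\Bigr)\Bigr),$$ where the sum in the error term runs over all $\eta'\in\prod_{v\in V'}\mathcal O_{v*}$ with $\mathcal R(\eta';B)\neq\emptyset$ and the implicit constant depends only on $K,k,m$ and $\mathcal O_{B_0}$. (If the sum in the error term diverges, nothing is claimed; if it converges, then $M(B)$ is finite and the main term converges absolutely.) Here $$V_1(\eta';B)=\int_{z\in\mathcal R(\eta';B)}\frac{1}{\mathfrak N(\Pi(I_C)\mathcal O_{B_0})}\,dz,$$ $$\theta_1(\eta')=\sum_{\substack{\mathfrak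 c\mid\Pi'(I_D,I_C)\\ \mathfrak c+I_{A_0}\Pi(I_A)\Pi(I_B)=\mathcal O_K}}\frac{\mu_K(\mathfrak c)}{\mathfrak N\mathfrak c}\,\tilde\theta_1(I',\mathfrak c)\,\#\bigl\{\rho\bmod\mathfrak c\Pi(I_C)\text{ invertible}:\ \rho^{b_0}\equiv_{\mathfrak c\Pi(I_C)}-\Pi_1/\Pi(\eta_B)\bigr\},$$ $$\tilde\theta_1(I',\mathfrak c)=\theta_0(I')\,\frac{\phi_K^*(\Pi'(I_D,I_B)\Pi(I_A))}{\phi_K^*(\Pi'(I_D,I_B)+\mathfrak c\,\Pi(I_C))}.$$ -/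

import Mathlib

open NumberField IsDedekindDomain
open scoped nonZeroDivisors

noncomputable section

namespace FirstSummation

/-! ### Sets of class `m` -/

section ClassM

variable {E : Type*} [NormedAddCommGroup E] [InnerProductSpace ℝ E]

/-- Every line `{p + τ v}` (`v ≠ 0`) meets `S` in at most `m` single points and intervals
(order-connected sets of parameters; some of the `m` sets may be empty). -/
def LinesMeetAtMost (m : ℕ) (S : Set E) : Prop :=
  ∀ p v : E, v ≠ 0 → ∃ I : Fin m → Set ℝ,
    (∀ i, (I i).OrdConnected) ∧ {τ : ℝ | p + τ • v ∈ S} = ⋃ i, I i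

/-- `S` is of class `m`: it is compact, every line meets it in at most `m` single points and
intervals, and the same holds for all (orthogonal) projections of `S` on linear subspaces. -/
def IsOfClass [FiniteDimensional ℝ E] (m : ℕ) (S : Set E) : Prop :=
  IsCompact S ∧ LinesMeetAtMost m S ∧
    ∀ W : Submodule ℝ E, LinesMeetAtMost m (W.starProjection '' S)

end ClassM

/-! ### Arithmetic of ideals -/

section Ideals

variable {K : Type*} [Field K] [NumberField K]

/-- `ω_K(𝔞)`: the number of distinct prime ideals dividing `𝔞`. -/
def omegaK (𝔞 : Ideal (𝓞 K)) : ℕ :=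
  {p : HeightOneSpectrum (𝓞 K) | p.asIdeal ∣ 𝔞}.ncard

open Classical in
/-- The Möbius function on nonzero ideals. -/
def moebiusK (𝔞 : Ideal (𝓞 K)) : ℤ :=
  if Squarefree 𝔞 then (-1) ^ omegaK 𝔞 else 0

/-- `φ_K^*(𝔞) = φ_K(𝔞) / N𝔞 = ∏_{p ∣ 𝔞} (1 - 1 / Np)`. -/
def phiStar (𝔞 : Ideal (𝓞 K)) : ℝ :=
  ∏ᶠ (p : HeightOneSpectrum (𝓞 K)) (_ : p.asIdeal ∣ 𝔞),
    (1 - 1 / (Ideal.absNorm p.asIdeal : ℝ))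

/-- `x ∈ K` is invertible modulo `𝔞`: `v_p(x) = 0` for all `p ∣ 𝔞`. -/
def InvertibleMod (𝔞 : Ideal (𝓞 K)) (x : K) : Prop :=
  ∀ p : HeightOneSpectrum (𝓞 K), p.asIdeal ∣ 𝔞 → p.valuation K x = 1

/-- `x ≡ y` modulo `𝔞` for `x y : K`: `v_p(x - y) ≥ v_p(𝔞)` for all `p ∣ 𝔞`, spelled out as
`v_p(x - y) ≥ n` whenever `n ≥ 1` and `p ^ n ∣ 𝔞` (the valuation is written multiplicatively). -/
def CongrMod (𝔞 : Ideal (𝓞 K)) (x y : K) : Prop :=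
  ∀ (p : HeightOneSpectrum (𝓞 K)) (n : ℕ), 1 ≤ n → p.asIdeal ^ n ∣ 𝔞 →
    p.valuation K (x - y) ≤ WithZero.exp (-(n : ℤ))

/-- The number of invertible residue classes `ρ` modulo `𝔞` with `ρ ^ n ≡ x` modulo `𝔞`. -/
def rootCount (𝔞 : Ideal (𝓞 K)) (n : ℕ) (x : K) : ℕ :=
  {u : 𝓞 K ⧸ 𝔞 | ∃ ρ : 𝓞 K, Ideal.Quotient.mk 𝔞 ρ = u ∧
    Ideal.span {ρ} ⊔ 𝔞 = ⊤ ∧ CongrMod 𝔞 ((ρ : K) ^ n) x}.ncard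

/-- The ideal `x J⁻¹` of `𝓞 K`, for `x` in the nonzero fractional ideal `J`. -/
def idealOf (x : K) (J : FractionalIdeal (𝓞 K)⁰ K) : Ideal (𝓞 K) :=
  ((FractionalIdeal.spanSingleton (𝓞 K)⁰ x * J⁻¹ : FractionalIdeal (𝓞 K)⁰ K) :
    Submodule (𝓞 K) K).comap (Algebra.linearMap (𝓞 K) K)

end Ideals

/-! ### The graphs `G` and `G'` -/

/-- The vertices `A_0, …, A_r, B_0, …, B_s, C_0, …, C_t, D` of `G`. -/
inductive Vertex (r s t : ℕ) : Type
  | A (i : Fin (r + 1))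
  | B (i : Fin (s + 1))
  | C (i : Fin (t + 1))
  | D

section Graph

variable {r s t : ℕ}

/-- The edges on each branch, the path `X_0 — X_n — X_{n-1} — ⋯ — X_1 — D`, which is `X_0 — D`
if `n = 0`. This is the part of the path without `D`. -/
def branchEdge {n : ℕ} (i j : Fin (n + 1)) : Prop :=
  (1 ≤ i.val ∧ j.val = i.val + 1) ∨ (i.val = n ∧ j.val = 0)

/-- The edges of `G`, each in one direction. -/
def edge : Vertex r s t → Vertex r s t → Prop
  | .A i, .A j => branchEdge i j
  | .B i, .B j => branchEdge i j
  | .C i, .C j => branchEdge i j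
  | .A i, .D => i.val = min 1 r
  | .B i, .D => i.val = min 1 s
  | .C i, .D => i.val = min 1 t
  | .A i, .B j => i.val = 0 ∧ j.val = 0
  | .A i, .C j => i.val = 0 ∧ j.val = 0
  | .B i, .C j => i.val = 0 ∧ j.val = 0
  | _, _ => False

variable (r s t) in
/-- The graph `G`: the triangle `A_0, B_0, C_0`, each of whose vertices is joined to `D` by its
branch (`fromRel` symmetrizes the relation and drops loops). -/
def graph : SimpleGraph (Vertex r s t) := SimpleGraph.fromRel edge

variable (r s t) in
/-- The vertex set `V' = V ∖ {B_0, C_0}`. -/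
def inner : Set (Vertex r s t) := {v | v ≠ .B 0 ∧ v ≠ .C 0}

variable (r s t) in
/-- The graph `G'`, obtained from `G` by deleting `B_0` and `C_0`. -/
def graph' : SimpleGraph (inner r s t) := (graph r s t).induce (inner r s t)

/-- `A_i` for `0 ≤ i ≤ r` as a vertex of `G'`. -/
def vA (i : Fin (r + 1)) : inner r s t := ⟨.A i, by simp [inner]⟩

/-- `B_{i+1}` for `0 ≤ i < s` as a vertex of `G'`. -/
def vB (i : Fin s) : inner r s t := ⟨.B i.succ, by simp [inner]⟩

/-- `C_{i+1}` for `0 ≤ i < t` as a vertex of `G'`. -/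
def vC (i : Fin t) : inner r s t := ⟨.C i.succ, by simp [inner]⟩

/-- `D` as a vertex of `G'`. -/
def vD : inner r s t := ⟨.D, by simp [inner]⟩

variable {K : Type*} [Field K] [NumberField K]

/-- `J_p(I')`: the set of `v ∈ V'` with `p ∣ I_v`. -/
def divSet (p : HeightOneSpectrum (𝓞 K)) (I : inner r s t → Ideal (𝓞 K)) :
    Set (inner r s t) :=
  {v | p.asIdeal ∣ I v}

open Classical in
/-- `θ_{0,p}(J)`: `1` if `J` is empty, a single vertex or an edge of `G'`, and `0` otherwise. -/
def theta0Local (J : Set (inner r s t)) : ℝ :=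
  if J = ∅ ∨ (∃ v, J = {v}) ∨ ∃ v w, (graph' r s t).Adj v w ∧ J = {v, w} then 1 else 0

/-- `θ_0(I') = ∏_p θ_{0,p}(J_p(I'))`. -/
def theta0 (I : inner r s t → Ideal (𝓞 K)) : ℝ :=
  ∏ᶠ p : HeightOneSpectrum (𝓞 K), theta0Local (divSet p I)

/-- `Π'(I_D, I_{B_1}, …, I_{B_s})`, which is `I_D I_{B_1} ⋯ I_{B_{s-1}}` if `s ≥ 1` and `𝓞 K`
if `s = 0`. -/
def PiB' (I : inner r s t → Ideal (𝓞 K)) : Ideal (𝓞 K) :=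
  if s = 0 then 1 else I vD * ∏ i : Fin s with i.val + 1 < s, I (vB i)

/-- `Π'(I_D, I_{C_1}, …, I_{C_t})`, which is `I_D I_{C_1} ⋯ I_{C_{t-1}}` if `t ≥ 1` and `𝓞 K`
if `t = 0`. -/
def PiC' (I : inner r s t → Ideal (𝓞 K)) : Ideal (𝓞 K) :=
  if t = 0 then 1 else I vD * ∏ i : Fin t with i.val + 1 < t, I (vC i)

end Graph

/-! ### The torsor equation and the set `M(B)` -/

/-- The exponents `a_0, …, a_r`, `b_0, …, b_s`, `c_1, …, c_t` (here `c i` is `c_{i+1}`), the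
nonzero fractional ideals `𝒪_v` of `K` for `v ∈ V` with
`∏ 𝒪_{A_i}^{a_i} = ∏ 𝒪_{B_i}^{b_i} = 𝒪_{C_0} ∏_{i ≥ 1} 𝒪_{C_i}^{c_i}`, and the choice whether
`η_{A_0} = 0` is allowed. -/
structure TorsorData (K : Type*) [Field K] [NumberField K] (r s t : ℕ) where
  a : Fin (r + 1) → ℕ
  b : Fin (s + 1) → ℕ
  c : Fin t → ℕ
  a_pos : ∀ i, 0 < a i
  b_pos : ∀ i, 0 < b i
  c_pos : ∀ i, 0 < c i
  O : Vertex r s t → FractionalIdeal (𝓞 K)⁰ K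
  O_ne_zero : ∀ v, O v ≠ 0
  O_A_eq_O_B : ∏ i, O (.A i) ^ a i = ∏ i, O (.B i) ^ b i
  O_A_eq_O_C : ∏ i, O (.A i) ^ a i = O (.C 0) * ∏ i : Fin t, O (.C i.succ) ^ c i
  allowZero : Prop

namespace TorsorData

variable {K : Type*} [Field K] [NumberField K] {r s t : ℕ} (T : TorsorData K r s t)

/-- The common value `𝒪` of the three products of the fractional ideals `𝒪_v`. -/
def total : FractionalIdeal (𝓞 K)⁰ K := ∏ i, T.O (.A i) ^ T.a i

/-- `𝒪_{v*}`: all of `𝒪_v` for `v = B_0, C_0` (and for `v = A_0`, if this is chosen), the nonzero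
elements of `𝒪_v` otherwise. -/
def coordSet (v : Vertex r s t) : Set K :=
  {x | x ∈ T.O v ∧ (x = 0 → v = .B 0 ∨ v = .C 0 ∨ (v = .A 0 ∧ T.allowZero))}

/-- The product of the `𝒪_{v*}` over `v ∈ V'`. -/
def dom : Set (inner r s t → K) := {η | ∀ v : inner r s t, η v ∈ T.coordSet v.1}

/-- The ideals `I_v = η_v 𝒪_v⁻¹` for `v ∈ V'`. -/
def idealsOf (η : inner r s t → K) (v : inner r s t) : Ideal (𝓞 K) := idealOf (η v) (T.O v.1)

/-- `Π(η_A) = η_{A_1}^{a_1} ⋯ η_{A_r}^{a_r}` for elements, or `Π(I_A)` for ideals. -/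
def PiA {M : Type*} [CommMonoid M] (x : inner r s t → M) : M :=
  ∏ i : Fin r, x (vA i.succ) ^ T.a i.succ

/-- `Π(η_B) = η_{B_1}^{b_1} ⋯ η_{B_s}^{b_s}` for elements, or `Π(I_B)` for ideals. -/
def PiB {M : Type*} [CommMonoid M] (x : inner r s t → M) : M :=
  ∏ i : Fin s, x (vB i) ^ T.b i.succ

/-- `Π(η_C) = η_{C_1}^{c_1} ⋯ η_{C_t}^{c_t}` for elements, or `Π(I_C)` for ideals. -/
def PiC {M : Type*} [CommMonoid M] (x : inner r s t → M) : M :=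
  ∏ i : Fin t, x (vC i) ^ T.c i

/-- The torsor equation. -/
def TorsorEquation (η : Vertex r s t → K) : Prop :=
  ∏ i, η (.A i) ^ T.a i + ∏ i, η (.B i) ^ T.b i
    + η (.C 0) * ∏ i : Fin t, η (.C i.succ) ^ T.c i = 0

/-- The coprimality conditions encoded by `G`, with the additional condition that a prime ideal
dividing `I_D` divides at most one of `I_{A_0}`, `I_{B_0}`, `I_{C_0}`. -/
def Coprimality (η : Vertex r s t → K) : Prop :=
  (∀ v w, v ≠ w → ¬ (graph r s t).Adj v w →
    idealOf (η v) (T.O v) ⊔ idealOf (η w) (T.O w) = ⊤) ∧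
  ∀ p : HeightOneSpectrum (𝓞 K), p.asIdeal ∣ idealOf (η .D) (T.O .D) →
    ∀ v ∈ ({.A 0, .B 0, .C 0} : Set (Vertex r s t)),
    ∀ w ∈ ({.A 0, .B 0, .C 0} : Set (Vertex r s t)),
      p.asIdeal ∣ idealOf (η v) (T.O v) → p.asIdeal ∣ idealOf (η w) (T.O w) → v = w

/-- The fiber `ℛ(η') ⊆ ℂ` over `η'` of a region `ℛ ⊆ ℂ^{V'} × ℂ`, where `K` is embedded in `ℂ`
by `σ`. -/
def fiber (σ : K →+* ℂ) (ℛ : Set ((inner r s t → ℂ) × ℂ)) (η : inner r s t → K) : Set ℂ :=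
  {z | ((fun v => σ (η v)), z) ∈ ℛ}

/-- The set `M(B)`, where `ℛ = ℛ(B)` is the region of the height conditions. -/
def solutions (σ : K →+* ℂ) (ℛ : Set ((inner r s t → ℂ) × ℂ)) : Set (Vertex r s t → K) :=
  {η | (∀ v, η v ∈ T.coordSet v) ∧ T.TorsorEquation η ∧
    σ (η (.B 0)) ∈ fiber σ ℛ (fun v : inner r s t => η v.1) ∧ T.Coprimality η}

/-- `𝔄`, `P₁`, `P₂` are admissible for `η'`: `𝔄` is a nonzero ideal relatively prime to
`Π'(I_D, I_C) Π(I_C)`, and `η_{A_0}^{a_0} Π(η_A) = P₁ P₂^{b_0}` with `P₂ ∈ 𝔄 𝒪_{B_0}` and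
`P₁ ∈ 𝒪 (𝔄 𝒪_{B_0})^{-b_0}`. -/
def Admissible (η : inner r s t → K) (𝔄 : Ideal (𝓞 K)) (P₁ P₂ : K) : Prop :=
  𝔄 ≠ ⊥ ∧ 𝔄 ⊔ PiC' (T.idealsOf η) * T.PiC (T.idealsOf η) = ⊤ ∧
  η (vA 0) ^ T.a 0 * T.PiA η = P₁ * P₂ ^ T.b 0 ∧
  P₂ ∈ (𝔄 : FractionalIdeal (𝓞 K)⁰ K) * T.O (.B 0) ∧
  P₁ ∈ T.total * (((𝔄 : FractionalIdeal (𝓞 K)⁰ K) * T.O (.B 0)) ^ T.b 0)⁻¹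

/-- The ideals `𝔠` in the sum that defines `θ_1`: the divisors of `Π'(I_D, I_C)` that are
relatively prime to `I_{A_0} Π(I_A) Π(I_B)`. -/
def divisorSet (I : inner r s t → Ideal (𝓞 K)) : Set (Ideal (𝓞 K)) :=
  {𝔠 | 𝔠 ∣ PiC' I ∧ 𝔠 ⊔ I (vA 0) * T.PiA I * T.PiB I = ⊤}

/-- `θ̃_1(I', 𝔠)`. The sum of two ideals is their supremum. -/
def thetaTilde1 (I : inner r s t → Ideal (𝓞 K)) (𝔠 : Ideal (𝓞 K)) : ℝ :=
  theta0 I * (phiStar (PiB' I * T.PiA I) / phiStar (PiB' I ⊔ 𝔠 * T.PiC I))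

/-- `θ_1(η')`, which depends on the choice of `P₁ = P₁(η')`. -/
def theta1 (η : inner r s t → K) (P₁ : K) : ℝ :=
  ∑ᶠ 𝔠 ∈ T.divisorSet (T.idealsOf η),
    (moebiusK 𝔠 : ℝ) / (Ideal.absNorm 𝔠 : ℝ) * T.thetaTilde1 (T.idealsOf η) 𝔠 *
      (rootCount (𝔠 * T.PiC (T.idealsOf η)) (T.b 0) (-(P₁ / T.PiB η)) : ℝ)

/-- `V_1(η'; B)`, the integral of `1 / N(Π(I_C) 𝒪_{B_0})` over `ℛ(η'; B)`. -/
def V1 (σ : K →+* ℂ) (ℛ : Set ((inner r s t → ℂ) × ℂ)) (η : inner r s t → K) : ℝ :=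
  ∫ _z in fiber σ ℛ η, 1 / ((FractionalIdeal.absNorm
    (((T.PiC (T.idealsOf η) : Ideal (𝓞 K)) : FractionalIdeal (𝓞 K)⁰ K) * T.O (.B 0)) : ℚ) : ℝ)

/-- The contribution of `η'` to the error term, where `R = R(η'; B)`. -/
def errorTerm (η : inner r s t → K) (R : ℝ) : ℝ :=
  2 ^ (omegaK (PiC' (T.idealsOf η)) + omegaK (PiB' (T.idealsOf η) * T.PiA (T.idealsOf η))) *
    (T.b 0 : ℝ) ^ omegaK (T.idealsOf η vD * T.PiC (T.idealsOf η)) *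
    (R / √(Ideal.absNorm (T.PiC (T.idealsOf η)) : ℝ) + 1)

end TorsorData

end FirstSummation

end

/-!
Eliminating `η_{C_0}` by means of the torsor equation, the points of `M(B)` over a fixed `η'` become
the `z = η_{B_0}` in `𝒪_{B_0}` that lie in the region `ℛ(η'; B)` and satisfy

* the congruence `η_{A_0}^{a_0} Π(η_A) + z^{b_0} Π(η_B) ∈ Π(I_C) 𝒪`, which says that `η_{C_0}` lies
  in `𝒪_{C_0}`;
* the coprimality conditions. Looking at one prime ideal at a time, and using that a prime ideal
  dividing two terms of the torsor equation divides the third, these amount to `θ_0(I') ≠ 0`, to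
  `I_{B_0}` being prime to `E = Π'(I_D, I_B) Π(I_A)` and to `I_{C_0}` being prime to
  `F = Π'(I_D, I_C)` (`localCoprimality_iff`, `TorsorData.coprimality_point_iff`).

Möbius inversion over the squarefree divisors `𝔠` of `F` and `𝔡` of `E` removes the last two
conditions: the congruence is then imposed modulo `𝔠 Π(I_C)`, and `z` is restricted to
`𝔡 𝒪_{B_0}`. If `𝔠` has a common factor with `I_{A_0} Π(I_A) Π(I_B)`, then no solution `z` of the
congruence has `I_{B_0}` prime to `E`. Otherwise `Π_2` generates `𝒪_{B_0}` modulo `𝔠 Π(I_C)`, so `z = ρ Π_2` there with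
`ρ^{b_0} ≡ -Π_1 / Π(η_B)`, and the admissible `z` form one translate of a fractional ideal for each
root `ρ` (`PowerCongruence.form_mem_iff`, `TorsorData.congruence_isGood`). The sums over `𝔡` and `𝔠`
of the main terms give `θ_1(η') V_1(η'; B)` (`PowerCongruence.abs_ncard_sub_finsum_le`).

Each translate is a translate of a lattice in the plane whose shape is bounded in terms of `K` only,
because there are finitely many ideal classes. Slicing the region parallel to a basis of this
lattice counts its points up to `O(R / √N + 1)` (`abs_ncard_int_prod_sub_volume_le`,
`exists_ideal_lattice_bound`).

The error term is uniform in the exponent `b_0`, although there may be far more than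
`b_0^{ω(q)}` roots modulo `q` when `q` has high powers of primes dividing `b_0`. The excess is
compensated: the set of roots is a union of residue classes modulo a divisor `q'` of `q`, and it is
the smaller number of these classes that enters the error term. Estimating the valuation of
`x^b - y^b` gives
`#(classes modulo q')² · N q ≤ (C b^{ω(q)})² · N q'` with `C` depending only on the prime ideals above
`2` and `3` (`exists_root_classes`), which is what the term `R / √N` allows for.

The error term for one `η'` with nonempty fiber is at least `1`, so that the convergence of the sum
of the error terms leaves only finitely many `η'`, and the estimates add up
(`TorsorData.abs_ncard_solutions_sub_tsum_le`).
-/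

noncomputable section

namespace FirstSummation

/-! ### Counting lattice points in the plane by slicing -/

section Davenport

open MeasureTheory Set

/-- Integers versus length on the line. The difference is a sum over unit cells `[n, n + 1)`; a cell
contributes only if one of the intervals ends in it or begins in it, and each interval
ends in at most one cell with its left end point in the interval. -/
lemma abs_ncard_int_sub_volume_le (m : ℕ) (E : Set ℝ) (hE : MeasurableSet E) (N : ℕ)
    (hN : E ⊆ Ico (-(N : ℝ)) N) (I : Fin m → Set ℝ) (hI : ∀ i, (I i).OrdConnected)
    (hEI : E = ⋃ i, I i) :
    |(({n : ℤ | (n : ℝ) ∈ E}).ncard : ℝ) - volume.real E| ≤ m := by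
  classical
  rcases Nat.eq_zero_or_pos m with rfl | hm
  · simp [hEI]
  have : Nonempty (Fin m) := ⟨⟨0, hm⟩⟩
  set F : Finset ℤ := Finset.Ico (-(N : ℤ)) N with hF
  have hvolE : volume E ≠ ⊤ := ne_top_of_le_ne_top (by simp) (measure_mono hN)
  -- cells
  let cell : ℤ → Set ℝ := fun n => E ∩ Ico (n : ℝ) (n + 1)
  have hcell_meas : ∀ n, MeasurableSet (cell n) := fun n => hE.inter measurableSet_Ico
  have hcell_le : ∀ n, volume.real (cell n) ≤ 1 := fun n => by
    calc volume.real (cell n) ≤ volume.real (Ico (n : ℝ) (n + 1)) :=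
          measureReal_mono inter_subset_right (by simp)
      _ = 1 := by simp
  have hEu : E = ⋃ n ∈ F, cell n := by
    ext x
    simp only [cell, mem_iUnion, mem_inter_iff, mem_Ico, exists_prop]
    constructor
    · intro hx
      have h := hN hx
      refine ⟨⌊x⌋, ?_, hx, Int.floor_le x, Int.lt_floor_add_one x⟩
      rw [hF, Finset.mem_Ico, Int.le_floor, Int.floor_lt]
      exact_mod_cast h
    · rintro ⟨n, _, hx, _⟩
      exact hx
  have hvol : volume.real E = ∑ n ∈ F, volume.real (cell n) := by
    conv_lhs => rw [hEu]
    refine measureReal_biUnion_finset ?_ (fun n _ => hcell_meas n) (fun n _ =>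
      ne_top_of_le_ne_top hvolE (measure_mono inter_subset_left))
    intro a _ b _ hab
    refine Disjoint.mono inter_subset_right inter_subset_right ?_
    rw [Set.disjoint_left]
    rintro x ⟨h1, h2⟩ ⟨h3, h4⟩
    apply hab
    have e1 : ⌊x⌋ = a := Int.floor_eq_iff.mpr ⟨h1, h2⟩
    have e2 : ⌊x⌋ = b := Int.floor_eq_iff.mpr ⟨h3, h4⟩
    omega
  have hcount : (({n : ℤ | (n : ℝ) ∈ E}).ncard : ℝ) = ∑ n ∈ F, if (n : ℝ) ∈ E then (1 : ℝ) else 0 := by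
    have : {n : ℤ | (n : ℝ) ∈ E} = ((F.filter fun n : ℤ => (n : ℝ) ∈ E : Finset ℤ) : Set ℤ) := by
      ext n
      simp only [mem_ofPred_eq, Finset.coe_filter, hF, Finset.mem_Ico]
      refine ⟨fun h => ⟨?_, h⟩, fun h => h.2⟩
      have := hN h
      rw [mem_Ico] at this
      exact_mod_cast this
    rw [this, ncard_coe_finset, Finset.sum_ite]
    simp
  -- the two kinds of contributing cells
  let U : Finset ℤ := F.filter fun n => (n : ℝ) ∈ E ∧ ¬ Ico (n : ℝ) (n + 1) ⊆ E
  let V : Finset ℤ := F.filter fun n => (n : ℝ) ∉ E ∧ (cell n).Nonempty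
  have hU : U.card ≤ m := by
    have key : ∀ n ∈ U, ∃ i, (n : ℝ) ∈ I i := by
      intro n hn
      have := (Finset.mem_filter.mp hn).2.1
      rw [hEI] at this
      simpa using this
    choose! f hf using key
    have := Finset.card_le_card_of_injOn (s := U) (t := (Finset.univ : Finset (Fin m))) f
      (fun _ _ => Finset.mem_coe.mpr (Finset.mem_univ _)) ?_
    · simpa using this
    have aux : ∀ a ∈ U, ∀ b ∈ U, f a = f b → ¬ a < b := by
      intro a ha b hb hab hlt
      apply (Finset.mem_filter.mp ha).2.2
      intro x hx
      rw [hEI]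
      refine mem_iUnion.mpr ⟨f a, (hI (f a)).out (hf a ha) (hab ▸ hf b hb) ⟨hx.1, ?_⟩⟩
      have : (a : ℝ) + 1 ≤ b := by exact_mod_cast hlt
      linarith [hx.2]
    intro a ha b hb hab
    exact le_antisymm (not_lt.mp (aux b hb a ha hab.symm)) (not_lt.mp (aux a ha b hb hab))
  have hV : V.card ≤ m := by
    have key : ∀ n ∈ V, ∃ i, ∃ x, x ∈ I i ∧ x ∈ Ico (n : ℝ) (n + 1) := by
      intro n hn
      obtain ⟨x, hx, hx'⟩ := (Finset.mem_filter.mp hn).2.2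
      rw [hEI] at hx
      obtain ⟨i, hi⟩ := mem_iUnion.mp hx
      exact ⟨i, x, hi, hx'⟩
    choose! f y hf using key
    have := Finset.card_le_card_of_injOn (s := V) (t := (Finset.univ : Finset (Fin m))) f
      (fun _ _ => Finset.mem_coe.mpr (Finset.mem_univ _)) ?_
    · simpa using this
    have aux : ∀ a ∈ V, ∀ b ∈ V, f a = f b → ¬ a < b := by
      intro a ha b hb hab hlt
      apply (Finset.mem_filter.mp hb).2.1
      rw [hEI]
      refine mem_iUnion.mpr ⟨f a, (hI (f a)).out (hf a ha).1 (hab ▸ (hf b hb).1)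
        ⟨?_, (hf b hb).2.1⟩⟩
      have : (a : ℝ) + 1 ≤ b := by exact_mod_cast hlt
      linarith [(hf a ha).2.2]
    intro a ha b hb hab
    exact le_antisymm (not_lt.mp (aux b hb a ha hab.symm)) (not_lt.mp (aux a ha b hb hab))
  have hup : ∑ n ∈ F, ((if (n : ℝ) ∈ E then (1 : ℝ) else 0) - volume.real (cell n)) ≤ m := by
    calc _ ≤ ∑ n ∈ F, (if (n : ℝ) ∈ E ∧ ¬ Ico (n : ℝ) (n + 1) ⊆ E then (1 : ℝ) else 0) := by
          refine Finset.sum_le_sum fun n _ => ?_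
          have h0 : 0 ≤ volume.real (cell n) := measureReal_nonneg
          by_cases h1 : (n : ℝ) ∈ E
          · by_cases h2 : Ico (n : ℝ) (n + 1) ⊆ E
            · have : cell n = Ico (n : ℝ) (n + 1) := inter_eq_right.mpr h2
              simp [h1, h2, this]
            · simp [h1, h2, h0]
          · simp [h1, h0]
      _ = U.card := by rw [Finset.sum_ite]; simp [U]
      _ ≤ m := by exact_mod_cast hU
  have hlow : ∑ n ∈ F, (volume.real (cell n) - (if (n : ℝ) ∈ E then (1 : ℝ) else 0)) ≤ m := by
    calc _ ≤ ∑ n ∈ F, (if (n : ℝ) ∉ E ∧ (cell n).Nonempty then (1 : ℝ) else 0) := by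
          refine Finset.sum_le_sum fun n _ => ?_
          have h0 := hcell_le n
          by_cases h1 : (n : ℝ) ∈ E
          · simp [h1, h0]
          · by_cases h2 : (cell n).Nonempty
            · simp [h1, h2, h0]
            · simp [h1, not_nonempty_iff_eq_empty.mp h2]
      _ = V.card := by rw [Finset.sum_ite]; simp [V]
      _ ≤ m := by exact_mod_cast hV
  rw [hcount, hvol, abs_le]
  rw [Finset.sum_sub_distrib] at hup hlow
  constructor <;> linarith

/-- The number of integers in a union of `k` intervals of length `l`. -/
lemma card_int_le_of_subset_iUnion_Icc (k : ℕ) (l : ℝ) (hl : 0 ≤ l) (p : Fin k → ℝ) (F : Finset ℤ)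
    (hF : ∀ n ∈ F, ∃ i, (n : ℝ) ∈ Icc (p i) (p i + l)) : (F.card : ℝ) ≤ k * (l + 1) := by
  classical
  have hsub : F ⊆ Finset.univ.biUnion fun i : Fin k => Finset.Icc ⌈p i⌉ ⌊p i + l⌋ := by
    intro n hn
    obtain ⟨i, h1, h2⟩ := hF n hn
    simp only [Finset.mem_biUnion, Finset.mem_univ, true_and, Finset.mem_Icc]
    exact ⟨i, Int.ceil_le.mpr h1, Int.le_floor.mpr h2⟩
  have hone : ∀ i : Fin k, ((Finset.Icc ⌈p i⌉ ⌊p i + l⌋).card : ℝ) ≤ l + 1 := by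
    intro i
    rw [Int.card_Icc]
    have h1 := Int.floor_le (p i + l)
    have h2 := Int.le_ceil (p i)
    rcases le_total 0 (⌊p i + l⌋ + 1 - ⌈p i⌉) with h | h
    · have : (((⌊p i + l⌋ + 1 - ⌈p i⌉).toNat : ℤ) : ℝ) = ((⌊p i + l⌋ + 1 - ⌈p i⌉ : ℤ) : ℝ) := by
        rw [Int.toNat_of_nonneg h]
      rw [Int.cast_natCast] at this
      rw [this]
      push_cast
      linarith
    · rw [Int.toNat_of_nonpos h]
      simp; linarith
  calc (F.card : ℝ) ≤ (Finset.univ.biUnion fun i : Fin k => Finset.Icc ⌈p i⌉ ⌊p i + l⌋).card := by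
        exact_mod_cast Finset.card_le_card hsub
    _ ≤ ((∑ i : Fin k, (Finset.Icc ⌈p i⌉ ⌊p i + l⌋).card : ℕ) : ℝ) := by
        exact_mod_cast Finset.card_biUnion_le
    _ ≤ ∑ i : Fin k, (l + 1) := by push_cast; exact Finset.sum_le_sum fun i _ => hone i
    _ = k * (l + 1) := by rw [Finset.sum_const, Finset.card_univ, Fintype.card_fin, nsmul_eq_mul]

/-- Davenport's principle in the plane: the number of integral points of a compact set is its area
up to an error controlled by its coordinate projections and the number of intervals in its
coordinate slices. The rows are compared with their lengths, and then the columns, whose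
number of integral points, integrated, is the sum of the lengths of the rows. -/
lemma abs_ncard_int_prod_sub_volume_le (m k : ℕ) (S : Set (ℝ × ℝ)) (hS : IsCompact S)
    (h1 : ∀ a : ℝ, ∃ I : Fin m → Set ℝ, (∀ i, (I i).OrdConnected) ∧ {b | (a, b) ∈ S} = ⋃ i, I i)
    (h2 : ∀ b : ℝ, ∃ I : Fin m → Set ℝ, (∀ i, (I i).OrdConnected) ∧ {a | (a, b) ∈ S} = ⋃ i, I i)
    (l₁ l₂ : ℝ) (hl₁ : 0 ≤ l₁) (hl₂ : 0 ≤ l₂) (p q : Fin k → ℝ)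
    (hp : ∀ x ∈ S, ∃ i, x.1 ∈ Icc (p i) (p i + l₁))
    (hq : ∀ x ∈ S, ∃ i, x.2 ∈ Icc (q i) (q i + l₂)) :
    |(({n : ℤ × ℤ | ((n.1 : ℝ), (n.2 : ℝ)) ∈ S}).ncard : ℝ) - volume.real S| ≤
      m * (k * (l₁ + 1)) + m * (k * l₂) := by
  classical
  obtain ⟨N, hN⟩ : ∃ N : ℕ, ∀ x ∈ S, x.1 ∈ Ico (-(N : ℝ)) N ∧ x.2 ∈ Ico (-(N : ℝ)) N := by
    obtain ⟨r, hr⟩ := hS.isBounded.exists_norm_le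
    obtain ⟨N, hN⟩ := exists_nat_gt r
    refine ⟨N, fun x hx => ?_⟩
    have hx' := hr x hx
    have ha := (norm_fst_le x).trans hx'
    have hb := (norm_snd_le x).trans hx'
    rw [Real.norm_eq_abs, abs_le] at ha hb
    refine ⟨⟨?_, ?_⟩, ?_, ?_⟩ <;> linarith [ha.1, ha.2, hb.1, hb.2]
  set F : Finset ℤ := Finset.Ico (-(N : ℤ)) N with hF
  have hSm : MeasurableSet S := hS.measurableSet
  let row : ℝ → Set ℝ := fun a => {b | (a, b) ∈ S}
  let col : ℝ → Set ℝ := fun b => {a | (a, b) ∈ S}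
  have hrowm : ∀ a, MeasurableSet (row a) := fun a => hSm.preimage measurable_prodMk_left
  have hcolm : ∀ b, MeasurableSet (col b) := fun b => hSm.preimage measurable_prodMk_right
  have hrowN : ∀ a, row a ⊆ Ico (-(N : ℝ)) N := fun a b hb => (hN _ hb).2
  have hcolN : ∀ b, col b ⊆ Ico (-(N : ℝ)) N := fun b a ha => (hN _ ha).1
  have hF1 : ∀ n : ℤ, n ∉ F → row n = ∅ := by
    intro n hn
    rw [← Set.not_nonempty_iff_eq_empty]
    rintro ⟨b, hb⟩
    apply hn
    have := (hN _ hb).1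
    rw [mem_Ico] at this
    rw [hF, Finset.mem_Ico]
    simp only at this
    exact_mod_cast this
  have hrowfin : ∀ a, {n : ℤ | (n : ℝ) ∈ row a}.Finite := fun a => by
    refine F.finite_toSet.subset fun n hn => ?_
    have := hrowN a hn
    rw [mem_Ico] at this
    simp only [hF, Finset.coe_Ico, mem_Ico]
    exact_mod_cast this
  -- count by rows
  have hcount : (({n : ℤ × ℤ | ((n.1 : ℝ), (n.2 : ℝ)) ∈ S}).ncard : ℝ) =
      ∑ a ∈ F, (({n : ℤ | (n : ℝ) ∈ row a}).ncard : ℝ) := by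
    have : {n : ℤ × ℤ | ((n.1 : ℝ), (n.2 : ℝ)) ∈ S} =
        ((F.sigma fun a => (hrowfin a).toFinset).map
          (Equiv.sigmaEquivProd ℤ ℤ).toEmbedding : Finset (ℤ × ℤ)) := by
      ext ⟨a, b⟩
      simp only [mem_ofPred_eq, Finset.coe_map, mem_image, Finset.mem_coe, Finset.mem_sigma,
        Finite.mem_toFinset, Equiv.coe_toEmbedding, Sigma.exists]
      constructor
      · intro h
        refine ⟨a, b, ⟨?_, h⟩, rfl⟩
        by_contra hc
        have : (b : ℝ) ∈ row a := h
        rw [hF1 a hc] at this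
        exact this
      · rintro ⟨a', b', ⟨_, h⟩, he⟩
        simp only [Equiv.sigmaEquivProd_apply, Prod.mk.injEq] at he
        rw [← he.1, ← he.2]
        exact h
    rw [this, ncard_coe_finset, Finset.card_map, Finset.card_sigma]
    push_cast
    refine Finset.sum_congr rfl fun a _ => ?_
    rw [Set.ncard_eq_toFinset_card _ (hrowfin a)]
  have hstep1 : |∑ a ∈ F, (({n : ℤ | (n : ℝ) ∈ row a}).ncard : ℝ) -
      ∑ a ∈ F, volume.real (row a)| ≤ m * (k * (l₁ + 1)) := by
    let F' : Finset ℤ := F.filter fun a => (row (a : ℝ)).Nonempty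
    have hF' : (F'.card : ℝ) ≤ k * (l₁ + 1) := by
      refine card_int_le_of_subset_iUnion_Icc k l₁ hl₁ p F' fun n hn => ?_
      obtain ⟨b, hb⟩ := (Finset.mem_filter.mp hn).2
      exact hp _ hb
    rw [← Finset.sum_sub_distrib]
    calc |∑ a ∈ F, ((({n : ℤ | (n : ℝ) ∈ row a}).ncard : ℝ) - volume.real (row a))|
        ≤ ∑ a ∈ F, |(({n : ℤ | (n : ℝ) ∈ row a}).ncard : ℝ) - volume.real (row a)| :=
          Finset.abs_sum_le_sum_abs _ _
      _ ≤ ∑ a ∈ F, if (row (a : ℝ)).Nonempty then (m : ℝ) else 0 := by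
          refine Finset.sum_le_sum fun a _ => ?_
          by_cases h : (row (a : ℝ)).Nonempty
          · rw [if_pos h]
            obtain ⟨I, hI, hE⟩ := h1 a
            exact abs_ncard_int_sub_volume_le m _ (hrowm a) N (hrowN a) I hI hE
          · rw [if_neg h, not_nonempty_iff_eq_empty.mp h]
            simp
      _ = F'.card * m := by rw [Finset.sum_ite]; simp [F']
      _ ≤ m * (k * (l₁ + 1)) := by rw [mul_comm]; gcongr
  -- the sum of the row lengths is the integral of the column counts
  have hcolfin : ∀ b, {n : ℤ | (n : ℝ) ∈ col b} = ((F.filter fun n : ℤ => (n : ℝ) ∈ col b :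
      Finset ℤ) : Set ℤ) := fun b => by
    ext n
    simp only [mem_ofPred_eq, Finset.coe_filter]
    refine ⟨fun h => ⟨?_, h⟩, fun h => h.2⟩
    by_contra hc
    have : b ∈ row n := h
    rw [hF1 n hc] at this
    exact this
  have hrowfinvol : ∀ a, volume (row a) ≠ ⊤ := fun a =>
    ne_top_of_le_ne_top (by simp) (measure_mono (hrowN a))
  have hint : ∀ a : ℤ, Integrable (fun b => (row (a : ℝ)).indicator (fun _ => (1 : ℝ)) b) :=
    fun a => (integrable_indicator_iff (hrowm a)).mpr
      (integrableOn_const (hrowfinvol a))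
  have hcolint : ∀ b, (({n : ℤ | (n : ℝ) ∈ col b}).ncard : ℝ) =
      ∑ a ∈ F, (row (a : ℝ)).indicator (fun _ => (1 : ℝ)) b := by
    intro b
    rw [hcolfin b, ncard_coe_finset, Finset.card_filter]
    push_cast
    refine Finset.sum_congr rfl fun a _ => ?_
    simp only [Set.indicator_apply]
    rfl
  have hsum : ∑ a ∈ F, volume.real (row a) = ∫ b, (({n : ℤ | (n : ℝ) ∈ col b}).ncard : ℝ) := by
    simp_rw [hcolint]
    rw [integral_finsetSum _ fun a _ => hint a]
    refine Finset.sum_congr rfl fun a _ => ?_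
    rw [integral_indicator_const _ (hrowm a)]
    simp
  have hcolI : Integrable fun b => (({n : ℤ | (n : ℝ) ∈ col b}).ncard : ℝ) := by
    simp_rw [hcolint]
    exact integrable_finsetSum _ fun a _ => hint a
  have hSfin : volume S ≠ ⊤ := hS.measure_lt_top.ne
  have hvolI : Integrable fun b => volume.real (col b) := by
    have := (Measure.integrable_measure_prodMk_left (μ := (volume : Measure ℝ))
      (ν := (volume : Measure ℝ)) (hSm.preimage measurable_swap) ?_)
    · exact this
    · rw [(Measure.measurePreserving_swap (μ := (volume : Measure ℝ)) (ν := (volume : Measure ℝ))).measure_preimage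
        hSm.nullMeasurableSet]
      exact hSfin
  have hvol : volume.real S = ∫ b, volume.real (col b) := by
    have e1 : volume S = ∫⁻ b, volume (col b) := by
      rw [Measure.volume_eq_prod, Measure.prod_apply_symm hSm]
      rfl
    rw [Measure.real, e1, integral_eq_lintegral_of_nonneg_ae
      (Filter.Eventually.of_forall fun b => measureReal_nonneg) hvolI.1]
    congr 1
    refine lintegral_congr fun b => ?_
    rw [Measure.real, ENNReal.ofReal_toReal]
    exact ne_top_of_le_ne_top (by simp) (measure_mono (hcolN b))
  have hstep2 : |∑ a ∈ F, volume.real (row a) - volume.real S| ≤ m * (k * l₂) := by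
    rw [hsum, hvol, ← integral_sub hcolI hvolI]
    let Q : Set ℝ := ⋃ i : Fin k, Icc (q i) (q i + l₂)
    have hQm : MeasurableSet Q := MeasurableSet.iUnion fun i => measurableSet_Icc
    have hQle : volume Q ≤ ENNReal.ofReal (k * l₂) := by
      calc volume Q ≤ ∑ i : Fin k, volume (Icc (q i) (q i + l₂)) := measure_iUnion_fintype_le _ _
        _ = ENNReal.ofReal (k * l₂) := by
          simp [ENNReal.ofReal_mul]
    have hQfin : volume Q ≠ ⊤ := ne_top_of_le_ne_top ENNReal.ofReal_ne_top hQle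
    have hQr : volume.real Q ≤ k * l₂ :=
      ENNReal.toReal_le_of_le_ofReal (by positivity) hQle
    have hbound : ∀ b, ‖(({n : ℤ | (n : ℝ) ∈ col b}).ncard : ℝ) - volume.real (col b)‖ ≤
        Q.indicator (fun _ => (m : ℝ)) b := by
      intro b
      rw [Real.norm_eq_abs]
      by_cases hb : b ∈ Q
      · rw [indicator_of_mem hb]
        obtain ⟨I, hI, hE⟩ := h2 b
        exact abs_ncard_int_sub_volume_le m _ (hcolm b) N (hcolN b) I hI hE
      · rw [indicator_of_notMem hb]
        have : col b = ∅ := by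
          rw [← not_nonempty_iff_eq_empty]
          rintro ⟨a, ha⟩
          obtain ⟨i, hi⟩ := hq _ ha
          exact hb (mem_iUnion.mpr ⟨i, hi⟩)
        simp [this]
    calc _ ≤ ∫ b, Q.indicator (fun _ => (m : ℝ)) b :=
          norm_integral_le_of_norm_le ((integrable_indicator_iff hQm).mpr
            (integrableOn_const hQfin)) (Filter.Eventually.of_forall hbound)
      _ = volume.real Q * m := by rw [integral_indicator_const _ hQm]; simp
      _ ≤ m * (k * l₂) := by rw [mul_comm]; gcongr
  rw [hcount]
  calc _ ≤ _ := abs_sub_le _ (∑ a ∈ F, volume.real (row a)) _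
    _ ≤ _ := add_le_add hstep1 hstep2

end Davenport

/-! ### Counting elements of fractional ideals in plane regions -/

section PlaneLattice

open MeasureTheory Set

/-- A set in the plane that meets each line in at most `m` intervals and lies in `k` balls of
radius `R` contains the expected number of points of a translate of `ℤ u + ℤ v`. -/
lemma finite_and_abs_ncard_lattice_sub_volume_le (m k : ℕ) (S : Set ℂ) (hS : IsCompact S)
    (hm : LinesMeetAtMost m S) (R : ℝ) (hR : 0 ≤ R) (p : Fin k → ℂ)
    (hp : S ⊆ ⋃ i, Metric.closedBall (p i) R) (x u v : ℂ)
    (D : ℝ) (hD : D = u.re * v.im - v.re * u.im) (hD0 : D ≠ 0) :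
    {n : ℤ × ℤ | x + n.1 * u + n.2 * v ∈ S}.Finite ∧
    |(({n : ℤ × ℤ | x + n.1 * u + n.2 * v ∈ S}).ncard : ℝ) - (volume.real S / |D|)| ≤
      m * k * (1 + 2 * R * (‖u‖ + ‖v‖) / |D|) := by
  have hDpos : 0 < |D| := abs_pos.mpr hD0
  have hu0 : u ≠ 0 := by rintro rfl; simp at hD; exact hD0 hD
  have hv0 : v ≠ 0 := by rintro rfl; simp at hD; exact hD0 hD
  let T : ℝ × ℝ → ℂ := fun w => x + w.1 * u + w.2 * v
  have hTc : Continuous T := by fun_prop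
  -- the two coordinates
  have hcoord1 : ∀ w : ℝ × ℝ, ((T w - x) * (starRingEnd ℂ) v).im = - (w.1 * D) := by
    intro w
    simp [T, hD]
    ring
  have hcoord2 : ∀ w : ℝ × ℝ, ((T w - x) * (starRingEnd ℂ) u).im = w.2 * D := by
    intro w
    simp [T, hD]
    ring
  have hproj : ∀ (y : ℂ) (f : ℝ × ℝ → ℝ) (ε : ℝ) (_ : |ε| = 1)
      (_ : ∀ w, ((T w - x) * (starRingEnd ℂ) y).im = ε * (f w * D)) (w : ℝ × ℝ) (_ : w ∈ T ⁻¹' S),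
      ∃ i, f w ∈ Icc (((p i - x) * (starRingEnd ℂ) y).im * ε / D - R * ‖y‖ / |D|)
        (((p i - x) * (starRingEnd ℂ) y).im * ε / D - R * ‖y‖ / |D| + 2 * (R * ‖y‖ / |D|)) := by
    intro y f ε hε hf w hw
    obtain ⟨i, hi⟩ := mem_iUnion.mp (hp hw)
    rw [Metric.mem_closedBall, dist_eq_norm] at hi
    refine ⟨i, ?_⟩
    have hε2 : ε * ε = 1 := by
      rw [← abs_mul_abs_self, hε]; norm_num
    have e1 : f w - ((p i - x) * (starRingEnd ℂ) y).im * ε / D =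
        ((T w - p i) * (starRingEnd ℂ) y).im * ε / D := by
      have : ((T w - p i) * (starRingEnd ℂ) y).im =
          ((T w - x) * (starRingEnd ℂ) y).im - ((p i - x) * (starRingEnd ℂ) y).im := by
        rw [← Complex.sub_im]; congr 1; ring
      rw [this, hf, eq_div_iff hD0, sub_mul, div_mul_cancel₀ _ hD0]
      linear_combination -(f w * D) * hε2
    have e2 : |f w - ((p i - x) * (starRingEnd ℂ) y).im * ε / D| ≤ R * ‖y‖ / |D| := by
      rw [e1, abs_div, abs_mul, hε, mul_one]
      gcongr
      calc _ ≤ ‖(T w - p i) * (starRingEnd ℂ) y‖ := Complex.abs_im_le_norm _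
        _ = ‖T w - p i‖ * ‖y‖ := by rw [norm_mul, RCLike.norm_conj]
        _ ≤ R * ‖y‖ := by gcongr
    rw [abs_le] at e2
    constructor <;> linarith [e2.1, e2.2]
  have hbdd : ∃ N : ℝ, ∀ w ∈ T ⁻¹' S, |w.1| ≤ N ∧ |w.2| ≤ N := by
    obtain ⟨r, hr⟩ := hS.isBounded.exists_norm_le
    have aux : ∀ (y : ℂ) (f : ℝ × ℝ → ℝ) (_ : ∀ w, |((T w - x) * (starRingEnd ℂ) y).im| = |f w| * |D|)
        (w : ℝ × ℝ) (_ : w ∈ T ⁻¹' S), |f w| ≤ (|r| + ‖x‖) * ‖y‖ / |D| := by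
      intro y f hf w hw
      rw [le_div_iff₀ hDpos, ← hf]
      calc _ ≤ ‖(T w - x) * (starRingEnd ℂ) y‖ := Complex.abs_im_le_norm _
        _ = ‖T w - x‖ * ‖y‖ := by rw [norm_mul, RCLike.norm_conj]
        _ ≤ (|r| + ‖x‖) * ‖y‖ := by
          gcongr
          exact (norm_sub_le _ _).trans (by gcongr; exact (hr _ hw).trans (le_abs_self _))
    refine ⟨(|r| + ‖x‖) * (‖u‖ + ‖v‖) / |D|, fun w hw => ⟨?_, ?_⟩⟩
    · refine (aux v (fun w => w.1) (fun w => ?_) w hw).trans ?_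
      · rw [hcoord1, abs_neg, abs_mul]
      · gcongr; linarith [norm_nonneg u]
    · refine (aux u (fun w => w.2) (fun w => ?_) w hw).trans ?_
      · rw [hcoord2, abs_mul]
      · gcongr; linarith [norm_nonneg v]
  obtain ⟨N, hN⟩ := hbdd
  have hS'c : IsCompact (T ⁻¹' S) := by
    refine Metric.isCompact_of_isClosed_isBounded (hS.isClosed.preimage hTc) ?_
    rw [isBounded_iff_forall_norm_le]
    exact ⟨N, fun w hw => by rw [Prod.norm_def]; exact max_le (hN w hw).1 (hN w hw).2⟩
  have hset : {n : ℤ × ℤ | x + n.1 * u + n.2 * v ∈ S} =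
      {n : ℤ × ℤ | ((n.1 : ℝ), (n.2 : ℝ)) ∈ T ⁻¹' S} := by
    ext n; simp [T]
  have hfin : {n : ℤ × ℤ | x + n.1 * u + n.2 * v ∈ S}.Finite := by
    rw [hset]
    refine ((finite_Icc (-⌈N⌉) ⌈N⌉).prod (finite_Icc (-⌈N⌉) ⌈N⌉)).subset fun n hn => ?_
    have h := hN _ hn
    simp only [abs_le] at h
    have hc := Int.le_ceil N
    refine ⟨⟨?_, ?_⟩, ?_, ?_⟩ <;> · rw [← Int.cast_le (R := ℝ)]; push_cast; linarith [h.1.1, h.1.2, h.2.1, h.2.2]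
  refine ⟨hfin, ?_⟩
  have hvol : volume.real (T ⁻¹' S) = volume.real S / |D| := by
    let A : ℝ × ℝ →ₗ[ℝ] ℝ × ℝ :=
      Matrix.toLin (Module.Basis.finTwoProd ℝ) (Module.Basis.finTwoProd ℝ) !![u.re, v.re; u.im, v.im]
    have hA : LinearMap.det A = D := by
      rw [LinearMap.det_toLin, Matrix.det_fin_two_of, hD]
    have hT : T ⁻¹' S = A ⁻¹' (Complex.measurableEquivRealProd.symm ⁻¹' ((fun z => x + z) ⁻¹' S)) := by
      ext w
      simp only [mem_preimage]
      have : T w = x + Complex.measurableEquivRealProd.symm (A w) := by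
        rw [Matrix.toLin_finTwoProd_apply]
        apply Complex.ext <;> simp [T, Complex.measurableEquivRealProd] <;> ring
      rw [this]
    have hm1 : MeasurableSet ((fun z => x + z) ⁻¹' S) :=
      hS.measurableSet.preimage (measurable_const_add x)
    have h1 : volume (Complex.measurableEquivRealProd.symm ⁻¹' ((fun z => x + z) ⁻¹' S)) = volume S := by
      rw [(Complex.volume_preserving_equiv_real_prod.symm).measure_preimage hm1.nullMeasurableSet,
        measure_preimage_add]
    rw [Measure.real, hT, Measure.addHaar_preimage_linearMap _ (by rw [hA]; exact hD0), h1, hA,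
      ENNReal.toReal_mul, ENNReal.toReal_ofReal (abs_nonneg _), abs_inv, Measure.real]
    field_simp
  have key := abs_ncard_int_prod_sub_volume_le m k (T ⁻¹' S) hS'c ?_ ?_
    (2 * (R * ‖v‖ / |D|)) (2 * (R * ‖u‖ / |D|)) (by positivity) (by positivity)
    (fun i => ((p i - x) * (starRingEnd ℂ) v).im * (-1) / D - R * ‖v‖ / |D|)
    (fun i => ((p i - x) * (starRingEnd ℂ) u).im * 1 / D - R * ‖u‖ / |D|)
    (fun w hw => hproj v (fun w => w.1) (-1) (by simp) (fun w => by rw [hcoord1]; ring) w hw)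
    (fun w hw => hproj u (fun w => w.2) 1 (by simp) (fun w => by rw [hcoord2]; ring) w hw)
  · rw [hset, ← hvol]
    refine key.trans (le_of_eq ?_)
    ring
  · intro a
    obtain ⟨I, hI, hE⟩ := hm (x + a * u) v hv0
    exact ⟨I, hI, by rw [← hE]; ext b; simp [T]⟩
  · intro b
    obtain ⟨I, hI, hE⟩ := hm (x + b * v) u hu0
    refine ⟨I, hI, ?_⟩
    rw [← hE]; ext a; simp only [T, mem_preimage, mem_ofPred_eq, Complex.real_smul]
    rw [add_right_comm]

end PlaneLattice

section IdealLattice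

open MeasureTheory Set

variable {K : Type*} [Field K] [NumberField K]

/-- The two complex embeddings of an imaginary quadratic field. -/
lemma exists_embeddings_equiv (hdeg : Module.finrank ℚ K = 2) (him : IsTotallyComplex K)
    (σ : K →+* ℂ) : ∃ e : Fin 2 ≃ (K →ₐ[ℚ] ℂ), (∀ x, e 0 x = σ x) ∧
      ∀ x, e 1 x = (starRingEnd ℂ) (σ x) := by
  have hne : σ ≠ ComplexEmbedding.conjugate σ := by
    intro h
    have := him.isComplex (InfinitePlace.mk σ)
    rw [InfinitePlace.isComplex_mk_iff] at this
    exact this h.symm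
  let f : Fin 2 → (K →ₐ[ℚ] ℂ) := ![σ.toRatAlgHom, (ComplexEmbedding.conjugate σ).toRatAlgHom]
  have hcard : Fintype.card (Fin 2) = Fintype.card (K →ₐ[ℚ] ℂ) := by
    rw [AlgHom.card, hdeg, Fintype.card_fin]
  have hinj : Function.Injective f := by
    have h01 : f 0 ≠ f 1 := by
      intro h
      apply hne
      ext x
      exact DFunLike.congr_fun h x
    intro i j hij
    fin_cases i <;> fin_cases j <;> simp_all
  exact ⟨Equiv.ofBijective f ((Fintype.bijective_iff_injective_and_card f).mpr ⟨hinj, hcard⟩),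
    fun x => rfl, fun x => rfl⟩

lemma absNorm_spanSingleton_eq (hdeg : Module.finrank ℚ K = 2) (him : IsTotallyComplex K)
    (σ : K →+* ℂ) (x : K) :
    ((FractionalIdeal.absNorm (FractionalIdeal.spanSingleton (𝓞 K)⁰ x) : ℚ) : ℝ) = ‖σ x‖ ^ 2 := by
  obtain ⟨e, he0, he1⟩ := exists_embeddings_equiv hdeg him σ
  have h := Algebra.norm_eq_prod_embeddings ℚ ℂ x
  rw [← e.prod_comp, Fin.prod_univ_two, he0, he1, Complex.mul_conj'] at h
  rw [FractionalIdeal.absNorm_span_singleton]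
  have h2 : ((Algebra.norm ℚ x : ℚ) : ℝ) = ‖σ x‖ ^ 2 := by
    have : (((Algebra.norm ℚ x : ℚ) : ℝ) : ℂ) = ((‖σ x‖ ^ 2 : ℝ) : ℂ) := by
      push_cast
      simpa using h
    exact_mod_cast this
  push_cast
  rw [h2, abs_of_nonneg (by positivity)]

/-- A `ℤ`-basis of a fractional ideal together with its covolume, which is computed from the
discriminant. -/
lemma exists_basis_covolume (hdeg : Module.finrank ℚ K = 2) (him : IsTotallyComplex K)
    (σ : K →+* ℂ) (J : (FractionalIdeal (𝓞 K)⁰ K)ˣ) :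
    ∃ u v : K, (∀ z : K, z ∈ J.1 ↔ ∃ n : ℤ × ℤ, z = n.1 * u + n.2 * v) ∧
      (∀ n n' : ℤ × ℤ, (n.1 * u + n.2 * v : K) = n'.1 * u + n'.2 * v → n = n') ∧
      |(σ u).re * (σ v).im - (σ v).re * (σ u).im| =
        √|(NumberField.discr K : ℝ)| / 2 * (FractionalIdeal.absNorm J.1 : ℚ) := by
  classical
  obtain ⟨e, he0, he1⟩ := exists_embeddings_equiv hdeg him σ
  have hcJ : Fintype.card (Fin 2) = Fintype.card (Module.Free.ChooseBasisIndex ℤ J.1) := by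
    rw [← Module.finrank_eq_card_chooseBasisIndex, fractionalIdeal_rank, RingOfIntegers.rank, hdeg,
      Fintype.card_fin]
  have hcO : Fintype.card (Module.Free.ChooseBasisIndex ℤ (𝓞 K)) = Fintype.card (Fin 2) := by
    rw [← Module.finrank_eq_card_chooseBasisIndex, RingOfIntegers.rank, hdeg, Fintype.card_fin]
  let eJ := Fintype.equivOfCardEq hcJ
  let eO := Fintype.equivOfCardEq hcO
  have hdet := det_basisOfFractionalIdeal_eq_absNorm K J (eO.trans eJ)
  set B := basisOfFractionalIdeal K J with hB
  set b := B.reindex eJ.symm with hb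
  refine ⟨b 0, b 1, ?_, ?_, ?_⟩
  · intro z
    have h1 := mem_span_basisOfFractionalIdeal K (I := J) (x := z)
    have hr : Set.range (basisOfFractionalIdeal K J) = Set.range b := by
      rw [hb, Module.Basis.range_reindex]
    rw [hr] at h1
    have hr2 : Set.range b = {b 0, b 1} := by
      ext y
      simp [Fin.exists_fin_two, eq_comm]
    rw [hr2, Submodule.mem_span_pair] at h1
    change z ∈ (J : Set K) ↔ _
    rw [← h1]
    simp [Prod.exists, eq_comm]
  · intro n n' h
    have hli := b.linearIndependent
    rw [Fintype.linearIndependent_iff] at hli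
    have := hli ![(n.1 - n'.1 : ℚ), (n.2 - n'.2 : ℚ)] (by
      simp [Fin.sum_univ_two, Algebra.smul_def]
      linear_combination h)
    have h0 := this 0
    have h1 := this 1
    simp only [Matrix.cons_val_zero, Matrix.cons_val_one, sub_eq_zero] at h0 h1
    ext
    · exact_mod_cast h0
    · exact_mod_cast h1
  · -- compare the two discriminants
    let c := (integralBasis K).reindex eO
    have hdisc : Algebra.discr ℚ b = (c.toMatrix b).det ^ 2 * Algebra.discr ℚ c := by
      have := Algebra.discr_of_matrix_vecMul (A := ℚ) c (c.toMatrix b)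
      rwa [Module.Basis.toMatrix_map_vecMul] at this
    have hc : Algebra.discr ℚ c = (NumberField.discr K : ℚ) := by
      rw [coe_discr]
      simp only [c, Module.Basis.coe_reindex]
      exact Algebra.discr_reindex ℚ _ _
    have hdet2 : |(c.toMatrix b).det| = FractionalIdeal.absNorm J.1 := by
      rw [← hdet, Module.Basis.det_apply]
      congr 1
      rw [← Matrix.det_submatrix_equiv_self eO]
      congr 1
      ext i j
      simp [c, hb, Module.Basis.toMatrix_apply]
    have hemb := Algebra.discr_eq_det_embeddingsMatrixReindex_pow_two ℚ ℂ b e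
    have hdd : (Algebra.embeddingsMatrixReindex ℚ ℂ b e).det =
        -(2 * Complex.I) * ((σ (b 0)).re * (σ (b 1)).im - (σ (b 1)).re * (σ (b 0)).im : ℝ) := by
      rw [Matrix.det_fin_two]
      simp only [Algebra.embeddingsMatrixReindex, Algebra.embeddingsMatrix, Matrix.reindex_apply,
        Matrix.submatrix_apply, Matrix.of_apply, Equiv.refl_symm, Equiv.coe_refl, id, Equiv.symm_symm,
        he0, he1]
      apply Complex.ext
      · simp
      · simp
        ring
    rw [hdd, hdisc, hc] at hemb
    set D := (σ (b 0)).re * (σ (b 1)).im - (σ (b 1)).re * (σ (b 0)).im with hDdef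
    set q : ℚ := (c.toMatrix b).det with hq
    have hreal : (q : ℝ) ^ 2 * (NumberField.discr K : ℝ) = - (4 * D ^ 2) := by
      have : ((((q : ℚ) : ℝ) ^ 2 * (NumberField.discr K : ℝ) : ℝ) : ℂ) =
          ((- (4 * D ^ 2) : ℝ) : ℂ) := by
        rw [mul_pow, neg_sq, mul_pow, Complex.I_sq] at hemb
        push_cast
        simp only [eq_ratCast, Rat.cast_mul, Rat.cast_pow, Rat.cast_intCast] at hemb
        rw [hemb]
        ring
      exact_mod_cast this
    have hN : ((FractionalIdeal.absNorm J.1 : ℚ) : ℝ) ^ 2 = (q : ℝ) ^ 2 := by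
      rw [← hdet2]; push_cast; rw [sq_abs]
    have hNn : (0 : ℝ) ≤ ((FractionalIdeal.absNorm J.1 : ℚ) : ℝ) := by
      exact_mod_cast FractionalIdeal.absNorm_nonneg J.1
    rw [← sq_eq_sq₀ (abs_nonneg _) (by positivity), sq_abs, mul_pow, div_pow, Real.sq_sqrt (abs_nonneg _), hN]
    have h3 : |(q : ℝ) ^ 2 * (NumberField.discr K : ℝ)| = 4 * D ^ 2 := by
      rw [hreal, abs_neg, abs_of_nonneg (by positivity)]
    rw [abs_mul, abs_of_nonneg (sq_nonneg _)] at h3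
    linarith

/-- The number of elements of a translate of a fractional ideal in a plane region, uniformly over
all fractional ideals: they are multiples of finitely many, so that the shape of the
lattices `σ(J)` is bounded. -/
theorem exists_ideal_lattice_bound (hdeg : Module.finrank ℚ K = 2) (him : IsTotallyComplex K)
    (σ : K →+* ℂ) (k m : ℕ) :
    ∃ C : ℝ, 0 < C ∧ ∀ (J : FractionalIdeal (𝓞 K)⁰ K) (_ : J ≠ 0) (x : K) (S : Set ℂ)
      (_ : IsCompact S) (_ : LinesMeetAtMost m S) (R : ℝ) (_ : 0 ≤ R) (p : Fin k → ℂ)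
      (_ : S ⊆ ⋃ i, Metric.closedBall (p i) R),
      {z : K | z - x ∈ J ∧ σ z ∈ S}.Finite ∧
      |({z : K | z - x ∈ J ∧ σ z ∈ S}.ncard : ℝ) -
        2 / √|(NumberField.discr K : ℝ)| * (volume.real S / (FractionalIdeal.absNorm J : ℚ))| ≤
        C * (R / √((FractionalIdeal.absNorm J : ℚ) : ℝ) + 1) := by
  classical
  let G := (FractionalIdeal (𝓞 K)⁰ K)ˣ ⧸ (toPrincipalIdeal (𝓞 K) K).range
  have : Fintype G := Fintype.ofEquiv _ (ClassGroup.equiv (R := 𝓞 K) K).toEquiv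
  choose u v hmem hinj hcov using exists_basis_covolume hdeg him σ
  let Δ : ℝ := √|(NumberField.discr K : ℝ)|
  have hΔ : 0 < Δ := Real.sqrt_pos.mpr (abs_pos.mpr (by exact_mod_cast NumberField.discr_ne_zero K))
  let N : FractionalIdeal (𝓞 K)⁰ K → ℝ := fun J => ((FractionalIdeal.absNorm J : ℚ) : ℝ)
  have hNpos : ∀ J, J ≠ 0 → 0 < N J := by
    intro J hJ
    have h1 := FractionalIdeal.absNorm_nonneg J
    have h2 : FractionalIdeal.absNorm J ≠ 0 := by
      rw [Ne, FractionalIdeal.absNorm_eq_zero_iff]; exact hJ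
    have : (0 : ℚ) < FractionalIdeal.absNorm J := lt_of_le_of_ne h1 h2.symm
    exact Rat.cast_pos.mpr this
  let c : (FractionalIdeal (𝓞 K)⁰ K)ˣ → ℝ := fun I =>
    2 * (‖σ (u I)‖ + ‖σ (v I)‖) / (Δ / 2 * N I) * √(N I)
  have hc0 : ∀ I, 0 ≤ c I := fun I => by
    have := hNpos I.1 I.ne_zero
    positivity
  refine ⟨m * k * (1 + ∑ g : G, c (Quotient.out g)) + 1, ?_, ?_⟩
  · have : 0 ≤ ∑ g : G, c (Quotient.out g) := Finset.sum_nonneg fun g _ => hc0 _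
    positivity
  intro J hJ x S hS hm R hR p hp
  obtain ⟨⟨h, a, ha⟩, hI⟩ := QuotientGroup.mk_out_eq_mul (toPrincipalIdeal (𝓞 K) K).range (Units.mk0 J hJ)
  set g : G := ((Units.mk0 J hJ : (FractionalIdeal (𝓞 K)⁰ K)ˣ) : G) with hg
  set I := Quotient.out g with hIdef
  -- `J = α I`
  obtain ⟨α, hα0, hJI⟩ : ∃ α : K, α ≠ 0 ∧ J = FractionalIdeal.spanSingleton (𝓞 K)⁰ α * I.1 := by
    refine ⟨(a⁻¹ : Kˣ), Units.ne_zero _, ?_⟩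
    have h1 : (I : (FractionalIdeal (𝓞 K)⁰ K)ˣ) = Units.mk0 J hJ * h := hI
    rw [h1, ← ha, Units.val_mul, coe_toPrincipalIdeal, Units.val_mk0, mul_comm J, ← mul_assoc,
      FractionalIdeal.spanSingleton_mul_spanSingleton]
    simp
  have hσα : 0 < ‖σ α‖ := by
    rw [norm_pos_iff]; exact (map_ne_zero σ).mpr hα0
  have hNJ : N J = ‖σ α‖ ^ 2 * N I.1 := by
    simp only [N]
    rw [hJI, map_mul]
    push_cast
    rw [absNorm_spanSingleton_eq hdeg him σ]
  set D := (σ (α * u I)).re * (σ (α * v I)).im - (σ (α * v I)).re * (σ (α * u I)).im with hD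
  have hDeq : |D| = Δ / 2 * N J := by
    have : D = ‖σ α‖ ^ 2 * ((σ (u I)).re * (σ (v I)).im - (σ (v I)).re * (σ (u I)).im) := by
      rw [hD, ← Complex.normSq_eq_norm_sq, Complex.normSq_apply, map_mul, map_mul]
      simp only [Complex.mul_re, Complex.mul_im]
      ring
    rw [this, abs_mul, hcov, abs_of_nonneg (by positivity), hNJ]
    ring
  have hNJpos := hNpos J hJ
  have hNIpos := hNpos I.1 I.ne_zero
  have hD0 : D ≠ 0 := by
    rw [← abs_pos, hDeq]; positivity
  obtain ⟨hfin, hbound⟩ := finite_and_abs_ncard_lattice_sub_volume_le m k S hS hm R hR p hp (σ x)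
    (σ (α * u I)) (σ (α * v I)) D hD hD0
  let f : ℤ × ℤ → K := fun n => x + n.1 * (α * u I) + n.2 * (α * v I)
  have hfinj : Function.Injective f := by
    intro n n' hnn
    apply hinj I
    apply mul_left_cancel₀ hα0
    simp only [f] at hnn
    linear_combination hnn
  have himg : {z : K | z - x ∈ J ∧ σ z ∈ S} =
      f '' {n : ℤ × ℤ | σ x + n.1 * σ (α * u I) + n.2 * σ (α * v I) ∈ S} := by
    have hmemJ : ∀ z, z ∈ J ↔ ∃ n : ℤ × ℤ, z = n.1 * (α * u I) + n.2 * (α * v I) := by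
      intro z
      rw [hJI, FractionalIdeal.mem_singleton_mul]
      constructor
      · rintro ⟨y, hy, rfl⟩
        obtain ⟨n, rfl⟩ := (hmem I y).mp hy
        exact ⟨n, by ring⟩
      · rintro ⟨n, rfl⟩
        exact ⟨n.1 * u I + n.2 * v I, (hmem I _).mpr ⟨n, rfl⟩, by ring⟩
    ext z
    simp only [mem_ofPred_eq, mem_image, hmemJ]
    constructor
    · rintro ⟨⟨n, hn⟩, hz⟩
      have hzf : f n = z := by simp only [f]; linear_combination -hn
      refine ⟨n, ?_, hzf⟩
      rw [← hzf] at hz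
      simpa [f] using hz
    · rintro ⟨n, hn, rfl⟩
      refine ⟨⟨n, by simp only [f]; ring⟩, by simpa [f] using hn⟩
  rw [himg]
  refine ⟨hfin.image f, ?_⟩
  rw [ncard_image_of_injective _ hfinj]
  have hmain : 2 / √|(NumberField.discr K : ℝ)| * (volume.real S / (FractionalIdeal.absNorm J : ℚ)) =
      volume.real S / |D| := by
    rw [hDeq]
    change 2 / Δ * (volume.real S / N J) = _
    field_simp
  rw [hmain]
  refine hbound.trans ?_
  have hce : 2 * R * (‖σ (α * u I)‖ + ‖σ (α * v I)‖) / |D| = c I * (R / √(N J)) := by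
    rw [hDeq, hNJ, Real.sqrt_mul (by positivity), Real.sqrt_sq hσα.le, map_mul, map_mul, norm_mul,
      norm_mul]
    simp only [c]
    have : √(N I.1) ≠ 0 := (Real.sqrt_pos.mpr hNIpos).ne'
    have := hΔ.ne'
    have := hσα.ne'
    have := hNIpos.ne'
    field_simp
  rw [hce]
  have hcs : c I ≤ ∑ g : G, c (Quotient.out g) :=
    Finset.single_le_sum (f := fun g : G => c (Quotient.out g)) (fun g _ => hc0 _) (Finset.mem_univ g)
  set s := ∑ g : G, c (Quotient.out g)
  have hs0 : 0 ≤ s := (hc0 I).trans hcs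
  have hq : 0 ≤ R / √(N J) := by positivity
  change _ ≤ (m * k * (1 + s) + 1) * (R / √(N J) + 1)
  have hmk : (0 : ℝ) ≤ m * k := by positivity
  calc m * k * (1 + c I * (R / √(N J))) ≤ m * k * ((1 + s) * (R / √(N J) + 1)) := by
        gcongr
        nlinarith [mul_le_mul_of_nonneg_right hcs hq]
    _ ≤ _ := by
        rw [← mul_assoc]
        gcongr
        linarith

end IdealLattice

/-! ### Valuations of differences of powers -/

section PowSub

lemma exists_add_pow_prime_eq_add {R : Type*} [CommRing R] (x y : R) {l : ℕ} (hl : l.Prime) :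
    ∃ s : R, (x + y) ^ l - x ^ l = l * y * (x ^ (l - 1) + y * s) + y ^ l := by
  obtain ⟨n, rfl⟩ : ∃ n, l = n + 2 := ⟨l - 2, by have := hl.two_le; omega⟩
  have hdvd : ((n + 2 : ℕ) : R) * y ^ 2 ∣
      ∑ k ∈ Finset.range n, x ^ (k + 1) * y ^ (n + 2 - (k + 1)) * ((n + 2).choose (k + 1) : R) := by
    refine Finset.dvd_sum fun k hk => ?_
    rw [Finset.mem_range] at hk
    have h1 : n + 2 ∣ (n + 2).choose (k + 1) := hl.dvd_choose_self (by omega) (by omega)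
    have h2 : y ^ 2 ∣ y ^ (n + 2 - (k + 1)) := pow_dvd_pow _ (by omega)
    obtain ⟨a, ha⟩ := h1
    obtain ⟨c, hc⟩ := h2
    rw [ha, hc]
    exact ⟨x ^ (k + 1) * c * a, by push_cast; ring⟩
  obtain ⟨s, hs⟩ := hdvd
  refine ⟨s, ?_⟩
  rw [add_pow, Finset.sum_range_succ, Finset.sum_range_succ, Finset.sum_range_succ', hs]
  have e1 : n + 2 - (n + 1) = 1 := by omega
  have e2 : (n + 2).choose (n + 1) = n + 2 := Nat.choose_succ_self_right (n + 1)
  have e3 : n + 2 - 1 = n + 1 := rfl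
  simp only [e1, e2, e3, Nat.sub_self, pow_zero, Nat.choose_self, Nat.choose_zero_right, pow_one,
    Nat.sub_zero]
  push_cast
  ring

variable {R : Type*} [CommRing R] [IsDedekindDomain R]

/-- Lifting the exponent: close to a unit the power map `x ↦ x ^ b` scales distances by the
absolute value of `b`. -/
lemma intValuation_add_pow_sub_pow (P : HeightOneSpectrum R) (b : ℕ) :
    ∀ x y : R, P.intValuation x = 1 → P.intValuation y < 1 →
      (∀ l : ℕ, l.Prime → P.intValuation y ^ (l - 1) < P.intValuation (l : R)) →
      P.intValuation ((x + y) ^ b - x ^ b) = P.intValuation (b : R) * P.intValuation y := by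
  induction b using Nat.recOnMul with
  | zero => intro x y _ _ _; simp
  | one => intro x y _ _ _; simp
  | prime l hl =>
    intro x y hx hy hyl
    rcases eq_or_ne y 0 with rfl | hy0
    · simp
    have hy0' : 0 < P.intValuation y := by
      rw [zero_lt_iff]; exact P.intValuation_ne_zero y hy0
    obtain ⟨s, hs⟩ := exists_add_pow_prime_eq_add x y hl
    have hl0 : 0 < P.intValuation (l : R) := (zero_le.trans_lt (hyl l hl))
    have h1 : P.intValuation (x ^ (l - 1) + y * s) = 1 := by
      rw [Valuation.map_add_eq_of_lt_left, map_pow, hx, one_pow]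
      rw [map_pow, hx, one_pow, map_mul]
      exact (mul_le_of_le_one_right' (P.intValuation_le_one s)).trans_lt hy
    have h2 : P.intValuation (l * y * (x ^ (l - 1) + y * s)) =
        P.intValuation (l : R) * P.intValuation y := by
      rw [map_mul, map_mul, h1, mul_one]
    rw [hs, Valuation.map_add_eq_of_lt_left, h2]
    rw [h2, map_pow, ← pow_sub_one_mul hl.ne_zero]
    exact mul_lt_mul_of_pos_right (hyl l hl) hy0'
  | mul a b iha ihb =>
    intro x y hx hy hyl
    have ha := iha x y hx hy hyl
    have hle : P.intValuation ((x + y) ^ a - x ^ a) ≤ P.intValuation y := by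
      rw [ha]
      exact mul_le_of_le_one_left' (P.intValuation_le_one _)
    have hb := ihb (x ^ a) ((x + y) ^ a - x ^ a) (by rw [map_pow, hx, one_pow])
      (hle.trans_lt hy) (fun l hl => (pow_le_pow_left' hle _).trans_lt (hyl l hl))
    rw [add_sub_cancel, ← pow_mul, ← pow_mul, ha] at hb
    rw [hb, Nat.cast_mul, map_mul, mul_left_comm, mul_assoc]

end PowSub

/-! ### Counting residue classes -/

section Classes

variable {R : Type*} [CommRing R]

lemma ncard_mk_image_le_of_forall (I J : Ideal R) [Finite (R ⧸ J)] (A : Set R)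
    (h : ∀ x ∈ A, ∀ y ∈ A, x - y ∈ J → x - y ∈ I) (t : Set (R ⧸ J))
    (ht : ∀ x ∈ A, Ideal.Quotient.mk J x ∈ t) :
    (Ideal.Quotient.mk I '' A).ncard ≤ t.ncard := by
  have hch : ∀ u ∈ Ideal.Quotient.mk I '' A, ∃ x ∈ A, Ideal.Quotient.mk I x = u := fun u hu => hu
  choose! f hf using hch
  refine Set.ncard_le_ncard_of_injOn (fun u => Ideal.Quotient.mk J (f u))
    (fun u hu => ht _ (hf u hu).1) ?_ (Set.toFinite t)
  intro u hu v hv huv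
  have h1 := h _ (hf u hu).1 _ (hf v hv).1 (Ideal.Quotient.eq.mp huv)
  rw [← (hf u hu).2, ← (hf v hv).2]
  exact Ideal.Quotient.eq.mpr h1

lemma ncard_mk_image_mul_le (I J : Ideal R) (A : Set R) [Finite (R ⧸ I)] [Finite (R ⧸ J)]
    (B C : Set R) (hB : A ⊆ B) (hC : A ⊆ C) (L : Ideal R) (hL : I ⊓ J ≤ L) :
    (Ideal.Quotient.mk L '' A).ncard ≤
      (Ideal.Quotient.mk I '' B).ncard * (Ideal.Quotient.mk J '' C).ncard := by
  have hch : ∀ u ∈ Ideal.Quotient.mk L '' A, ∃ x ∈ A, Ideal.Quotient.mk L x = u := fun u hu => hu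
  choose! f hf using hch
  rw [← Set.ncard_prod]
  refine Set.ncard_le_ncard_of_injOn
    (fun u => (Ideal.Quotient.mk I (f u), Ideal.Quotient.mk J (f u)))
    (fun u hu => ⟨⟨_, hB (hf u hu).1, rfl⟩, ⟨_, hC (hf u hu).1, rfl⟩⟩) ?_ (Set.toFinite _)
  intro u hu v hv huv
  simp only [Prod.mk.injEq] at huv
  rw [← (hf u hu).2, ← (hf v hv).2]
  exact Ideal.Quotient.eq.mpr (hL ⟨Ideal.Quotient.eq.mp huv.1, Ideal.Quotient.eq.mp huv.2⟩)

/-- A set that is a union of classes modulo `J` is a union of `[J : I]` times as many classes modulo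
a smaller ideal `I`. -/
lemma ncard_mk_image_mul_card_eq (I J : Ideal R) [Finite (R ⧸ I)] (hIJ : I ≤ J) (A : Set R)
    (hA : ∀ x ∈ A, ∀ y, y - x ∈ J → y ∈ A) :
    (Ideal.Quotient.mk I '' A).ncard * Nat.card (R ⧸ J) =
      (Ideal.Quotient.mk J '' A).ncard * Nat.card (R ⧸ I) := by
  classical
  have : Finite (R ⧸ J) := Finite.of_surjective _ (Ideal.Quotient.factor_surjective hIJ)
  have := Fintype.ofFinite (R ⧸ I)
  have := Fintype.ofFinite (R ⧸ J)
  let f := Ideal.Quotient.factor hIJ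
  have hf : ∀ x, f (Ideal.Quotient.mk I x) = Ideal.Quotient.mk J x := fun x => rfl
  set κ := (Finset.univ.filter fun u => f u = 0).card
  -- all fibres have the same size
  have hfib : ∀ w : R ⧸ J, (Finset.univ.filter fun u => f u = w).card = κ := by
    intro w
    obtain ⟨u₀, hu₀⟩ := Ideal.Quotient.factor_surjective hIJ w
    refine Finset.card_bij (fun u _ => u - u₀) ?_ ?_ ?_
    · intro u hu
      simp only [Finset.mem_filter, Finset.mem_univ, true_and] at hu ⊢
      rw [map_sub, hu, ← hu₀]
      exact sub_self _
    · intro u _ v _ h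
      exact sub_left_injective h
    · intro v hv
      simp only [Finset.mem_filter, Finset.mem_univ, true_and] at hv
      refine ⟨v + u₀, ?_, by simp⟩
      simp only [Finset.mem_filter, Finset.mem_univ, true_and]
      rw [map_add, hv, zero_add]
      exact hu₀
  have hcount : ∀ t : Set (R ⧸ J), (f ⁻¹' t).ncard = t.ncard * κ := by
    intro t
    rw [Set.ncard_eq_toFinset_card' t, Set.ncard_eq_toFinset_card' (f ⁻¹' t),
      Finset.card_eq_sum_card_fiberwise (f := f) (t := t.toFinset), Finset.sum_const_nat]
    · intro w hw
      rw [← hfib w]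
      congr 1
      ext u
      simp only [Finset.mem_filter, Set.mem_toFinset, Set.mem_preimage, Finset.mem_univ, true_and,
        and_iff_right_iff_imp]
      rintro rfl
      simpa using hw
    · intro u hu
      simpa using hu
  have h1 : (Ideal.Quotient.mk I '' A) = f ⁻¹' (Ideal.Quotient.mk J '' A) := by
    ext u
    obtain ⟨y, rfl⟩ := Ideal.Quotient.mk_surjective u
    constructor
    · rintro ⟨x, hx, hxy⟩
      exact ⟨x, hx, by rw [← hf, hxy]⟩
    · rintro ⟨x, hx, hxy⟩
      rw [hf] at hxy
      exact ⟨y, hA x hx y (Ideal.Quotient.eq.mp hxy.symm), rfl⟩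
  have h2 : Nat.card (R ⧸ I) = Nat.card (R ⧸ J) * κ := by
    have := hcount Set.univ
    rwa [Set.preimage_univ, Set.ncard_univ, Set.ncard_univ] at this
  rw [h1, hcount, h2]
  ring

end Classes

/-! ### Roots modulo ideals of a quadratic field -/

section LocalRoots

variable {K : Type*} [Field K] [NumberField K]

lemma exists_prime_mem (P : HeightOneSpectrum (𝓞 K)) :
    ∃ p : ℕ, p.Prime ∧ (p : 𝓞 K) ∈ P.asIdeal := by
  have key : ∀ n : ℕ, n ≠ 0 → (n : 𝓞 K) ∈ P.asIdeal →
      ∃ p : ℕ, p.Prime ∧ (p : 𝓞 K) ∈ P.asIdeal := by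
    intro n
    induction n using Nat.recOnMul with
    | zero => intro h; exact absurd rfl h
    | one =>
      intro _ h
      rw [Nat.cast_one] at h
      exact absurd ((Ideal.eq_top_iff_one _).mpr h) P.isPrime.ne_top
    | prime p hp => intro _ h; exact ⟨p, hp, h⟩
    | mul a b iha ihb =>
      intro h0 h
      rw [Nat.cast_mul] at h
      rcases P.isPrime.mem_or_mem h with h | h
      · exact iha (left_ne_zero_of_mul h0) h
      · exact ihb (right_ne_zero_of_mul h0) h
  refine key (Ideal.absNorm P.asIdeal) ?_ (Ideal.absNorm_mem _)
  rw [Ne, Ideal.absNorm_eq_zero_iff]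
  exact P.ne_bot

lemma absNorm_pow_dvd_sq (hdeg : Module.finrank ℚ K = 2) (P : HeightOneSpectrum (𝓞 K)) {n v : ℕ}
    (h : (n : 𝓞 K) ∈ P.asIdeal ^ v) : Ideal.absNorm P.asIdeal ^ v ∣ n ^ 2 := by
  have h1 : Ideal.span {(n : 𝓞 K)} ≤ P.asIdeal ^ v := by
    rwa [Ideal.span_singleton_le_iff_mem]
  have h2 := Ideal.absNorm_dvd_absNorm_of_le h1
  rwa [Ideal.absNorm_span_natCast, RingOfIntegers.rank, hdeg, map_pow] at h2

lemma exists_intValuation_eq_exp {R : Type*} [CommRing R] [IsDedekindDomain R]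
    (P : HeightOneSpectrum R) {r : R} (hr : r ≠ 0) :
    ∃ c : ℕ, P.intValuation r = WithZero.exp (-(c : ℤ)) ∧ ∀ n : ℕ, r ∈ P.asIdeal ^ n ↔ n ≤ c := by
  refine ⟨_, P.intValuation_if_neg hr, fun n => ?_⟩
  rw [← P.intValuation_le_pow_iff_mem, P.intValuation_if_neg hr, WithZero.exp_le_exp]
  omega

lemma exp_neg_two_le_intValuation (hdeg : Module.finrank ℚ K = 2) (P : HeightOneSpectrum (𝓞 K))
    {p : ℕ} (hp : p.Prime) (hpP : (p : 𝓞 K) ∈ P.asIdeal) :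
    WithZero.exp (-2 : ℤ) ≤ P.intValuation (p : 𝓞 K) := by
  have hp0 : (p : 𝓞 K) ≠ 0 := by exact_mod_cast hp.ne_zero
  obtain ⟨c, hc, hmem⟩ := exists_intValuation_eq_exp P hp0
  rw [hc, WithZero.exp_le_exp]
  by_contra hcon
  have h3 := absNorm_pow_dvd_sq hdeg P ((hmem 3).mpr (by omega))
  have h1 : Ideal.absNorm P.asIdeal ∣ p ^ 2 := by
    simpa using absNorm_pow_dvd_sq hdeg P (v := 1) (by rwa [pow_one])
  obtain ⟨i, hi, hNi⟩ := (Nat.dvd_prime_pow hp).mp h1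
  rw [hNi, ← pow_mul, Nat.pow_dvd_pow_iff_le_right hp.one_lt] at h3
  have : i = 0 := by omega
  rw [this, pow_zero, Ideal.absNorm_eq_one_iff] at hNi
  exact P.isPrime.ne_top hNi

lemma intValuation_natCast_eq_one (P : HeightOneSpectrum (𝓞 K)) {p n : ℕ}
    (hp : p.Prime) (hpP : (p : 𝓞 K) ∈ P.asIdeal) (hpn : ¬ p ∣ n) :
    P.intValuation (n : 𝓞 K) = 1 := by
  rw [HeightOneSpectrum.intValuation_eq_one_iff]
  intro hn
  have hc : IsCoprime (p : ℤ) (n : ℤ) :=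
    Nat.isCoprime_iff_coprime.mpr ((Nat.Prime.coprime_iff_not_dvd hp).mpr hpn)
  obtain ⟨x, y, hxy⟩ := hc
  apply P.isPrime.ne_top
  rw [Ideal.eq_top_iff_one]
  have : (1 : 𝓞 K) = (x : 𝓞 K) * p + y * n := by exact_mod_cast hxy.symm
  rw [this]
  exact Ideal.add_mem _ (Ideal.mul_mem_left _ _ hpP) (Ideal.mul_mem_left _ _ hn)

open Classical in
/-- The roots of a unit modulo `P ^ n` are a union of classes modulo some `P ^ j`. If `b` is
divisible by the residue characteristic, there may be more than `b` roots modulo `P ^ n`, but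
only because `j` can then be chosen smaller than `n`. -/
lemma exists_prime_pow_classes (hdeg : Module.finrank ℚ K = 2) (P : HeightOneSpectrum (𝓞 K))
    {n b : ℕ} (hn : 1 ≤ n) (hb : b ≠ 0) (ρ₀ : 𝓞 K) (hρ₀ : ρ₀ ∉ P.asIdeal) :
    ∃ j, 1 ≤ j ∧ j ≤ n ∧
      (∀ ρ ρ', ρ ^ b - ρ₀ ^ b ∈ P.asIdeal ^ n → ρ' - ρ ∈ P.asIdeal ^ j →
        ρ' ^ b - ρ₀ ^ b ∈ P.asIdeal ^ n) ∧
      (Ideal.Quotient.mk (P.asIdeal ^ j) '' {ρ | ρ ^ b - ρ₀ ^ b ∈ P.asIdeal ^ n}).ncard ^ 2 *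
          Ideal.absNorm P.asIdeal ^ n ≤
        ((if (6 : 𝓞 K) ∈ P.asIdeal then 729 else 1) * b) ^ 2 * Ideal.absNorm P.asIdeal ^ j := by
  obtain ⟨p, hp, hpP⟩ := exists_prime_mem P
  set N := Ideal.absNorm P.asIdeal with hNdef
  -- `i₀` is large enough for lifting the exponent in the ball `ρ + P ^ i₀`: the valuation of `p` at
  -- `P` is at most `2`, so that `i₀ (p - 1) > 2` is sufficient
  set i₀ : ℕ := if p ≤ 3 then 3 else 1 with hi₀
  have hi₀1 : 1 ≤ i₀ := by rw [hi₀]; split_ifs <;> norm_num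
  have hi₀p : 2 < i₀ * (p - 1) := by
    have := hp.two_le
    rw [hi₀]; split_ifs <;> omega
  have hb0 : (b : 𝓞 K) ≠ 0 := by exact_mod_cast hb
  obtain ⟨v, hv, hvmem⟩ := exists_intValuation_eq_exp P hb0
  set A := {ρ | ρ ^ b - ρ₀ ^ b ∈ P.asIdeal ^ n} with hA
  have hPn : P.asIdeal ^ n ≤ P.asIdeal := Ideal.pow_le_self (by omega)
  have hAunit : ∀ ρ ∈ A, ρ ∉ P.asIdeal := by
    intro ρ hρ hmem
    apply hρ₀
    have h1 : ρ ^ b ∈ P.asIdeal := Ideal.pow_mem_of_mem _ hmem b (Nat.pos_of_ne_zero hb)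
    have h2 := (Submodule.sub_mem_iff_right _ h1).mp (hPn hρ)
    exact P.isPrime.mem_of_pow_mem b h2
  have hLTE : ∀ x y : 𝓞 K, x ∉ P.asIdeal → y ∈ P.asIdeal ^ i₀ →
      P.intValuation ((x + y) ^ b - x ^ b) = WithZero.exp (-(v : ℤ)) * P.intValuation y := by
    intro x y hx hy
    have hy1 : P.intValuation y < 1 := by
      rw [P.intValuation_lt_one_iff_mem]
      exact Ideal.pow_le_self (by omega) hy
    rw [← hv]
    refine intValuation_add_pow_sub_pow P b x y (HeightOneSpectrum.intValuation_eq_one_iff.mpr hx)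
      hy1 fun l hl => ?_
    by_cases hlp : l = p
    · subst hlp
      rw [← P.intValuation_le_pow_iff_mem] at hy
      calc P.intValuation y ^ (l - 1) ≤ WithZero.exp (-(i₀ : ℤ)) ^ (l - 1) :=
            pow_le_pow_left' hy _
        _ = WithZero.exp (-((i₀ * (l - 1) : ℕ) : ℤ)) := by
            rw [← WithZero.exp_nsmul, nsmul_eq_mul]
            push_cast
            ring_nf
        _ < WithZero.exp (-2 : ℤ) := by
            rw [WithZero.exp_lt_exp]; omega
        _ ≤ _ := exp_neg_two_le_intValuation hdeg P hl hpP
    · rw [intValuation_natCast_eq_one P hp hpP (fun h => hlp ((Nat.prime_dvd_prime_iff_eq hp hl).mp h).symm)]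
      exact pow_lt_one' hy1 (by have := hl.two_le; omega)
  set j := max (min n i₀) (n - v) with hj
  have hj1 : 1 ≤ j := by omega
  have hjn : j ≤ n := by omega
  have hmono : ∀ {i i' : ℕ}, i ≤ i' → P.asIdeal ^ i' ≤ P.asIdeal ^ i := fun h => Ideal.pow_le_pow_right h
  refine ⟨j, hj1, hjn, ?_, ?_⟩
  · intro ρ ρ' hρ hd
    have hsplit : ρ' ^ b - ρ₀ ^ b = (ρ' ^ b - ρ ^ b) + (ρ ^ b - ρ₀ ^ b) := by ring
    rw [hsplit]
    refine Ideal.add_mem _ ?_ hρ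
    rcases eq_or_lt_of_le hjn with hjn' | hjn'
    · rw [hjn'] at hd
      exact Ideal.mem_of_dvd _ (sub_dvd_pow_sub_pow ρ' ρ b) hd
    · have h1 := hLTE ρ (ρ' - ρ) (hAunit ρ hρ) (hmono (by omega) hd)
      rw [add_sub_cancel] at h1
      rw [← P.intValuation_le_pow_iff_mem] at hd ⊢
      rw [h1]
      calc _ ≤ WithZero.exp (-(v : ℤ)) * WithZero.exp (-(j : ℤ)) := mul_le_mul_right hd _
        _ = WithZero.exp (-(v : ℤ) + -(j : ℤ)) := by rw [WithZero.exp_add]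
        _ ≤ _ := by rw [WithZero.exp_le_exp]; omega
  · have hkey : ∀ x ∈ A, ∀ y ∈ A, x - y ∈ P.asIdeal ^ (min n i₀) → x - y ∈ P.asIdeal ^ j := by
      intro x hx y hy hd
      rcases le_total n i₀ with hni | hni
      · rw [min_eq_left hni] at hd
        exact hmono hjn hd
      · rw [min_eq_right hni] at hd
        rcases eq_or_ne (x - y) 0 with h0 | h0
        · rw [h0]; exact Ideal.zero_mem _
        obtain ⟨c, hc, hcmem⟩ := exists_intValuation_eq_exp P h0
        have h1 := hLTE y (x - y) (hAunit y hy) hd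
        have h2 : x ^ b - y ^ b ∈ P.asIdeal ^ n := by
          have : x ^ b - y ^ b = (x ^ b - ρ₀ ^ b) - (y ^ b - ρ₀ ^ b) := by ring
          rw [this]; exact Ideal.sub_mem _ hx hy
        rw [add_sub_cancel, hc, ← WithZero.exp_add] at h1
        rw [← P.intValuation_le_pow_iff_mem, h1, WithZero.exp_le_exp] at h2
        rw [hcmem] at hd ⊢
        omega
    have hfinq : ∀ i : ℕ, Finite (𝓞 K ⧸ P.asIdeal ^ i) := fun i =>
      Ideal.finiteQuotientOfFreeOfNeBot _ (pow_ne_zero _ P.ne_bot)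
    obtain ⟨a, b', hb', hbb'⟩ := Nat.exists_eq_pow_mul_and_not_dvd hb p hp.ne_one
    have hb'0 : b' ≠ 0 := by rintro rfl; exact hb' (dvd_zero p)
    -- the number of classes: if `p ≤ 3`, all `N ^ 3 ≤ 9 ^ 3 = 729` classes modulo `P ^ 3` are counted;
    -- otherwise the classes modulo `P`, where raising to the power `p ^ a` is injective
    have hM : (Ideal.Quotient.mk (P.asIdeal ^ j) '' A).ncard ≤
        (if (6 : 𝓞 K) ∈ P.asIdeal then 729 else 1) * b' := by
      by_cases hp3 : p ≤ 3
      · have h6 : (6 : 𝓞 K) ∈ P.asIdeal := by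
          have hp6 : p ∣ 6 := by
            have := hp.two_le
            interval_cases p <;> norm_num
          have : ((p : 𝓞 K)) ∣ ((6 : ℕ) : 𝓞 K) := Nat.cast_dvd_cast hp6
          exact Ideal.mem_of_dvd _ (by exact_mod_cast this) hpP
        rw [if_pos h6]
        have := hfinq (min n i₀)
        have hN9 : N ≤ 9 := by
          have h1 : N ∣ p ^ 2 := by
            simpa using absNorm_pow_dvd_sq hdeg P (v := 1) (by rwa [pow_one])
          exact (Nat.le_of_dvd (pow_pos hp.pos 2) h1).trans (Nat.pow_le_pow_left hp3 2)
        have hN0 : 0 < N := Nat.pos_of_ne_zero (by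
          rw [hNdef, Ne, Ideal.absNorm_eq_zero_iff]; exact P.ne_bot)
        calc _ ≤ (Set.univ : Set (𝓞 K ⧸ P.asIdeal ^ (min n i₀))).ncard :=
              ncard_mk_image_le_of_forall _ _ A hkey _ (fun _ _ => Set.mem_univ _)
          _ = N ^ (min n i₀) := by
              rw [Set.ncard_univ, ← Submodule.cardQuot_apply, ← Ideal.absNorm_apply, map_pow]
          _ ≤ N ^ 3 := Nat.pow_le_pow_right hN0 (by rw [hi₀, if_pos hp3]; exact min_le_right _ _)
          _ ≤ 9 ^ 3 := Nat.pow_le_pow_left hN9 3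
          _ ≤ 729 * b' := by omega
      · have hi1 : min n i₀ = 1 := by rw [hi₀, if_neg hp3]; omega
        have := hfinq 1
        have hmax : (P.asIdeal ^ 1).IsPrime := by rw [pow_one]; exact P.isPrime
        have : Fact p.Prime := ⟨hp⟩
        have : CharP (𝓞 K ⧸ P.asIdeal ^ 1) p := by
          rw [CharP.charP_iff_prime_eq_zero hp, ← map_natCast (Ideal.Quotient.mk (P.asIdeal ^ 1)),
            Ideal.Quotient.eq_zero_iff_mem, pow_one]
          exact hpP
        rw [hi1] at hkey
        let c : 𝓞 K ⧸ P.asIdeal ^ 1 := Ideal.Quotient.mk _ ρ₀ ^ b'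
        have hle : (Ideal.Quotient.mk (P.asIdeal ^ j) '' A).ncard ≤ b' := by
          classical
          calc _ ≤ ((Polynomial.nthRoots b' c).toFinset : Set (𝓞 K ⧸ P.asIdeal ^ 1)).ncard := by
                refine ncard_mk_image_le_of_forall _ _ A hkey _ fun x hx => ?_
                rw [Finset.mem_coe, Multiset.mem_toFinset,
                  Polynomial.mem_nthRoots (Nat.pos_of_ne_zero hb'0)]
                have h1 : (Ideal.Quotient.mk (P.asIdeal ^ 1) x) ^ b -
                    (Ideal.Quotient.mk (P.asIdeal ^ 1) ρ₀) ^ b = 0 := by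
                  rw [← map_pow, ← map_pow, ← map_sub, Ideal.Quotient.eq_zero_iff_mem]
                  exact hmono hn hx
                rw [hbb', mul_comm (p ^ a), pow_mul, pow_mul, ← sub_pow_char_pow] at h1
                exact sub_eq_zero.mp (eq_zero_of_pow_eq_zero h1)
            _ ≤ b' := by
                rw [Set.ncard_coe_finset]
                exact (Multiset.toFinset_card_le _).trans (Polynomial.card_nthRoots _ _)
        split_ifs <;> omega
    have hNv : N ^ v ≤ (p ^ a) ^ 2 := by
      have h1 : ((p ^ a : ℕ) : 𝓞 K) ∈ P.asIdeal ^ v := by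
        rw [← P.intValuation_le_pow_iff_mem, ← hv, hbb', Nat.cast_mul, map_mul,
          intValuation_natCast_eq_one P hp hpP hb', mul_one]
      exact Nat.le_of_dvd (by have := hp.pos; positivity) (absNorm_pow_dvd_sq hdeg P h1)
    have hN0 : 0 < N := Nat.pos_of_ne_zero (by
      rw [hNdef, Ne, Ideal.absNorm_eq_zero_iff]; exact P.ne_bot)
    set c := (if (6 : 𝓞 K) ∈ P.asIdeal then 729 else 1)
    calc _ ≤ (c * b') ^ 2 * N ^ (v + j) := by
          gcongr
          omega
      _ = (c * b') ^ 2 * N ^ v * N ^ j := by rw [pow_add]; ring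
      _ ≤ (c * b') ^ 2 * (p ^ a) ^ 2 * N ^ j := by gcongr
      _ = (c * b) ^ 2 * N ^ j := by rw [hbb']; ring

lemma finite_setOf_prime_dvd {q : Ideal (𝓞 K)} (hq : q ≠ 0) :
    {P : HeightOneSpectrum (𝓞 K) | P.asIdeal ∣ q}.Finite := Ideal.finite_factors hq

lemma dvd_or_dvd_of_dvd_mul (P : HeightOneSpectrum (𝓞 K)) {x y : Ideal (𝓞 K)}
    (h : P.asIdeal ∣ x * y) : P.asIdeal ∣ x ∨ P.asIdeal ∣ y :=
  P.prime.dvd_or_dvd h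

lemma not_dvd_of_dvd_of_sup_eq_top (P : HeightOneSpectrum (𝓞 K)) {x y : Ideal (𝓞 K)}
    (h : x ⊔ y = ⊤) (hx : P.asIdeal ∣ x) : ¬ P.asIdeal ∣ y := by
  intro hy
  apply P.isPrime.ne_top
  rw [Ideal.dvd_iff_le] at hx hy
  exact top_le_iff.mp (h ▸ sup_le hx hy)

lemma sup_eq_top_of_forall_not_dvd {x y : Ideal (𝓞 K)} (hx : x ≠ 0)
    (h : ∀ P : HeightOneSpectrum (𝓞 K), P.asIdeal ∣ x → ¬ P.asIdeal ∣ y) : x ⊔ y = ⊤ := by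
  by_contra hne
  obtain ⟨M, hM, hle⟩ := Ideal.exists_le_maximal _ hne
  have hM0 : M ≠ ⊥ := by
    rintro rfl
    exact hx (le_bot_iff.mp (le_sup_left.trans hle))
  refine h ⟨M, hM.isPrime, hM0⟩ ?_ ?_ <;> rw [Ideal.dvd_iff_le]
  · exact le_sup_left.trans hle
  · exact le_sup_right.trans hle

lemma ncard_prime_dvd_mul (s : Set (HeightOneSpectrum (𝓞 K))) {x y : Ideal (𝓞 K)} (hx : x ≠ 0)
    (hy : y ≠ 0) (hxy : x ⊔ y = ⊤) :
    {P : HeightOneSpectrum (𝓞 K) | P.asIdeal ∣ x * y ∧ P ∈ s}.ncard =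
      {P : HeightOneSpectrum (𝓞 K) | P.asIdeal ∣ x ∧ P ∈ s}.ncard +
      {P : HeightOneSpectrum (𝓞 K) | P.asIdeal ∣ y ∧ P ∈ s}.ncard := by
  rw [← Set.ncard_union_eq ?_ ((finite_setOf_prime_dvd hx).subset fun P h => h.1)
    ((finite_setOf_prime_dvd hy).subset fun P h => h.1)]
  · congr 1
    ext P
    constructor
    · rintro ⟨h, hs⟩
      rcases dvd_or_dvd_of_dvd_mul P h with h | h
      · exact Or.inl ⟨h, hs⟩
      · exact Or.inr ⟨h, hs⟩
    · rintro (⟨h, hs⟩ | ⟨h, hs⟩)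
      · exact ⟨h.mul_right _, hs⟩
      · exact ⟨h.mul_left _, hs⟩
  · rw [Set.disjoint_left]
    rintro P ⟨h1, _⟩ ⟨h2, _⟩
    exact not_dvd_of_dvd_of_sup_eq_top P hxy h1 h2

lemma omegaK_mul {x y : Ideal (𝓞 K)} (hx : x ≠ 0) (hy : y ≠ 0) (hxy : x ⊔ y = ⊤) :
    omegaK (x * y) = omegaK x + omegaK y := by
  simpa [omegaK] using ncard_prime_dvd_mul Set.univ hx hy hxy

/-- The number of primes above `6` that divide `q`. -/
def omegaSix (q : Ideal (𝓞 K)) : ℕ :=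
  {P : HeightOneSpectrum (𝓞 K) | P.asIdeal ∣ q ∧ P ∈ {P | (6 : 𝓞 K) ∈ P.asIdeal}}.ncard

lemma prime_dvd_prime_pow_iff (P Q : HeightOneSpectrum (𝓞 K)) {n : ℕ} (hn : n ≠ 0) :
    Q.asIdeal ∣ P.asIdeal ^ n ↔ Q = P := by
  constructor
  · intro h
    have h1 := Q.prime.dvd_of_dvd_pow h
    rw [Ideal.dvd_iff_le] at h1
    exact HeightOneSpectrum.ext (P.isMaximal.eq_of_le Q.isPrime.ne_top h1).symm
  · rintro rfl
    exact dvd_pow_self _ hn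

/-- The solutions of `ρ ^ b = ρ₀ ^ b` modulo `q` are a union of classes modulo a divisor `q'` of
`q`, whose number is controlled after weighting with the index of `q` in `q'`. -/
theorem exists_root_classes (hdeg : Module.finrank ℚ K = 2) {b : ℕ} (hb : b ≠ 0)
    (q : Ideal (𝓞 K)) :
    q ≠ 0 → ∀ ρ₀ : 𝓞 K, Ideal.span {ρ₀} ⊔ q = ⊤ → ∃ q' : Ideal (𝓞 K), q' ∣ q ∧
      (∀ P : HeightOneSpectrum (𝓞 K), P.asIdeal ∣ q → P.asIdeal ∣ q') ∧
      (∀ ρ ρ', ρ ^ b - ρ₀ ^ b ∈ q → ρ' - ρ ∈ q' → ρ' ^ b - ρ₀ ^ b ∈ q) ∧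
      (Ideal.Quotient.mk q' '' {ρ | ρ ^ b - ρ₀ ^ b ∈ q}).ncard ^ 2 * Ideal.absNorm q ≤
        (729 ^ omegaSix q * b ^ omegaK q) ^ 2 * Ideal.absNorm q' := by
  classical
  let Good : Ideal (𝓞 K) → Prop := fun q =>
    q ≠ 0 → ∀ ρ₀ : 𝓞 K, Ideal.span {ρ₀} ⊔ q = ⊤ → ∃ q' : Ideal (𝓞 K), q' ∣ q ∧
      (∀ P : HeightOneSpectrum (𝓞 K), P.asIdeal ∣ q → P.asIdeal ∣ q') ∧
      (∀ ρ ρ', ρ ^ b - ρ₀ ^ b ∈ q → ρ' - ρ ∈ q' → ρ' ^ b - ρ₀ ^ b ∈ q) ∧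
      (Ideal.Quotient.mk q' '' {ρ | ρ ^ b - ρ₀ ^ b ∈ q}).ncard ^ 2 * Ideal.absNorm q ≤
        (729 ^ omegaSix q * b ^ omegaK q) ^ 2 * Ideal.absNorm q'
  have hunit : ∀ x, IsUnit x → Good x := by
    intro x hx _ ρ₀ _
    rw [Ideal.isUnit_iff] at hx
    subst hx
    refine ⟨⊤, dvd_rfl, fun P h => h, fun ρ ρ' h h' => trivial, ?_⟩
    have : Subsingleton (𝓞 K ⧸ (⊤ : Ideal (𝓞 K))) := Ideal.Quotient.subsingleton_iff.mpr rfl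
    have h1 : (Ideal.Quotient.mk (⊤ : Ideal (𝓞 K)) ''
        {ρ | ρ ^ b - ρ₀ ^ b ∈ (⊤ : Ideal (𝓞 K))}).ncard ≤ 1 :=
      Set.ncard_le_one_of_subsingleton _
    have h2 : 0 < 729 ^ omegaSix (⊤ : Ideal (𝓞 K)) * b ^ omegaK (⊤ : Ideal (𝓞 K)) := by
      have := Nat.pos_of_ne_zero hb; positivity
    gcongr
    omega
  refine UniqueFactorizationMonoid.induction_on_coprime (P := Good) q
    (fun h => absurd rfl h) (fun hx => hunit _ hx) ?_ ?_
  · intro p i hp h0 ρ₀ hρ₀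
    rcases Nat.eq_zero_or_pos i with rfl | hi
    · exact hunit _ (by simp) h0 ρ₀ hρ₀
    · let P : HeightOneSpectrum (𝓞 K) := ⟨p, Ideal.isPrime_of_prime hp, hp.ne_zero⟩
      have hρP : ρ₀ ∉ P.asIdeal := by
        intro h
        refine not_dvd_of_dvd_of_sup_eq_top P hρ₀ ?_ (dvd_pow_self _ hi.ne')
        rw [Ideal.dvd_iff_le, Ideal.span_singleton_le_iff_mem]
        exact h
      obtain ⟨j, hj1, hjn, hst, hcount⟩ := exists_prime_pow_classes hdeg P hi hb ρ₀ hρP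
      refine ⟨p ^ j, pow_dvd_pow _ hjn, fun Q hQ => ?_, hst, ?_⟩
      · rw [(prime_dvd_prime_pow_iff P Q hi.ne').mp hQ]
        exact dvd_pow_self _ (by omega)
      · have hω : omegaK (p ^ i) = 1 := by
          have : {Q : HeightOneSpectrum (𝓞 K) | Q.asIdeal ∣ p ^ i} = {P} := by
            ext Q; exact prime_dvd_prime_pow_iff P Q hi.ne'
          rw [omegaK, this, Set.ncard_singleton]
        have hω6 : (if (6 : 𝓞 K) ∈ P.asIdeal then 729 else 1) ≤ 729 ^ omegaSix (p ^ i) := by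
          split_ifs with h6
          · have : {Q : HeightOneSpectrum (𝓞 K) | Q.asIdeal ∣ p ^ i ∧ Q ∈ {P | (6 : 𝓞 K) ∈ P.asIdeal}} = {P} := by
              ext Q
              constructor
              · rintro ⟨h, _⟩
                exact (prime_dvd_prime_pow_iff P Q hi.ne').mp h
              · rintro rfl
                exact ⟨dvd_pow_self _ hi.ne', h6⟩
            rw [omegaSix, this, Set.ncard_singleton, pow_one]
          · exact Nat.one_le_pow _ _ (by norm_num)
        rw [map_pow, map_pow, hω, pow_one]
        refine hcount.trans ?_
        change _ ≤ _ * Ideal.absNorm P.asIdeal ^ j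
        gcongr
  · intro x y hrel ihx ihy h0 ρ₀ hρ₀
    have hx0 := left_ne_zero_of_mul h0
    have hy0 := right_ne_zero_of_mul h0
    have hxy : x ⊔ y = ⊤ := by
      rw [← Ideal.isUnit_iff]
      exact hrel (Ideal.dvd_iff_le.mpr le_sup_left) (Ideal.dvd_iff_le.mpr le_sup_right)
    have htop : ∀ z : Ideal (𝓞 K), x * y ≤ z → Ideal.span {ρ₀} ⊔ z = ⊤ := by
      intro z hz
      rw [← top_le_iff, ← hρ₀]
      exact sup_le_sup_left hz _
    obtain ⟨x', hx', hxP, hxst, hxc⟩ := ihx hx0 ρ₀ (htop x Ideal.mul_le_left)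
    obtain ⟨y', hy', hyP, hyst, hyc⟩ := ihy hy0 ρ₀ (htop y Ideal.mul_le_right)
    have hinf : x * y = x ⊓ y := Ideal.mul_eq_inf_of_coprime hxy
    have hxy' : x' ⊔ y' = ⊤ := by
      rw [← top_le_iff, ← hxy]
      exact sup_le_sup (Ideal.dvd_iff_le.mp hx') (Ideal.dvd_iff_le.mp hy')
    have hinf' : x' * y' = x' ⊓ y' := Ideal.mul_eq_inf_of_coprime hxy'
    refine ⟨x' * y', mul_dvd_mul hx' hy', ?_, ?_, ?_⟩
    · intro P hP
      rcases dvd_or_dvd_of_dvd_mul P hP with h | h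
      · exact (hxP P h).mul_right _
      · exact (hyP P h).mul_left _
    · intro ρ ρ' h h'
      rw [hinf] at h ⊢
      exact ⟨hxst ρ ρ' h.1 (Ideal.mul_le_left h'), hyst ρ ρ' h.2 (Ideal.mul_le_right h')⟩
    · have : Finite (𝓞 K ⧸ x') :=
        Ideal.finiteQuotientOfFreeOfNeBot _ (ne_zero_of_dvd_ne_zero hx0 hx')
      have : Finite (𝓞 K ⧸ y') :=
        Ideal.finiteQuotientOfFreeOfNeBot _ (ne_zero_of_dvd_ne_zero hy0 hy')
      have hM := ncard_mk_image_mul_le x' y' {ρ | ρ ^ b - ρ₀ ^ b ∈ x * y}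
        {ρ | ρ ^ b - ρ₀ ^ b ∈ x} {ρ | ρ ^ b - ρ₀ ^ b ∈ y}
        (fun ρ hρ => Ideal.mul_le_left hρ) (fun ρ hρ => Ideal.mul_le_right hρ) (x' * y') hinf'.ge
      have h6 : omegaSix (x * y) = omegaSix x + omegaSix y := ncard_prime_dvd_mul _ hx0 hy0 hxy
      rw [map_mul, map_mul, omegaK_mul hx0 hy0 hxy, h6]
      set M := (Ideal.Quotient.mk (x' * y') '' {ρ | ρ ^ b - ρ₀ ^ b ∈ x * y}).ncard
      set M₁ := (Ideal.Quotient.mk x' '' {ρ | ρ ^ b - ρ₀ ^ b ∈ x}).ncard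
      set M₂ := (Ideal.Quotient.mk y' '' {ρ | ρ ^ b - ρ₀ ^ b ∈ y}).ncard
      calc M ^ 2 * (Ideal.absNorm x * Ideal.absNorm y)
          ≤ (M₁ * M₂) ^ 2 * (Ideal.absNorm x * Ideal.absNorm y) := by gcongr
        _ = (M₁ ^ 2 * Ideal.absNorm x) * (M₂ ^ 2 * Ideal.absNorm y) := by ring
        _ ≤ _ := Nat.mul_le_mul hxc hyc
        _ = _ := by rw [pow_add, pow_add]; ring

end LocalRoots

/-! ### Sums over squarefree divisors of an ideal -/

section Moebius

variable {K : Type*} [Field K] [NumberField K]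

open Classical in
/-- The finite set of prime divisors of a nonzero ideal (empty for the zero ideal). -/
def primesOf (F : Ideal (𝓞 K)) : Finset (HeightOneSpectrum (𝓞 K)) :=
  if h : F ≠ 0 then (finite_setOf_prime_dvd h).toFinset else ∅

lemma mem_primesOf {F : Ideal (𝓞 K)} (hF : F ≠ 0) {P : HeightOneSpectrum (𝓞 K)} :
    P ∈ primesOf F ↔ P.asIdeal ∣ F := by
  rw [primesOf, dif_pos hF, Set.Finite.mem_toFinset]
  rfl

lemma card_primesOf {F : Ideal (𝓞 K)} (hF : F ≠ 0) : (primesOf F).card = omegaK F := by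
  rw [omegaK, ← Set.ncard_coe_finset]
  congr 1
  ext P
  exact mem_primesOf hF

open Classical in
/-- The squarefree divisors of a nonzero ideal. -/
def sqfreeDivisors (F : Ideal (𝓞 K)) : Finset (Ideal (𝓞 K)) :=
  (primesOf F).powerset.image fun T => ∏ P ∈ T, P.asIdeal

lemma prime_dvd_prod_iff (T : Finset (HeightOneSpectrum (𝓞 K))) (Q : HeightOneSpectrum (𝓞 K)) :
    Q.asIdeal ∣ ∏ P ∈ T, P.asIdeal ↔ Q ∈ T := by
  rw [Prime.dvd_finsetProd_iff Q.prime]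
  constructor
  · rintro ⟨P, hP, h⟩
    rw [← pow_one P.asIdeal, prime_dvd_prime_pow_iff P Q one_ne_zero] at h
    exact h ▸ hP
  · intro h
    exact ⟨Q, h, dvd_rfl⟩

lemma exists_prime_dvd_of_not_isUnit {x : Ideal (𝓞 K)} (hx0 : x ≠ 0) (hx : ¬ IsUnit x) :
    ∃ P : HeightOneSpectrum (𝓞 K), P.asIdeal ∣ x := by
  obtain ⟨p, hp, hpx⟩ := WfDvdMonoid.exists_irreducible_factor hx hx0
  have hp' := UniqueFactorizationMonoid.irreducible_iff_prime.mp hp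
  exact ⟨⟨p, Ideal.isPrime_of_prime hp', hp'.ne_zero⟩, hpx⟩

lemma prod_prime_ne_zero (T : Finset (HeightOneSpectrum (𝓞 K))) :
    ∏ P ∈ T, P.asIdeal ≠ 0 :=
  Finset.prod_ne_zero_iff.mpr fun P _ => P.ne_bot

lemma squarefree_prod_prime (T : Finset (HeightOneSpectrum (𝓞 K))) :
    Squarefree (∏ P ∈ T, P.asIdeal) := by
  classical
  intro x hx
  by_contra hu
  have hx0 : x ≠ 0 := by
    rintro rfl
    rw [zero_mul, zero_dvd_iff] at hx
    exact prod_prime_ne_zero T hx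
  obtain ⟨P, hP⟩ := exists_prime_dvd_of_not_isUnit hx0 hu
  have h1 := (mul_dvd_mul hP hP).trans hx
  have hPT : P ∈ T := (prime_dvd_prod_iff T P).mp ((dvd_mul_right _ _).trans h1)
  rw [← Finset.mul_prod_erase T _ hPT] at h1
  have h2 := (mul_dvd_mul_iff_left P.ne_bot).mp h1
  rw [prime_dvd_prod_iff] at h2
  exact Finset.notMem_erase P T h2

lemma prod_prime_injective : Function.Injective
    fun T : Finset (HeightOneSpectrum (𝓞 K)) => ∏ P ∈ T, P.asIdeal := by
  intro S T hST
  ext P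
  rw [← prime_dvd_prod_iff S, ← prime_dvd_prod_iff T]
  simp only at hST
  rw [hST]

lemma eq_prod_primesOf_of_squarefree {d : Ideal (𝓞 K)} (hd0 : d ≠ 0) (hd : Squarefree d) :
    d = ∏ P ∈ primesOf d, P.asIdeal := by
  classical
  have hdvd : ∏ P ∈ primesOf d, P.asIdeal ∣ d := by
    refine Finset.prod_dvd_of_isRelPrime ?_ fun P hP => (mem_primesOf hd0).mp hP
    intro P _ Q _ hPQ x hxP hxQ
    by_contra hu
    have hx0 : x ≠ 0 := by
      rintro rfl
      exact P.ne_bot (zero_dvd_iff.mp hxP)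
    obtain ⟨R, hR⟩ := exists_prime_dvd_of_not_isUnit hx0 hu
    have h1 := hR.trans hxP
    have h2 := hR.trans hxQ
    rw [← pow_one P.asIdeal, prime_dvd_prime_pow_iff P R one_ne_zero] at h1
    rw [← pow_one Q.asIdeal, prime_dvd_prime_pow_iff Q R one_ne_zero] at h2
    exact hPQ (h1 ▸ h2)
  obtain ⟨e, he⟩ := hdvd
  have hu : IsUnit e := by
    by_contra hu
    have he0 : e ≠ 0 := by
      rintro rfl
      rw [mul_zero] at he
      exact hd0 he
    obtain ⟨P, hP⟩ := exists_prime_dvd_of_not_isUnit he0 hu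
    have hPd : P.asIdeal ∣ d := by
      rw [he]
      exact hP.mul_left _
    have h1 : P.asIdeal ∣ ∏ Q ∈ primesOf d, Q.asIdeal :=
      (prime_dvd_prod_iff _ P).mpr ((mem_primesOf hd0).mpr hPd)
    exact P.prime.not_isUnit (hd _ ((mul_dvd_mul h1 hP).trans he.symm.dvd))
  rw [Ideal.isUnit_iff] at hu
  rw [hu, Ideal.mul_top] at he
  exact he

lemma mem_sqfreeDivisors {F : Ideal (𝓞 K)} (hF : F ≠ 0) {d : Ideal (𝓞 K)} :
    d ∈ sqfreeDivisors F ↔ Squarefree d ∧ d ∣ F := by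
  classical
  simp only [sqfreeDivisors, Finset.mem_image, Finset.mem_powerset]
  constructor
  · rintro ⟨T, hT, rfl⟩
    refine ⟨squarefree_prod_prime T, ?_⟩
    have h1 : ∏ P ∈ T, P.asIdeal ∣ ∏ P ∈ primesOf F, P.asIdeal := Finset.prod_dvd_prod_of_subset _ _ _ hT
    refine h1.trans (Finset.prod_dvd_of_isRelPrime ?_ fun P hP => (mem_primesOf hF).mp hP)
    intro P _ Q _ hPQ
    rw [Function.onFun, Irreducible.isRelPrime_iff_not_dvd P.prime.irreducible]
    intro h
    rw [← pow_one Q.asIdeal, prime_dvd_prime_pow_iff Q P one_ne_zero] at h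
    exact hPQ h
  · rintro ⟨hd, hdF⟩
    have hd0 := ne_zero_of_dvd_ne_zero hF hdF
    refine ⟨primesOf d, ?_, (eq_prod_primesOf_of_squarefree hd0 hd).symm⟩
    intro P hP
    exact (mem_primesOf hF).mpr (((mem_primesOf hd0).mp hP).trans hdF)

lemma sum_sqfreeDivisors {M : Type*} [AddCommMonoid M] (F : Ideal (𝓞 K)) (g : Ideal (𝓞 K) → M) :
    ∑ d ∈ sqfreeDivisors F, g d = ∑ T ∈ (primesOf F).powerset, g (∏ P ∈ T, P.asIdeal) := by
  classical
  rw [sqfreeDivisors, Finset.sum_image]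
  intro S _ T _ h
  exact prod_prime_injective h

lemma card_sqfreeDivisors {F : Ideal (𝓞 K)} (hF : F ≠ 0) :
    (sqfreeDivisors F).card = 2 ^ omegaK F := by
  rw [Finset.card_eq_sum_ones, sum_sqfreeDivisors, ← Finset.card_eq_sum_ones, Finset.card_powerset,
    card_primesOf hF]

lemma primesOf_prod (T : Finset (HeightOneSpectrum (𝓞 K))) :
    primesOf (∏ P ∈ T, P.asIdeal) = T := by
  ext Q
  rw [mem_primesOf (prod_prime_ne_zero T), prime_dvd_prod_iff]

lemma moebiusK_prod (T : Finset (HeightOneSpectrum (𝓞 K))) :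
    moebiusK (∏ P ∈ T, P.asIdeal) = (-1) ^ T.card := by
  rw [moebiusK, if_pos (squarefree_prod_prime T), ← card_primesOf (prod_prime_ne_zero T),
    primesOf_prod]

lemma abs_moebiusK_le_one (d : Ideal (𝓞 K)) : |(moebiusK d : ℝ)| ≤ 1 := by
  rw [moebiusK]
  split_ifs
  · push_cast
    rw [abs_pow, abs_neg, abs_one, one_pow]
  · simp

lemma sum_moebiusK_mul (F : Ideal (𝓞 K)) (f : Ideal (𝓞 K) →* ℝ) :
    ∑ d ∈ sqfreeDivisors F, (moebiusK d : ℝ) * f d = ∏ P ∈ primesOf F, (1 - f P.asIdeal) := by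
  classical
  rw [sum_sqfreeDivisors]
  simp_rw [moebiusK_prod, map_prod, sub_eq_add_neg]
  rw [Finset.prod_one_add]
  refine Finset.sum_congr rfl fun T _ => ?_
  rw [Finset.prod_neg]
  push_cast
  rfl

open Classical in
/-- Detecting coprimality to `F` by the Möbius function; `I` may be the zero ideal. -/
lemma sum_moebiusK_dvd {F : Ideal (𝓞 K)} (hF : F ≠ 0) (I : Ideal (𝓞 K)) :
    ∑ d ∈ sqfreeDivisors F with d ∣ I, (moebiusK d : ℝ) = if I ⊔ F = ⊤ then 1 else 0 := by
  have hG : I ⊔ F ≠ 0 := fun h => hF (le_bot_iff.mp (le_sup_right.trans h.le))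
  have hset : (sqfreeDivisors F).filter (fun d => d ∣ I) = sqfreeDivisors (I ⊔ F) := by
    ext d
    rw [Finset.mem_filter, mem_sqfreeDivisors hF, mem_sqfreeDivisors hG]
    simp only [Ideal.dvd_iff_le, sup_le_iff]
    tauto
  rw [hset]
  have := sum_moebiusK_mul (I ⊔ F) 1
  simp only [MonoidHom.one_apply, mul_one, sub_self] at this
  rw [this]
  split_ifs with h
  · have he : primesOf (I ⊔ F) = ∅ := by
      rw [Finset.eq_empty_iff_forall_notMem]
      intro P hP
      rw [mem_primesOf hG, h, Ideal.dvd_iff_le, top_le_iff] at hP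
      exact P.isPrime.ne_top hP
    rw [he, Finset.prod_empty]
  · rw [← Ideal.isUnit_iff] at h
    obtain ⟨P, hP⟩ := exists_prime_dvd_of_not_isUnit hG h
    exact Finset.prod_eq_zero ((mem_primesOf hG).mpr hP) rfl

open Classical in
/-- `d ↦ 1 / N(d)` on the ideals prime to `q`, extended by zero. -/
def invNormCoprime (q : Ideal (𝓞 K)) : Ideal (𝓞 K) →* ℝ where
  toFun d := if d ⊔ q = ⊤ then ((Ideal.absNorm d : ℝ))⁻¹ else 0
  map_one' := by
    rw [Ideal.one_eq_top, top_sup_eq, if_pos rfl, Ideal.absNorm_top, Nat.cast_one, inv_one]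
  map_mul' d e := by
    simp only [← Ideal.isCoprime_iff_sup_eq, IsCoprime.mul_left_iff]
    by_cases h1 : IsCoprime d q <;> by_cases h2 : IsCoprime e q <;> simp [h1, h2, mul_comm]

lemma prime_sup_eq_top_iff (P : HeightOneSpectrum (𝓞 K)) (q : Ideal (𝓞 K)) :
    P.asIdeal ⊔ q = ⊤ ↔ ¬ P.asIdeal ∣ q := by
  constructor
  · intro h
    exact not_dvd_of_dvd_of_sup_eq_top P h dvd_rfl
  · intro h
    rw [Ideal.dvd_iff_le] at h
    by_contra hne
    have := P.isMaximal.eq_of_le hne le_sup_left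
    exact h (this ▸ le_sup_right)

lemma one_lt_absNorm (P : HeightOneSpectrum (𝓞 K)) : 1 < Ideal.absNorm P.asIdeal := by
  have h0 : Ideal.absNorm P.asIdeal ≠ 0 := by
    rw [Ne, Ideal.absNorm_eq_zero_iff]; exact P.ne_bot
  have h1 : Ideal.absNorm P.asIdeal ≠ 1 := by
    rw [Ne, Ideal.absNorm_eq_one_iff]; exact P.isPrime.ne_top
  omega

lemma phiStar_eq_prod {F : Ideal (𝓞 K)} (hF : F ≠ 0) :
    phiStar F = ∏ P ∈ primesOf F, (1 - 1 / (Ideal.absNorm P.asIdeal : ℝ)) := by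
  rw [phiStar]
  have : {P : HeightOneSpectrum (𝓞 K) | P.asIdeal ∣ F} = (primesOf F : Set (HeightOneSpectrum (𝓞 K))) := by
    ext P; exact (mem_primesOf hF).symm
  rw [← finprod_mem_coe_finset, ← this]
  rfl

lemma one_sub_inv_absNorm_pos (P : HeightOneSpectrum (𝓞 K)) :
    (0 : ℝ) < 1 - 1 / (Ideal.absNorm P.asIdeal : ℝ) := by
  have : (1 : ℝ) < Ideal.absNorm P.asIdeal := by exact_mod_cast one_lt_absNorm P
  rw [sub_pos, div_lt_one (by linarith)]
  exact this

/-- The Euler product of the sum over the squarefree divisors of `E` that are prime to `q`. -/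
lemma sum_moebiusK_invNormCoprime {E q G : Ideal (𝓞 K)} (hE : E ≠ 0) (hG : G ≠ 0)
    (hEG : ∀ P : HeightOneSpectrum (𝓞 K), P.asIdeal ∣ G ↔ P.asIdeal ∣ E ∧ P.asIdeal ∣ q) :
    ∑ d ∈ sqfreeDivisors E, (moebiusK d : ℝ) * invNormCoprime q d = phiStar E / phiStar G := by
  classical
  have hsub : primesOf G ⊆ primesOf E := fun P hP =>
    (mem_primesOf hE).mpr ((hEG P).mp ((mem_primesOf hG).mp hP)).1
  rw [sum_moebiusK_mul, phiStar_eq_prod hE, phiStar_eq_prod hG, ← Finset.prod_sdiff hsub,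
    ← Finset.prod_sdiff hsub, mul_div_assoc,
    div_self (Finset.prod_ne_zero_iff.mpr fun P _ => (one_sub_inv_absNorm_pos P).ne'), mul_one]
  have h1 : ∏ P ∈ primesOf G, (1 - invNormCoprime q P.asIdeal) = 1 := by
    refine Finset.prod_eq_one fun P hP => ?_
    have h2 := ((hEG P).mp ((mem_primesOf hG).mp hP)).2
    change 1 - (if P.asIdeal ⊔ q = ⊤ then _ else _) = _
    rw [if_neg (fun h => (prime_sup_eq_top_iff P q).mp h h2), sub_zero]
  rw [h1, mul_one]
  refine Finset.prod_congr rfl fun P hP => ?_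
  rw [Finset.mem_sdiff, mem_primesOf hE, mem_primesOf hG, hEG] at hP
  change 1 - (if P.asIdeal ⊔ q = ⊤ then _ else _) = _
  rw [if_pos ((prime_sup_eq_top_iff P q).mpr fun h => hP.2 ⟨hP.1, h⟩), one_div]

end Moebius

/-! ### The ideals `x J⁻¹` -/

section IdealOf

variable {K : Type*} [Field K] [NumberField K]

open FractionalIdeal

lemma coe_idealOf_mul {x : K} {J : FractionalIdeal (𝓞 K)⁰ K} (hJ : J ≠ 0) (hx : x ∈ J) :
    (idealOf x J : FractionalIdeal (𝓞 K)⁰ K) * J = spanSingleton (𝓞 K)⁰ x := by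
  have hle : spanSingleton (𝓞 K)⁰ x * J⁻¹ ≤ 1 := by
    calc spanSingleton (𝓞 K)⁰ x * J⁻¹ ≤ J * J⁻¹ :=
          mul_le_mul_left ((spanSingleton_le_iff_mem).mpr hx) _
      _ = 1 := mul_inv_cancel₀ hJ
  obtain ⟨I, hI⟩ := le_one_iff_exists_coeIdeal.mp hle
  have h1 : idealOf x J = I := by
    rw [idealOf, ← hI, coe_coeIdeal]
    ext r
    simp only [Submodule.mem_comap, Algebra.linearMap_apply, IsLocalization.mem_coeSubmodule]
    constructor
    · rintro ⟨y, hy, hyr⟩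
      rwa [← FaithfulSMul.algebraMap_injective (𝓞 K) K hyr]
    · intro hr
      exact ⟨r, hr, rfl⟩
  rw [h1, hI, inv_mul_cancel_right₀ hJ]

lemma idealOf_eq_of_coe_mul {x : K} {J : FractionalIdeal (𝓞 K)⁰ K} (hJ : J ≠ 0)
    {I : Ideal (𝓞 K)} (h : (I : FractionalIdeal (𝓞 K)⁰ K) * J = spanSingleton (𝓞 K)⁰ x) :
    idealOf x J = I := by
  have hx : x ∈ J := by
    rw [← spanSingleton_le_iff_mem, ← h]
    calc (I : FractionalIdeal (𝓞 K)⁰ K) * J ≤ 1 * J := mul_le_mul_left coeIdeal_le_one _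
      _ = J := one_mul J
  have h2 := coe_idealOf_mul hJ hx
  rw [← h] at h2
  exact coeIdeal_injective (mul_right_cancel₀ hJ h2)

lemma dvd_idealOf_iff {x : K} {J : FractionalIdeal (𝓞 K)⁰ K} (hJ : J ≠ 0) (hx : x ∈ J)
    (c : Ideal (𝓞 K)) : c ∣ idealOf x J ↔ x ∈ (c : FractionalIdeal (𝓞 K)⁰ K) * J := by
  rw [Ideal.dvd_iff_le, ← spanSingleton_le_iff_mem, ← coe_idealOf_mul hJ hx,
    ← coeIdeal_le_coeIdeal K]
  constructor
  · intro h
    exact mul_le_mul_left h _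
  · intro h
    have := mul_le_mul_left h J⁻¹
    rwa [mul_inv_cancel_right₀ hJ, mul_inv_cancel_right₀ hJ] at this

lemma coeIdeal_mul_le (c : Ideal (𝓞 K)) (J : FractionalIdeal (𝓞 K)⁰ K) :
    (c : FractionalIdeal (𝓞 K)⁰ K) * J ≤ J :=
  (mul_le_mul_left coeIdeal_le_one _).trans (one_mul J).le

lemma idealOf_mul {x y : K} {J L : FractionalIdeal (𝓞 K)⁰ K} (hJ : J ≠ 0) (hL : L ≠ 0)
    (hx : x ∈ J) (hy : y ∈ L) : idealOf (x * y) (J * L) = idealOf x J * idealOf y L := by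
  apply idealOf_eq_of_coe_mul (mul_ne_zero hJ hL)
  rw [coeIdeal_mul, ← spanSingleton_mul_spanSingleton, ← coe_idealOf_mul hJ hx,
    ← coe_idealOf_mul hL hy]
  ring

lemma idealOf_one : idealOf (1 : K) (1 : FractionalIdeal (𝓞 K)⁰ K) = 1 := by
  have h0 : (1 : FractionalIdeal (𝓞 K)⁰ K) ≠ 0 := one_ne_zero
  apply idealOf_eq_of_coe_mul h0
  rw [mul_one, spanSingleton_one, Ideal.one_eq_top, coeIdeal_top]

lemma pow_mem_pow_fractionalIdeal {x : K} {J : FractionalIdeal (𝓞 K)⁰ K} (hx : x ∈ J) (n : ℕ) :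
    x ^ n ∈ J ^ n := by
  induction n with
  | zero => rw [pow_zero, pow_zero]; exact one_mem_one _
  | succ n ih => rw [pow_succ, pow_succ]; exact mul_mem_mul ih hx

lemma idealOf_pow {x : K} {J : FractionalIdeal (𝓞 K)⁰ K} (hJ : J ≠ 0) (hx : x ∈ J) (n : ℕ) :
    idealOf (x ^ n) (J ^ n) = idealOf x J ^ n := by
  induction n with
  | zero => rw [pow_zero, pow_zero, pow_zero, idealOf_one]
  | succ n ih =>
    rw [pow_succ, pow_succ, pow_succ,
      idealOf_mul (pow_ne_zero n hJ) hJ (pow_mem_pow_fractionalIdeal hx n) hx, ih]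

lemma prod_mem_and_idealOf_prod {ι : Type*} (s : Finset ι) (x : ι → K)
    (J : ι → FractionalIdeal (𝓞 K)⁰ K) (hJ : ∀ i, J i ≠ 0) (hx : ∀ i, x i ∈ J i) (e : ι → ℕ) :
    ∏ i ∈ s, x i ^ e i ∈ ∏ i ∈ s, J i ^ e i ∧
      idealOf (∏ i ∈ s, x i ^ e i) (∏ i ∈ s, J i ^ e i) = ∏ i ∈ s, idealOf (x i) (J i) ^ e i := by
  classical
  induction s using Finset.induction_on with
  | empty => simp only [Finset.prod_empty]; exact ⟨one_mem_one _, idealOf_one⟩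
  | insert i s his ih =>
    simp only [Finset.prod_insert his]
    have h1 := pow_mem_pow_fractionalIdeal (hx i) (e i)
    refine ⟨mul_mem_mul h1 ih.1, ?_⟩
    rw [idealOf_mul (pow_ne_zero _ (hJ i)) (Finset.prod_ne_zero_iff.mpr fun j _ => pow_ne_zero _ (hJ j)) h1 ih.1,
      ih.2, idealOf_pow (hJ i) (hx i)]

lemma idealOf_eq_zero_iff {x : K} {J : FractionalIdeal (𝓞 K)⁰ K} (hJ : J ≠ 0) (hx : x ∈ J) :
    idealOf x J = 0 ↔ x = 0 := by
  have h := coe_idealOf_mul hJ hx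
  constructor
  · intro h0
    rw [h0, Ideal.zero_eq_bot, coeIdeal_bot, zero_mul] at h
    exact spanSingleton_eq_zero_iff.mp h.symm
  · rintro rfl
    apply idealOf_eq_of_coe_mul hJ
    rw [spanSingleton_zero, Ideal.zero_eq_bot, coeIdeal_bot, zero_mul]

/-- Valuations relative to a fractional ideal: if `P ∤ g J⁻¹`, then `P ^ n ∣ x J⁻¹` means that
`v_P(x) ≥ v_P(g) + n`. -/
lemma prime_pow_dvd_idealOf_iff {x g : K} {J : FractionalIdeal (𝓞 K)⁰ K} (hJ : J ≠ 0) (hx : x ∈ J)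
    (hg : g ∈ J) (P : HeightOneSpectrum (𝓞 K)) (hP : ¬ P.asIdeal ∣ idealOf g J) (n : ℕ) :
    P.asIdeal ^ n ∣ idealOf x J ↔
      P.valuation K x ≤ WithZero.exp (-(n : ℤ)) * P.valuation K g := by
  have hg0 : g ≠ 0 := by
    rintro rfl
    rw [(idealOf_eq_zero_iff hJ hg).mpr rfl] at hP
    exact hP (dvd_zero _)
  -- clear denominators
  obtain ⟨a, x', g', ha, hx', hg'⟩ : ∃ a x' g' : 𝓞 K, a ≠ 0 ∧ algebraMap (𝓞 K) K x' = algebraMap (𝓞 K) K a * x ∧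
      algebraMap (𝓞 K) K g' = algebraMap (𝓞 K) K a * g := by
    obtain ⟨x₁, s₁, hs₁, rfl⟩ := IsFractionRing.div_surjective (A := 𝓞 K) x
    obtain ⟨g₁, s₂, hs₂, rfl⟩ := IsFractionRing.div_surjective (A := 𝓞 K) g
    have h1 : algebraMap (𝓞 K) K s₁ ≠ 0 := by
      rw [Ne, FaithfulSMul.algebraMap_eq_zero_iff]; exact nonZeroDivisors.ne_zero hs₁
    have h2 : algebraMap (𝓞 K) K s₂ ≠ 0 := by
      rw [Ne, FaithfulSMul.algebraMap_eq_zero_iff]; exact nonZeroDivisors.ne_zero hs₂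
    refine ⟨s₁ * s₂, x₁ * s₂, g₁ * s₁, mul_ne_zero (nonZeroDivisors.ne_zero hs₁)
      (nonZeroDivisors.ne_zero hs₂), ?_, ?_⟩
    · rw [map_mul, map_mul]; field_simp
    · rw [map_mul, map_mul]; field_simp
  have haK : algebraMap (𝓞 K) K a ≠ 0 := by rwa [Ne, FaithfulSMul.algebraMap_eq_zero_iff]
  have hg'0 : g' ≠ 0 := by
    rintro rfl
    rw [map_zero] at hg'
    exact mul_ne_zero haK hg0 hg'.symm
  have hid : idealOf x J * Ideal.span {g'} = idealOf g J * Ideal.span {x'} := by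
    apply coeIdeal_injective (K := K)
    simp only [coeIdeal_mul, coeIdeal_span_singleton, hx', hg', ← spanSingleton_mul_spanSingleton,
      ← coe_idealOf_mul hJ hx, ← coe_idealOf_mul hJ hg]
    ring
  obtain ⟨k, hk, hkmem⟩ := exists_intValuation_eq_exp P hg'0
  have hva : P.valuation K (algebraMap (𝓞 K) K a) ≠ 0 := by
    rwa [Ne, Valuation.zero_iff]
  have hval : P.valuation K x ≤ WithZero.exp (-(n : ℤ)) * P.valuation K g ↔
      x' ∈ P.asIdeal ^ (n + k) := by
    have ev : ∀ y : 𝓞 K, P.valuation K (algebraMap (𝓞 K) K y) = P.intValuation y :=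
      fun y => P.valuation_of_algebraMap y
    rw [← P.intValuation_le_pow_iff_mem, ← ev, hx', map_mul]
    have h1 : WithZero.exp (-((n + k : ℕ) : ℤ)) =
        P.valuation K (algebraMap (𝓞 K) K a) * (WithZero.exp (-(n : ℤ)) * P.valuation K g) := by
      rw [mul_left_comm, ← map_mul, ← hg', ev, hk, ← WithZero.exp_add]
      congr 1
      push_cast
      ring
    rw [h1]
    exact (mul_le_mul_iff_right₀ (zero_lt_iff.mpr hva)).symm
  rw [hval, ← Ideal.span_singleton_le_iff_mem, ← Ideal.dvd_iff_le]
  obtain ⟨L, hL⟩ : P.asIdeal ^ k ∣ Ideal.span {g'} := by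
    rw [Ideal.dvd_iff_le, Ideal.span_singleton_le_iff_mem]
    exact (hkmem k).mpr le_rfl
  have hPL : ¬ P.asIdeal ∣ L := by
    intro h
    have h1 : P.asIdeal ^ (k + 1) ∣ Ideal.span {g'} := by
      rw [hL, pow_succ]; exact mul_dvd_mul_left _ h
    rw [Ideal.dvd_iff_le, Ideal.span_singleton_le_iff_mem, hkmem] at h1
    omega
  have e1 : P.asIdeal ^ n ∣ idealOf x J ↔ P.asIdeal ^ n ∣ idealOf x J * L :=
    ⟨fun h => h.mul_right _, fun h => P.prime.pow_dvd_of_dvd_mul_right _ hPL h⟩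
  have e2 : P.asIdeal ^ (n + k) ∣ Ideal.span {x'} ↔ P.asIdeal ^ (n + k) ∣ idealOf g J * Ideal.span {x'} :=
    ⟨fun h => h.mul_left _, fun h => P.prime.pow_dvd_of_dvd_mul_left _ hP h⟩
  rw [e1, e2, ← hid, hL, pow_add, mul_comm (P.asIdeal ^ n), mul_left_comm]
  exact (mul_dvd_mul_iff_left (pow_ne_zero k P.ne_bot)).symm

lemma dvd_of_forall_prime_pow_dvd (q X : Ideal (𝓞 K)) : q ≠ 0 →
    (∀ (P : HeightOneSpectrum (𝓞 K)) (n : ℕ), 1 ≤ n → P.asIdeal ^ n ∣ q → P.asIdeal ^ n ∣ X) →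
    q ∣ X := by
  refine UniqueFactorizationMonoid.induction_on_coprime (P := fun q : Ideal (𝓞 K) => q ≠ 0 →
    (∀ (P : HeightOneSpectrum (𝓞 K)) (n : ℕ), 1 ≤ n → P.asIdeal ^ n ∣ q → P.asIdeal ^ n ∣ X) →
    q ∣ X) q (fun h => absurd rfl h) (fun hx _ _ => hx.dvd) ?_ ?_
  · intro p i hp _ h
    rcases Nat.eq_zero_or_pos i with rfl | hi
    · rw [pow_zero]; exact one_dvd _
    · exact h ⟨p, Ideal.isPrime_of_prime hp, hp.ne_zero⟩ i hi dvd_rfl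
  · intro x y hxy hx hy h0 h
    exact hxy.mul_dvd (hx (left_ne_zero_of_mul h0) fun P n hn hd => h P n hn (hd.mul_right _))
      (hy (right_ne_zero_of_mul h0) fun P n hn hd => h P n hn (hd.mul_left _))

/-- A congruence in `K` modulo `q`, multiplied by an element `g` of a fractional ideal `J` that
generates `J` at the primes dividing `q`. -/
lemma congrMod_iff_mul_mem {g y₁ y₂ : K} {J : FractionalIdeal (𝓞 K)⁰ K} (hJ : J ≠ 0) (hg : g ∈ J)
    {q : Ideal (𝓞 K)} (hq : q ≠ 0) (hgq : idealOf g J ⊔ q = ⊤) (hy : g * (y₁ - y₂) ∈ J) :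
    CongrMod q y₁ y₂ ↔ g * (y₁ - y₂) ∈ (q : FractionalIdeal (𝓞 K)⁰ K) * J := by
  rw [← dvd_idealOf_iff hJ hy]
  have key : ∀ (P : HeightOneSpectrum (𝓞 K)) (n : ℕ), 1 ≤ n → P.asIdeal ^ n ∣ q →
      (P.valuation K (y₁ - y₂) ≤ WithZero.exp (-(n : ℤ)) ↔
        P.asIdeal ^ n ∣ idealOf (g * (y₁ - y₂)) J) := by
    intro P n hn hPn
    have hPq : P.asIdeal ∣ q := (dvd_pow_self _ (by omega)).trans hPn
    have hPg : ¬ P.asIdeal ∣ idealOf g J := fun h => not_dvd_of_dvd_of_sup_eq_top P hgq h hPq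
    have hg0 : g ≠ 0 := by
      rintro rfl
      rw [(idealOf_eq_zero_iff hJ hg).mpr rfl] at hPg
      exact hPg (dvd_zero _)
    rw [prime_pow_dvd_idealOf_iff hJ hy hg P hPg, map_mul, mul_comm]
    have : 0 < P.valuation K g := by
      rw [zero_lt_iff, Ne, Valuation.zero_iff]; exact hg0
    exact (mul_le_mul_iff_left₀ this).symm
  constructor
  · intro h
    exact dvd_of_forall_prime_pow_dvd q _ hq fun P n hn hPn => (key P n hn hPn).mp (h P n hn hPn)
  · intro h P n hn hPn
    exact (key P n hn hPn).mpr (hPn.trans h)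

lemma invertibleMod_div {x g : K} {J : FractionalIdeal (𝓞 K)⁰ K} (hJ : J ≠ 0) (hx : x ∈ J)
    (hg : g ∈ J) {q : Ideal (𝓞 K)} (hxq : idealOf x J ⊔ q = ⊤) (hgq : idealOf g J ⊔ q = ⊤) :
    InvertibleMod q (x / g) := by
  intro P hP
  have hPx : ¬ P.asIdeal ∣ idealOf x J := fun h => not_dvd_of_dvd_of_sup_eq_top P hxq h hP
  have hPg : ¬ P.asIdeal ∣ idealOf g J := fun h => not_dvd_of_dvd_of_sup_eq_top P hgq h hP
  have h1 := (prime_pow_dvd_idealOf_iff hJ hx hg P hPg 0).mp (by simp)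
  have h2 := (prime_pow_dvd_idealOf_iff hJ hg hx P hPx 0).mp (by simp)
  simp only [Nat.cast_zero, neg_zero, WithZero.exp_zero, one_mul] at h1 h2
  have hg0 : g ≠ 0 := by
    rintro rfl
    rw [(idealOf_eq_zero_iff hJ hg).mpr rfl] at hPg
    exact hPg (dvd_zero _)
  rw [map_div₀, le_antisymm h1 h2, div_self]
  rw [Ne, Valuation.zero_iff]
  exact hg0

end IdealOf

/-! ### Solutions of the congruence as a union of residue classes -/

section Residues

variable {K : Type*} [Field K] [NumberField K]

open FractionalIdeal

lemma coe_mul_mono_of_dvd {c d : Ideal (𝓞 K)} (h : c ∣ d) (J : FractionalIdeal (𝓞 K)⁰ K) :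
    (d : FractionalIdeal (𝓞 K)⁰ K) * J ≤ (c : FractionalIdeal (𝓞 K)⁰ K) * J :=
  mul_le_mul_left ((coeIdeal_le_coeIdeal K).mpr (Ideal.dvd_iff_le.mp h)) _

lemma algebraMap_mul_mem {x : K} {J : FractionalIdeal (𝓞 K)⁰ K} (hx : x ∈ J) (ρ : 𝓞 K) :
    (ρ : K) * x ∈ J := by
  have h := Submodule.smul_mem (J : Submodule (𝓞 K) K) ρ hx
  rwa [Algebra.smul_def] at h

lemma pow_sub_pow_mem {x y : K} {J : FractionalIdeal (𝓞 K)⁰ K} {q : Ideal (𝓞 K)} (hx : x ∈ J)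
    (hy : y ∈ J) (h : x - y ∈ (q : FractionalIdeal (𝓞 K)⁰ K) * J) (n : ℕ) :
    x ^ n - y ^ n ∈ (q : FractionalIdeal (𝓞 K)⁰ K) * J ^ n := by
  induction n with
  | zero => simp
  | succ n ih =>
    have e : x ^ (n + 1) - y ^ (n + 1) = (x ^ n - y ^ n) * x + (x - y) * y ^ n := by ring
    rw [e]
    refine Submodule.add_mem _ ?_ ?_
    · have := mul_mem_mul ih hx
      rwa [mul_assoc, ← pow_succ] at this
    · have := mul_mem_mul h (pow_mem_pow_fractionalIdeal hy n)
      rwa [mul_assoc, ← pow_succ'] at this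

lemma exists_sub_mem_of_sup_eq_top {I q : Ideal (𝓞 K)} (h : I ⊔ q = ⊤)
    {J : FractionalIdeal (𝓞 K)⁰ K} {z : K} (hz : z ∈ J) :
    ∃ y ∈ (I : FractionalIdeal (𝓞 K)⁰ K) * J, z - y ∈ (q : FractionalIdeal (𝓞 K)⁰ K) * J := by
  have h1 : (I : FractionalIdeal (𝓞 K)⁰ K) * J + (q : FractionalIdeal (𝓞 K)⁰ K) * J = J := by
    rw [← add_mul, ← coeIdeal_sup, h, coeIdeal_top, one_mul]
  rw [← h1] at hz
  obtain ⟨y, hy, w, hw, rfl⟩ := (mem_add _ _ _).mp hz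
  exact ⟨y, hy, by simpa using hw⟩

lemma mem_mul_of_mem_of_mem {c d : Ideal (𝓞 K)} (h : c ⊔ d = ⊤) {J : FractionalIdeal (𝓞 K)⁰ K}
    (hJ : J ≠ 0) {z : K} (hc : z ∈ (c : FractionalIdeal (𝓞 K)⁰ K) * J)
    (hd : z ∈ (d : FractionalIdeal (𝓞 K)⁰ K) * J) :
    z ∈ ((c * d : Ideal (𝓞 K)) : FractionalIdeal (𝓞 K)⁰ K) * J := by
  have hz := coeIdeal_mul_le _ _ hc
  rw [← dvd_idealOf_iff hJ hz] at hc hd ⊢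
  exact (Ideal.isCoprime_iff_sup_eq.mpr h).mul_dvd hc hd

lemma idealOf_coe (ρ : 𝓞 K) : idealOf (ρ : K) (1 : FractionalIdeal (𝓞 K)⁰ K) = Ideal.span {ρ} := by
  have h0 : (1 : FractionalIdeal (𝓞 K)⁰ K) ≠ 0 := one_ne_zero
  apply idealOf_eq_of_coe_mul h0
  rw [mul_one, coeIdeal_span_singleton]

lemma coe_mem_one_fractionalIdeal (ρ : 𝓞 K) : (ρ : K) ∈ (1 : FractionalIdeal (𝓞 K)⁰ K) :=
  (mem_one_iff _).mpr ⟨ρ, rfl⟩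

lemma mem_of_coe_mul_mem {g : K} {J : FractionalIdeal (𝓞 K)⁰ K} (hJ : J ≠ 0) (hg : g ∈ J)
    {q : Ideal (𝓞 K)} (hgq : idealOf g J ⊔ q = ⊤) {ρ : 𝓞 K}
    (h : (ρ : K) * g ∈ (q : FractionalIdeal (𝓞 K)⁰ K) * J) : ρ ∈ q := by
  have h0 : (1 : FractionalIdeal (𝓞 K)⁰ K) ≠ 0 := one_ne_zero
  rw [← dvd_idealOf_iff hJ (algebraMap_mul_mem hg ρ), ← one_mul J,
    idealOf_mul h0 hJ (coe_mem_one_fractionalIdeal ρ) hg, idealOf_coe] at h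
  have := (Ideal.isCoprime_iff_sup_eq.mpr (sup_comm q _ ▸ hgq)).dvd_of_dvd_mul_right h
  rwa [Ideal.dvd_iff_le, Ideal.span_singleton_le_iff_mem] at this

/-- The congruence `A + z ^ b PB ≡ 0` for `z` in the fractional ideal `OB`, where `A = P₁ P₂ ^ b`
with `P₂ ∈ OB`. -/
structure PowerCongruence (K : Type*) [Field K] [NumberField K] where
  b : ℕ
  b_ne_zero : b ≠ 0
  OB : FractionalIdeal (𝓞 K)⁰ K
  O : FractionalIdeal (𝓞 K)⁰ K
  OP : FractionalIdeal (𝓞 K)⁰ K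
  OB_ne_zero : OB ≠ 0
  O_ne_zero : O ≠ 0
  OP_ne_zero : OP ≠ 0
  O_eq : OB ^ b * OP = O
  A : K
  PB : K
  P₁ : K
  P₂ : K
  A_mem : A ∈ O
  PB_mem : PB ∈ OP
  PB_ne_zero : PB ≠ 0
  P₂_mem : P₂ ∈ OB
  A_eq : A = P₁ * P₂ ^ b

/-- The conditions on the modulus `q` under which the solutions of the congruence are the multiples
`ρ P₂` with `ρ` a root modulo `q`. -/
structure PowerCongruence.IsGood (D : PowerCongruence K) (q : Ideal (𝓞 K)) : Prop where
  ne_zero : q ≠ 0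
  coprime_P₂ : idealOf D.P₂ D.OB ⊔ q = ⊤
  coprime_PB : idealOf D.PB D.OP ⊔ q = ⊤
  invertible : InvertibleMod q (D.P₁ / D.PB)

namespace PowerCongruence

variable (D : PowerCongruence K) {q : Ideal (𝓞 K)}

/-- The form whose divisibility is imposed. -/
def form (z : K) : K := D.A + z ^ D.b * D.PB

/-- The roots `ρ` modulo `q`, as elements of the ring of integers. -/
def roots (q : Ideal (𝓞 K)) : Set (𝓞 K) :=
  {ρ | Ideal.span {ρ} ⊔ q = ⊤ ∧ CongrMod q ((ρ : K) ^ D.b) (-(D.P₁ / D.PB))}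

lemma rootCount_eq (q : Ideal (𝓞 K)) :
    rootCount q D.b (-(D.P₁ / D.PB)) = (Ideal.Quotient.mk q '' D.roots q).ncard := by
  rw [rootCount]
  congr 1
  ext u
  constructor
  · rintro ⟨ρ, h1, h2⟩; exact ⟨ρ, h2, h1⟩
  · rintro ⟨ρ, h2, h1⟩; exact ⟨ρ, h1, h2⟩

lemma form_mem {z : K} (hz : z ∈ D.OB) : D.form z ∈ D.O := by
  refine Submodule.add_mem _ D.A_mem ?_
  have := mul_mem_mul (pow_mem_pow_fractionalIdeal hz D.b) D.PB_mem
  rwa [D.O_eq] at this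

lemma form_mem_iff (hq : D.IsGood q) (ρ : 𝓞 K) {z : K} (hz : z ∈ D.OB)
    (hρ : z - ρ * D.P₂ ∈ (q : FractionalIdeal (𝓞 K)⁰ K) * D.OB) :
    D.form z ∈ (q : FractionalIdeal (𝓞 K)⁰ K) * D.O ↔
      CongrMod q ((ρ : K) ^ D.b) (-(D.P₁ / D.PB)) := by
  have hρP : (ρ : K) * D.P₂ ∈ D.OB := algebraMap_mul_mem D.P₂_mem ρ
  have hg : D.P₂ ^ D.b * D.PB ∈ D.O := by
    have := mul_mem_mul (pow_mem_pow_fractionalIdeal D.P₂_mem D.b) D.PB_mem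
    rwa [D.O_eq] at this
  have he : D.P₂ ^ D.b * D.PB * ((ρ : K) ^ D.b - -(D.P₁ / D.PB)) = D.form (ρ * D.P₂) := by
    rw [form, D.A_eq]
    have := D.PB_ne_zero
    field_simp
    ring
  have hgq : idealOf (D.P₂ ^ D.b * D.PB) D.O ⊔ q = ⊤ := by
    rw [← D.O_eq, idealOf_mul (pow_ne_zero _ D.OB_ne_zero) D.OP_ne_zero
      (pow_mem_pow_fractionalIdeal D.P₂_mem D.b) D.PB_mem,
      idealOf_pow D.OB_ne_zero D.P₂_mem, ← Ideal.isCoprime_iff_sup_eq, IsCoprime.mul_left_iff]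
    exact ⟨(Ideal.isCoprime_iff_sup_eq.mpr hq.coprime_P₂).pow_left,
      Ideal.isCoprime_iff_sup_eq.mpr hq.coprime_PB⟩
  rw [congrMod_iff_mul_mem D.O_ne_zero hg hq.ne_zero hgq (by rw [he]; exact D.form_mem hρP), he]
  have hdiff : D.form z - D.form (ρ * D.P₂) ∈ (q : FractionalIdeal (𝓞 K)⁰ K) * D.O := by
    have e : D.form z - D.form (ρ * D.P₂) = (z ^ D.b - (ρ * D.P₂) ^ D.b) * D.PB := by
      rw [form, form]; ring
    rw [e, ← D.O_eq, ← mul_assoc]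
    exact mul_mem_mul (pow_sub_pow_mem hz hρP hρ D.b) D.PB_mem
  constructor
  · intro h
    have := Submodule.sub_mem _ h hdiff
    rwa [sub_sub_cancel] at this
  · intro h
    have := Submodule.add_mem _ hdiff h
    rwa [sub_add_cancel] at this

lemma roots_of_congrMod (hq : D.IsGood q) {ρ : 𝓞 K}
    (h : CongrMod q ((ρ : K) ^ D.b) (-(D.P₁ / D.PB))) : ρ ∈ D.roots q := by
  refine ⟨?_, h⟩
  rw [sup_comm]
  refine sup_eq_top_of_forall_not_dvd hq.ne_zero fun P hP hρ => ?_
  have h1 := h P 1 le_rfl (by rwa [pow_one])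
  have h2 := hq.invertible P hP
  have h3 : P.valuation K ((ρ : K) ^ D.b) < 1 := by
    rw [map_pow]
    refine pow_lt_one' ?_ D.b_ne_zero
    rw [P.valuation_lt_one_iff_mem]
    rwa [Ideal.dvd_iff_le, Ideal.span_singleton_le_iff_mem] at hρ
  have h4 : P.valuation K ((ρ : K) ^ D.b - -(D.P₁ / D.PB)) < 1 :=
    h1.trans_lt (by rw [← WithZero.exp_zero, WithZero.exp_lt_exp]; norm_num)
  have h5 : P.valuation K (-(D.P₁ / D.PB)) < 1 := by
    have : -(D.P₁ / D.PB) = (ρ : K) ^ D.b - ((ρ : K) ^ D.b - -(D.P₁ / D.PB)) := by ring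
    rw [this]
    exact Valuation.map_sub_lt _ h3 h4
  rw [Valuation.map_neg, h2] at h5
  exact lt_irrefl _ h5

lemma exists_root (hq : D.IsGood q) {z : K} (hz : z ∈ D.OB)
    (h : D.form z ∈ (q : FractionalIdeal (𝓞 K)⁰ K) * D.O) :
    ∃ ρ ∈ D.roots q, z - ρ * D.P₂ ∈ (q : FractionalIdeal (𝓞 K)⁰ K) * D.OB := by
  obtain ⟨y, hy, hzy⟩ := exists_sub_mem_of_sup_eq_top hq.coprime_P₂ hz
  rw [coe_idealOf_mul D.OB_ne_zero D.P₂_mem, mem_spanSingleton] at hy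
  obtain ⟨ρ, rfl⟩ := hy
  rw [Algebra.smul_def] at hzy
  exact ⟨ρ, D.roots_of_congrMod hq ((D.form_mem_iff hq ρ hz hzy).mp h), hzy⟩

lemma roots_eq (hq : q ≠ 0) {ρ₀ : 𝓞 K} (hρ₀ : ρ₀ ∈ D.roots q) :
    D.roots q = {ρ | ρ ^ D.b - ρ₀ ^ D.b ∈ q} := by
  have hint : ∀ y : 𝓞 K, (∀ (P : HeightOneSpectrum (𝓞 K)) (n : ℕ), 1 ≤ n → P.asIdeal ^ n ∣ q →
      P.valuation K (y : K) ≤ WithZero.exp (-(n : ℤ))) ↔ y ∈ q := by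
    intro y
    have hv : ∀ (P : HeightOneSpectrum (𝓞 K)) (n : ℕ), P.valuation K (y : K) ≤ WithZero.exp (-(n : ℤ)) ↔
        P.asIdeal ^ n ∣ Ideal.span {y} := by
      intro P n
      have e : P.valuation K (y : K) = P.intValuation y := P.valuation_of_algebraMap y
      rw [e, P.intValuation_le_pow_iff_mem, Ideal.dvd_iff_le, Ideal.span_singleton_le_iff_mem]
    rw [← Ideal.span_singleton_le_iff_mem, ← Ideal.dvd_iff_le]
    constructor
    · intro h
      exact dvd_of_forall_prime_pow_dvd q _ hq fun P n hn hd => (hv P n).mp (h P n hn hd)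
    · intro h P n hn hd
      exact (hv P n).mpr (hd.trans h)
  ext ρ
  have hcast : (((ρ ^ D.b - ρ₀ ^ D.b : 𝓞 K)) : K) = (ρ : K) ^ D.b - (ρ₀ : K) ^ D.b := by
    push_cast; rfl
  constructor
  · rintro ⟨_, h⟩
    rw [Set.mem_ofPred_eq, ← hint]
    intro P n hn hd
    have e : (((ρ ^ D.b - ρ₀ ^ D.b : 𝓞 K)) : K) =
      ((ρ : K) ^ D.b - -(D.P₁ / D.PB)) - ((ρ₀ : K) ^ D.b - -(D.P₁ / D.PB)) := by rw [hcast]; ring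
    rw [e]
    exact Valuation.map_sub_le _ (h P n hn hd) (hρ₀.2 P n hn hd)
  · intro h
    have hc : CongrMod q ((ρ : K) ^ D.b) (-(D.P₁ / D.PB)) := by
      intro P n hn hd
      have e : (ρ : K) ^ D.b - -(D.P₁ / D.PB) = (((ρ ^ D.b - ρ₀ ^ D.b : 𝓞 K)) : K) +
        ((ρ₀ : K) ^ D.b - -(D.P₁ / D.PB)) := by rw [hcast]; ring
      rw [e]
      exact Valuation.map_add_le _ ((hint _).mpr h P n hn hd) (hρ₀.2 P n hn hd)
    refine ⟨?_, hc⟩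
    rw [sup_comm]
    refine sup_eq_top_of_forall_not_dvd hq fun P hP hρ => ?_
    rw [Ideal.dvd_iff_le, Ideal.span_singleton_le_iff_mem] at hρ
    have h1 : ρ ^ D.b - ρ₀ ^ D.b ∈ P.asIdeal := Ideal.dvd_iff_le.mp hP h
    have h2 := (Submodule.sub_mem_iff_right _ (Ideal.pow_mem_of_mem _ hρ D.b
      (Nat.pos_of_ne_zero D.b_ne_zero))).mp h1
    have h3 := P.isPrime.mem_of_pow_mem _ h2
    refine not_dvd_of_dvd_of_sup_eq_top P hρ₀.1 ?_ hP
    rwa [Ideal.dvd_iff_le, Ideal.span_singleton_le_iff_mem]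

end PowerCongruence

end Residues

/-! ### The number of solutions in a region -/

section Count

variable {K : Type*} [Field K] [NumberField K]

open FractionalIdeal MeasureTheory

/-- Translates of fractional ideals have the expected number of elements in `S`, with an error as for
a region of radius `R`. -/
def WellCounted (σ : K →+* ℂ) (S : Set ℂ) (C R : ℝ) : Prop :=
  ∀ (J : FractionalIdeal (𝓞 K)⁰ K) (_ : J ≠ 0) (x : K),
    {z : K | z - x ∈ J ∧ σ z ∈ S}.Finite ∧
    |({z : K | z - x ∈ J ∧ σ z ∈ S}.ncard : ℝ) -
      2 / √|(NumberField.discr K : ℝ)| * (volume.real S / (absNorm J : ℚ))| ≤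
      C * (R / √((absNorm J : ℚ) : ℝ) + 1)

lemma absNorm_pos_of_ne_zero {q : Ideal (𝓞 K)} (hq : q ≠ 0) : 0 < Ideal.absNorm q :=
  Nat.pos_of_ne_zero (by rw [Ne, Ideal.absNorm_eq_zero_iff]; exact hq)

lemma fractionalIdeal_absNorm_pos {J : FractionalIdeal (𝓞 K)⁰ K} (hJ : J ≠ 0) :
    (0 : ℝ) < ((absNorm J : ℚ) : ℝ) := by
  have h1 := absNorm_nonneg J
  have h2 : absNorm J ≠ 0 := by
    rw [Ne, absNorm_eq_zero_iff]; exact hJ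
  exact Rat.cast_pos.mpr (lt_of_le_of_ne h1 h2.symm)

lemma absNorm_coe_mul (c : Ideal (𝓞 K)) (J : FractionalIdeal (𝓞 K)⁰ K) :
    ((absNorm ((c : FractionalIdeal (𝓞 K)⁰ K) * J) : ℚ) : ℝ) =
      (Ideal.absNorm c : ℝ) * ((absNorm J : ℚ) : ℝ) := by
  rw [map_mul, coeIdeal_absNorm]
  push_cast
  rfl

/-- The numerical part of `abs_ncard_solutions_sub_le`: `M` classes modulo an ideal of norm `n'`, each
counted up to `C (R / √(d n' N) + 1)`. -/
lemma class_error_le {M n n' c d N C R : ℝ} (hM : 0 ≤ M) (hn : 0 < n) (hn' : 0 < n')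
    (hnn : n' ≤ n) (hc : 0 ≤ c) (hd : 1 ≤ d) (hN : 0 < N) (hC : 0 ≤ C) (hR : 0 ≤ R)
    (h : M ^ 2 * n ≤ c ^ 2 * n') :
    M * (C * (R / √(d * (n' * N)) + 1)) ≤ C * c * (1 + 1 / √N) * (R / √n + 1) := by
  have hsn : 0 < √n := Real.sqrt_pos.mpr hn
  have hsn' : 0 < √n' := Real.sqrt_pos.mpr hn'
  have hsN : 0 < √N := Real.sqrt_pos.mpr hN
  have hMn : M * √n ≤ c * √n' := by
    have := Real.sqrt_le_sqrt h
    rwa [Real.sqrt_mul (sq_nonneg _), Real.sqrt_sq hM, Real.sqrt_mul (sq_nonneg _),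
      Real.sqrt_sq hc] at this
  have hMc : M ≤ c := by
    have h1 : c * √n' ≤ c * √n := by gcongr
    exact le_of_mul_le_mul_right (hMn.trans h1) hsn
  have h1 : R / √(d * (n' * N)) ≤ R / (√n' * √N) := by
    rw [← Real.sqrt_mul hn'.le]
    exact div_le_div_of_nonneg_left hR (Real.sqrt_pos.mpr (mul_pos hn' hN))
      (Real.sqrt_le_sqrt (le_mul_of_one_le_left (mul_pos hn' hN).le hd))
  have h2 : M * (R / (√n' * √N)) ≤ c * (R / √n * (1 / √N)) := by
    have e1 : M * (R / (√n' * √N)) = (M * √n) * (R / (√n' * √N * √n)) := by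
      field_simp
    have e2 : c * (R / √n * (1 / √N)) = (c * √n') * (R / (√n' * √N * √n)) := by
      field_simp
    rw [e1, e2]
    gcongr
  calc M * (C * (R / √(d * (n' * N)) + 1))
      ≤ M * (C * (R / (√n' * √N) + 1)) := by gcongr
    _ = C * (M * (R / (√n' * √N)) + M) := by ring
    _ ≤ C * (c * (R / √n * (1 / √N)) + c) := by gcongr
    _ ≤ C * (c * ((1 + 1 / √N) * (R / √n + 1))) := by
        gcongr
        have h3 : 0 ≤ R / √n := by positivity
        have h4 : 0 ≤ 1 / √N := by positivity
        nlinarith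
    _ = _ := by ring

open Classical in
/-- Solutions of the congruence modulo `q` that lie in `d OB`, for `d` prime to `q`: they form one
class modulo `d q' OB` for each class of roots modulo `q'`. -/
theorem PowerCongruence.abs_ncard_solutions_sub_le (hdeg : Module.finrank ℚ K = 2)
    (D : PowerCongruence K) {q d : Ideal (𝓞 K)} (hq : D.IsGood q) (hd : d ≠ 0) (hdq : d ⊔ q = ⊤)
    (σ : K →+* ℂ) {S : Set ℂ} {C R : ℝ} (hC : 0 ≤ C) (hR : 0 ≤ R) (hS : WellCounted σ S C R) :
    |({z : K | z ∈ (d : FractionalIdeal (𝓞 K)⁰ K) * D.OB ∧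
          D.form z ∈ (q : FractionalIdeal (𝓞 K)⁰ K) * D.O ∧ σ z ∈ S}.ncard : ℝ) -
        2 / √|(NumberField.discr K : ℝ)| * (volume.real S / ((absNorm D.OB : ℚ) : ℝ)) *
          ((rootCount q D.b (-(D.P₁ / D.PB)) : ℝ) / (Ideal.absNorm q : ℝ)) *
          (Ideal.absNorm d : ℝ)⁻¹| ≤
      C * (729 ^ omegaSix q * (D.b : ℝ) ^ omegaK q) * (1 + 1 / √((absNorm D.OB : ℚ) : ℝ)) *
        (R / √(Ideal.absNorm q : ℝ) + 1) := by
  have hNOB := fractionalIdeal_absNorm_pos D.OB_ne_zero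
  rcases (D.roots q).eq_empty_or_nonempty with hemp | ⟨ρ₀, hρ₀⟩
  · have h1 : {z : K | z ∈ (d : FractionalIdeal (𝓞 K)⁰ K) * D.OB ∧
          D.form z ∈ (q : FractionalIdeal (𝓞 K)⁰ K) * D.O ∧ σ z ∈ S} = ∅ := by
      rw [Set.eq_empty_iff_forall_notMem]
      rintro z ⟨hz, hf, _⟩
      obtain ⟨ρ, hρ, _⟩ := D.exists_root hq (coeIdeal_mul_le _ _ hz) hf
      rw [hemp] at hρ
      exact hρ
    rw [h1, D.rootCount_eq, hemp, Set.image_empty, Set.ncard_empty, Set.ncard_empty]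
    simp only [Nat.cast_zero, zero_div, mul_zero, zero_mul, sub_zero, abs_zero]
    positivity
  obtain ⟨q', hq'q, hrad, hst, hcount⟩ := exists_root_classes hdeg D.b_ne_zero q hq.ne_zero ρ₀ hρ₀.1
  rw [← D.roots_eq hq.ne_zero hρ₀] at hcount
  have hst' : ∀ ρ ∈ D.roots q, ∀ ρ', ρ' - ρ ∈ q' → ρ' ∈ D.roots q := by
    intro ρ hρ ρ' h
    rw [D.roots_eq hq.ne_zero hρ₀] at hρ ⊢
    exact hst ρ ρ' hρ h
  have hq'0 : q' ≠ 0 := ne_zero_of_dvd_ne_zero hq.ne_zero hq'q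
  have hdq' : d ⊔ q' = ⊤ := by
    rw [← top_le_iff, ← hdq]
    exact sup_le_sup_left (Ideal.dvd_iff_le.mp hq'q) _
  have hP₂q' : idealOf D.P₂ D.OB ⊔ q' = ⊤ := by
    rw [← top_le_iff, ← hq.coprime_P₂]
    exact sup_le_sup_left (Ideal.dvd_iff_le.mp hq'q) _
  have : Finite (𝓞 K ⧸ q') := Ideal.finiteQuotientOfFreeOfNeBot _ hq'0
  have : Finite (𝓞 K ⧸ q) := Ideal.finiteQuotientOfFreeOfNeBot _ hq.ne_zero
  set U := Ideal.Quotient.mk q' '' D.roots q with hU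
  have hUfin : U.Finite := Set.toFinite _
  -- a representative of each class
  have hch : ∀ u ∈ U, ∃ ρ ∈ D.roots q, Ideal.Quotient.mk q' ρ = u := fun u hu => hu
  choose! f hf using hch
  have hch2 : ∀ u ∈ U, ∃ y ∈ (d : FractionalIdeal (𝓞 K)⁰ K) * D.OB,
      (f u : K) * D.P₂ - y ∈ (q' : FractionalIdeal (𝓞 K)⁰ K) * D.OB := fun u _ =>
    exists_sub_mem_of_sup_eq_top hdq' (algebraMap_mul_mem D.P₂_mem (f u))
  choose! g hg using hch2
  set L : FractionalIdeal (𝓞 K)⁰ K := ((d * q' : Ideal (𝓞 K)) : FractionalIdeal (𝓞 K)⁰ K) * D.OB with hL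
  have hL0 : L ≠ 0 := mul_ne_zero (coeIdeal_ne_zero.mpr (mul_ne_zero hd hq'0)) D.OB_ne_zero
  have hLd : L ≤ (d : FractionalIdeal (𝓞 K)⁰ K) * D.OB := coe_mul_mono_of_dvd (dvd_mul_right _ _) _
  have hLq' : L ≤ (q' : FractionalIdeal (𝓞 K)⁰ K) * D.OB := coe_mul_mono_of_dvd (dvd_mul_left _ _) _
  let cls : 𝓞 K ⧸ q' → Set K := fun u => {z | z - g u ∈ L ∧ σ z ∈ S}
  have hclsfin : ∀ u, (cls u).Finite := fun u => (hS L hL0 (g u)).1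
  have hset : {z : K | z ∈ (d : FractionalIdeal (𝓞 K)⁰ K) * D.OB ∧
      D.form z ∈ (q : FractionalIdeal (𝓞 K)⁰ K) * D.O ∧ σ z ∈ S} =
      ((hUfin.toFinset.biUnion fun u => (hclsfin u).toFinset : Finset K) : Set K) := by
    ext z
    simp only [Finset.coe_biUnion, Set.Finite.coe_toFinset, Set.mem_iUnion, exists_prop,
      Set.mem_ofPred_eq]
    constructor
    · rintro ⟨hz, hfz, hσ⟩
      obtain ⟨ρ, hρ, hzρ⟩ := D.exists_root hq (coeIdeal_mul_le _ _ hz) hfz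
      have hu : Ideal.Quotient.mk q' ρ ∈ U := ⟨ρ, hρ, rfl⟩
      refine ⟨_, hu, ?_, hσ⟩
      set u := Ideal.Quotient.mk q' ρ
      have hρu : ρ - f u ∈ q' := Ideal.Quotient.eq.mp (hf u hu).2.symm
      refine mem_mul_of_mem_of_mem hdq' D.OB_ne_zero (Submodule.sub_mem _ hz (hg u hu).1) ?_
      have e : z - g u = (z - ρ * D.P₂) + (((ρ - f u : 𝓞 K)) : K) * D.P₂ + ((f u : K) * D.P₂ - g u) := by
        push_cast; ring
      rw [e]
      refine Submodule.add_mem _ (Submodule.add_mem _ (coe_mul_mono_of_dvd hq'q _ hzρ) ?_) (hg u hu).2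
      exact mul_mem_mul (mem_coeIdeal_of_mem _ hρu) D.P₂_mem
    · rintro ⟨u, hu, hzu, hσ⟩
      have hzd : z ∈ (d : FractionalIdeal (𝓞 K)⁰ K) * D.OB := by
        have := Submodule.add_mem _ (hLd hzu) (hg u hu).1
        rwa [sub_add_cancel] at this
      refine ⟨hzd, ?_, hσ⟩
      have hzOB := coeIdeal_mul_le _ _ hzd
      obtain ⟨y, hy, hzy⟩ := exists_sub_mem_of_sup_eq_top hq.coprime_P₂ hzOB
      rw [coe_idealOf_mul D.OB_ne_zero D.P₂_mem, mem_spanSingleton] at hy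
      obtain ⟨ρ, rfl⟩ := hy
      rw [Algebra.smul_def] at hzy
      have hρf : ρ - f u ∈ q' := by
        refine mem_of_coe_mul_mem D.OB_ne_zero D.P₂_mem hP₂q' ?_
        have e : (((ρ - f u : 𝓞 K)) : K) * D.P₂ =
            (z - g u) - (z - algebraMap (𝓞 K) K ρ * D.P₂) - ((f u : K) * D.P₂ - g u) := by
          push_cast; ring
        rw [e]
        exact Submodule.sub_mem _ (Submodule.sub_mem _ (hLq' hzu) (coe_mul_mono_of_dvd hq'q _ hzy)) (hg u hu).2
      have hρ := hst' _ (hf u hu).1 ρ hρf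
      exact (D.form_mem_iff hq ρ hzOB hzy).mpr hρ.2
  have hdisj : ∀ u ∈ hUfin.toFinset, ∀ v ∈ hUfin.toFinset, u ≠ v →
      Disjoint (hclsfin u).toFinset (hclsfin v).toFinset := by
    intro u hu v hv huv
    rw [Set.Finite.mem_toFinset] at hu hv
    rw [Finset.disjoint_left]
    intro z hzu hzv
    rw [Set.Finite.mem_toFinset] at hzu hzv
    apply huv
    rw [← (hf u hu).2, ← (hf v hv).2]
    refine Ideal.Quotient.eq.mpr (mem_of_coe_mul_mem D.OB_ne_zero D.P₂_mem hP₂q' ?_)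
    have e : (((f u - f v : 𝓞 K)) : K) * D.P₂ =
        ((f u : K) * D.P₂ - g u) - ((f v : K) * D.P₂ - g v) - (z - g u) + (z - g v) := by
      push_cast; ring
    rw [e]
    exact Submodule.add_mem _ (Submodule.sub_mem _ (Submodule.sub_mem _ (hg u hu).2 (hg v hv).2) (hLq' hzu.1)) (hLq' hzv.1)
  rw [hset, Set.ncard_coe_finset, Finset.card_biUnion hdisj]
  have hNL : ((absNorm L : ℚ) : ℝ) =
      (Ideal.absNorm d : ℝ) * ((Ideal.absNorm q' : ℝ) * ((absNorm D.OB : ℚ) : ℝ)) := by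
    rw [hL, absNorm_coe_mul, map_mul, Nat.cast_mul, mul_assoc]
  have hcard : ∀ u, ((hclsfin u).toFinset.card : ℝ) = ((cls u).ncard : ℝ) := fun u => by
    rw [Set.ncard_eq_toFinset_card _ (hclsfin u)]
  set n : ℝ := (Ideal.absNorm q : ℝ)
  set n' : ℝ := (Ideal.absNorm q' : ℝ)
  set δ : ℝ := (Ideal.absNorm d : ℝ)
  have hn : 0 < n := Nat.cast_pos.mpr (absNorm_pos_of_ne_zero hq.ne_zero)
  have hn' : 0 < n' := Nat.cast_pos.mpr (absNorm_pos_of_ne_zero hq'0)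
  have hδ : 1 ≤ δ := Nat.one_le_cast.mpr (absNorm_pos_of_ne_zero hd)
  have hnn : n' ≤ n := by
    have := Nat.le_of_dvd (absNorm_pos_of_ne_zero hq.ne_zero)
      (Ideal.absNorm_dvd_absNorm_of_le (Ideal.dvd_iff_le.mp hq'q))
    exact Nat.cast_le.mpr this
  have hroot : (rootCount q D.b (-(D.P₁ / D.PB)) : ℝ) * n' = (U.ncard : ℝ) * n := by
    have := ncard_mk_image_mul_card_eq q q' (Ideal.dvd_iff_le.mp hq'q) (D.roots q) hst'
    rw [← D.rootCount_eq, ← Submodule.cardQuot_apply, ← Submodule.cardQuot_apply,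
      ← Ideal.absNorm_apply, ← Ideal.absNorm_apply] at this
    have h2 := congrArg (Nat.cast (R := ℝ)) this
    rwa [Nat.cast_mul, Nat.cast_mul] at h2
  have hmain : 2 / √|(NumberField.discr K : ℝ)| * (volume.real S / ((absNorm D.OB : ℚ) : ℝ)) *
      ((rootCount q D.b (-(D.P₁ / D.PB)) : ℝ) / n) * δ⁻¹ =
      ∑ u ∈ hUfin.toFinset, 2 / √|(NumberField.discr K : ℝ)| * (volume.real S / ((absNorm L : ℚ) : ℝ)) := by
    rw [Finset.sum_const, ← Set.ncard_eq_toFinset_card _ hUfin, nsmul_eq_mul, hNL]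
    have : (rootCount q D.b (-(D.P₁ / D.PB)) : ℝ) / n = (U.ncard : ℝ) / n' := by
      rw [div_eq_div_iff hn.ne' hn'.ne', hroot]
    rw [this]
    have := hn'.ne'
    have : δ ≠ 0 := by linarith
    field_simp
  rw [hmain]
  push_cast
  rw [← Finset.sum_sub_distrib]
  calc _ ≤ ∑ u ∈ hUfin.toFinset, |((hclsfin u).toFinset.card : ℝ) -
          2 / √|(NumberField.discr K : ℝ)| * (volume.real S / ((absNorm L : ℚ) : ℝ))| :=
        Finset.abs_sum_le_sum_abs _ _
    _ ≤ ∑ u ∈ hUfin.toFinset, C * (R / √(δ * (n' * ((absNorm D.OB : ℚ) : ℝ))) + 1) := by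
        refine Finset.sum_le_sum fun u _ => ?_
        rw [hcard, ← hNL]
        exact (hS L hL0 (g u)).2
    _ = (U.ncard : ℝ) * (C * (R / √(δ * (n' * ((absNorm D.OB : ℚ) : ℝ))) + 1)) := by
        rw [Finset.sum_const, ← Set.ncard_eq_toFinset_card _ hUfin, nsmul_eq_mul]
    _ ≤ _ := by
        refine class_error_le (by positivity) hn hn' hnn (by positivity) hδ hNOB hC hR ?_
        have h2 := Nat.cast_le (α := ℝ).mpr hcount
        push_cast at h2
        exact h2

end Count

/-! ### Removing the coprimality conditions -/

section Inversion

variable {K : Type*} [Field K] [NumberField K]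

open FractionalIdeal MeasureTheory

open Classical in
lemma card_filter_coprime_eq_sum (Z : Finset K) (I : K → Ideal (𝓞 K)) {F : Ideal (𝓞 K)}
    (hF : F ≠ 0) :
    ((Z.filter fun z => I z ⊔ F = ⊤).card : ℝ) =
      ∑ d ∈ sqfreeDivisors F, (moebiusK d : ℝ) * ((Z.filter fun z => d ∣ I z).card : ℝ) := by
  rw [Finset.card_filter]
  push_cast
  simp_rw [← sum_moebiusK_dvd hF, Finset.sum_filter]
  rw [Finset.sum_comm]
  refine Finset.sum_congr rfl fun d _ => ?_
  rw [Finset.card_filter]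
  push_cast
  rw [Finset.mul_sum]
  exact Finset.sum_congr rfl fun z _ => by split_ifs <;> simp

lemma finsum_mem_moebiusK_eq {F : Ideal (𝓞 K)} (hF : F ≠ 0) (p : Ideal (𝓞 K) → Prop)
    [DecidablePred p] (f : Ideal (𝓞 K) → ℝ) (hf : ∀ c, moebiusK c = 0 → f c = 0) :
    ∑ᶠ c ∈ {c | c ∣ F ∧ p c}, f c = ∑ c ∈ (sqfreeDivisors F).filter p, f c := by
  apply finsum_mem_eq_sum_of_inter_support_eq
  ext c
  simp only [Set.mem_inter_iff, Set.mem_ofPred_eq, Function.mem_support, Finset.coe_filter,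
    mem_sqfreeDivisors hF]
  constructor
  · rintro ⟨⟨h1, h2⟩, h3⟩
    refine ⟨⟨⟨?_, h1⟩, h2⟩, h3⟩
    by_contra hsq
    exact h3 (hf c (by rw [moebiusK, if_neg hsq]))
  · rintro ⟨⟨⟨_, h1⟩, h2⟩, h3⟩
    exact ⟨⟨h1, h2⟩, h3⟩

lemma abs_sum_moebiusK_sub_le {F : Ideal (𝓞 K)} (hF : F ≠ 0) (x y : Ideal (𝓞 K) → ℝ) (B : ℝ)
    (h : ∀ d, d ∣ F → |x d - y d| ≤ B) :
    |∑ d ∈ sqfreeDivisors F, (moebiusK d : ℝ) * x d - ∑ d ∈ sqfreeDivisors F, (moebiusK d : ℝ) * y d| ≤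
      2 ^ omegaK F * B := by
  rw [← Finset.sum_sub_distrib]
  calc _ ≤ ∑ d ∈ sqfreeDivisors F, |(moebiusK d : ℝ) * x d - (moebiusK d : ℝ) * y d| :=
        Finset.abs_sum_le_sum_abs _ _
    _ ≤ ∑ d ∈ sqfreeDivisors F, B := by
        refine Finset.sum_le_sum fun d hd => ?_
        rw [← mul_sub, abs_mul]
        have h1 := h d ((mem_sqfreeDivisors hF).mp hd).2
        calc _ ≤ 1 * |x d - y d| := by gcongr; exact abs_moebiusK_le_one d
          _ ≤ B := by rwa [one_mul]
    _ = _ := by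
        rw [Finset.sum_const, card_sqfreeDivisors hF, nsmul_eq_mul]
        push_cast
        rfl

namespace PowerCongruence

variable (D : PowerCongruence K)

/-- The bound for the error in `PowerCongruence.abs_ncard_solutions_sub_le`. -/
def errorBound (C R : ℝ) (q : Ideal (𝓞 K)) : ℝ :=
  C * (729 ^ omegaSix q * (D.b : ℝ) ^ omegaK q) * (1 + 1 / √((absNorm D.OB : ℚ) : ℝ)) *
    (R / √(Ideal.absNorm q : ℝ) + 1)

lemma errorBound_nonneg {C R : ℝ} (hC : 0 ≤ C) (hR : 0 ≤ R) (q : Ideal (𝓞 K)) :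
    0 ≤ D.errorBound C R q := by
  unfold errorBound
  have := fractionalIdeal_absNorm_pos D.OB_ne_zero
  positivity

/-- A solution of the congruence modulo `q` is prime to `q`, because it is congruent to `ρ P₂` with
`ρ` and `P₂` prime to `q`. -/
lemma sup_eq_top_of_form_mem {q d : Ideal (𝓞 K)} (hq : D.IsGood q) {z : K} (hz : z ∈ D.OB)
    (hf : D.form z ∈ (q : FractionalIdeal (𝓞 K)⁰ K) * D.O) (hd : d ∣ idealOf z D.OB) :
    d ⊔ q = ⊤ := by
  rw [sup_comm]
  refine sup_eq_top_of_forall_not_dvd hq.ne_zero fun P hPq hPd => ?_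
  obtain ⟨ρ, hρ, hzρ⟩ := D.exists_root hq hz hf
  have h1 := (dvd_idealOf_iff D.OB_ne_zero hz _).mp (hPd.trans hd)
  have h2 := Submodule.sub_mem _ h1 (coe_mul_mono_of_dvd hPq _ hzρ)
  rw [sub_sub_cancel] at h2
  have hP₂ : idealOf D.P₂ D.OB ⊔ P.asIdeal = ⊤ := by
    rw [← top_le_iff, ← hq.coprime_P₂]
    exact sup_le_sup_left (Ideal.dvd_iff_le.mp hPq) _
  have h3 := mem_of_coe_mul_mem D.OB_ne_zero D.P₂_mem hP₂ h2
  refine not_dvd_of_dvd_of_sup_eq_top P hρ.1 ?_ hPq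
  rwa [Ideal.dvd_iff_le, Ideal.span_singleton_le_iff_mem]

lemma finite_mem_region (σ : K →+* ℂ) {S : Set ℂ} {C R : ℝ} (hS : WellCounted σ S C R) :
    {z : K | z ∈ D.OB ∧ σ z ∈ S}.Finite := by
  have := (hS D.OB D.OB_ne_zero 0).1
  simpa using this

open Classical in
/-- The solutions of the congruence modulo `q` in a region that are prime to `E`. -/
lemma abs_ncard_coprime_solutions_sub_le (hdeg : Module.finrank ℚ K = 2)
    {q E G : Ideal (𝓞 K)} (hq : D.IsGood q) (hE : E ≠ 0) (hG : G ≠ 0)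
    (hEG : ∀ P : HeightOneSpectrum (𝓞 K), P.asIdeal ∣ G ↔ P.asIdeal ∣ E ∧ P.asIdeal ∣ q)
    (σ : K →+* ℂ) {S : Set ℂ} {C R : ℝ} (hC : 0 ≤ C) (hR : 0 ≤ R) (hS : WellCounted σ S C R) :
    |({z : K | z ∈ D.OB ∧ D.form z ∈ (q : FractionalIdeal (𝓞 K)⁰ K) * D.O ∧
          idealOf z D.OB ⊔ E = ⊤ ∧ σ z ∈ S}.ncard : ℝ) -
        2 / √|(NumberField.discr K : ℝ)| * (volume.real S / ((absNorm D.OB : ℚ) : ℝ)) *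
          ((rootCount q D.b (-(D.P₁ / D.PB)) : ℝ) / (Ideal.absNorm q : ℝ)) *
          (phiStar E / phiStar G)| ≤ 2 ^ omegaK E * D.errorBound C R q := by
  have hfin : {z : K | z ∈ D.OB ∧ D.form z ∈ (q : FractionalIdeal (𝓞 K)⁰ K) * D.O ∧ σ z ∈ S}.Finite :=
    (D.finite_mem_region σ hS).subset fun z hz => ⟨hz.1, hz.2.2⟩
  set Z := hfin.toFinset with hZ
  have h1 : {z : K | z ∈ D.OB ∧ D.form z ∈ (q : FractionalIdeal (𝓞 K)⁰ K) * D.O ∧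
      idealOf z D.OB ⊔ E = ⊤ ∧ σ z ∈ S} = (Z.filter fun z => idealOf z D.OB ⊔ E = ⊤ : Finset K) := by
    ext z
    simp only [hZ, Finset.coe_filter, Set.Finite.mem_toFinset, Set.mem_ofPred_eq]
    tauto
  rw [h1, Set.ncard_coe_finset, card_filter_coprime_eq_sum Z _ hE,
    ← sum_moebiusK_invNormCoprime hE hG hEG, Finset.mul_sum]
  simp_rw [mul_left_comm _ (moebiusK _ : ℝ)]
  refine abs_sum_moebiusK_sub_le hE _ _ _ fun d hd => ?_
  have hd0 := ne_zero_of_dvd_ne_zero hE hd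
  by_cases hdq : d ⊔ q = ⊤
  · have h2 : ((Z.filter fun z => d ∣ idealOf z D.OB : Finset K) : Set K) =
        {z : K | z ∈ (d : FractionalIdeal (𝓞 K)⁰ K) * D.OB ∧
          D.form z ∈ (q : FractionalIdeal (𝓞 K)⁰ K) * D.O ∧ σ z ∈ S} := by
      ext z
      simp only [hZ, Finset.coe_filter, Set.Finite.mem_toFinset, Set.mem_ofPred_eq]
      constructor
      · rintro ⟨⟨h1, h2, h3⟩, h4⟩
        exact ⟨(dvd_idealOf_iff D.OB_ne_zero h1 d).mp h4, h2, h3⟩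
      · rintro ⟨h1, h2, h3⟩
        have h4 := coeIdeal_mul_le _ _ h1
        exact ⟨⟨h4, h2, h3⟩, (dvd_idealOf_iff D.OB_ne_zero h4 d).mpr h1⟩
    have h3 : invNormCoprime q d = (Ideal.absNorm d : ℝ)⁻¹ := if_pos hdq
    rw [← Set.ncard_coe_finset, h2, h3]
    exact D.abs_ncard_solutions_sub_le hdeg hq hd0 hdq σ hC hR hS
  · have h2 : (Z.filter fun z => d ∣ idealOf z D.OB) = ∅ := by
      rw [Finset.filter_eq_empty_iff]
      intro z hz hdz
      rw [hZ, Set.Finite.mem_toFinset] at hz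
      exact hdq (D.sup_eq_top_of_form_mem hq hz.1 hz.2.1 hdz)
    have h3 : invNormCoprime q d = 0 := if_neg hdq
    rw [h2, h3, Finset.card_empty, Nat.cast_zero, mul_zero, sub_zero, abs_zero]
    exact D.errorBound_nonneg hC hR q

lemma omegaSix_le (q : Ideal (𝓞 K)) : omegaSix q ≤ omegaK (Ideal.span {(6 : 𝓞 K)}) := by
  have h6 : Ideal.span {(6 : 𝓞 K)} ≠ 0 := by
    rw [Ideal.zero_eq_bot, Ne, Ideal.span_singleton_eq_bot]
    norm_num
  refine Set.ncard_le_ncard ?_ (finite_setOf_prime_dvd h6)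
  rintro P ⟨_, hP⟩
  change P.asIdeal ∣ _
  rw [Ideal.dvd_iff_le, Ideal.span_singleton_le_iff_mem]
  exact hP

lemma errorBound_le {C R : ℝ} (hC : 0 ≤ C) (hR : 0 ≤ R) {c PC W : Ideal (𝓞 K)} (hc : c ≠ 0)
    (hPC : PC ≠ 0) (hW : W ≠ 0) (hcW : ∀ P : HeightOneSpectrum (𝓞 K), P.asIdeal ∣ c * PC → P.asIdeal ∣ W) :
    D.errorBound C R (c * PC) ≤
      C * 729 ^ omegaK (Ideal.span {(6 : 𝓞 K)}) * (1 + 1 / √((absNorm D.OB : ℚ) : ℝ)) *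
        ((D.b : ℝ) ^ omegaK W * (R / √(Ideal.absNorm PC : ℝ) + 1)) := by
  have hNOB := fractionalIdeal_absNorm_pos D.OB_ne_zero
  have hb : (1 : ℝ) ≤ D.b := Nat.one_le_cast.mpr (Nat.pos_of_ne_zero D.b_ne_zero)
  have hω : omegaK (c * PC) ≤ omegaK W := Set.ncard_le_ncard hcW (finite_setOf_prime_dvd hW)
  have hPCpos : (0 : ℝ) < Ideal.absNorm PC := Nat.cast_pos.mpr (absNorm_pos_of_ne_zero hPC)
  have hn : (Ideal.absNorm PC : ℝ) ≤ Ideal.absNorm (c * PC) := by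
    rw [map_mul, Nat.cast_mul]
    exact le_mul_of_one_le_left hPCpos.le (Nat.one_le_cast.mpr (absNorm_pos_of_ne_zero hc))
  have h6 := omegaSix_le (c * PC)
  unfold errorBound
  calc _ ≤ C * (729 ^ omegaK (Ideal.span {(6 : 𝓞 K)}) * (D.b : ℝ) ^ omegaK W) *
        (1 + 1 / √((absNorm D.OB : ℚ) : ℝ)) * (R / √(Ideal.absNorm PC : ℝ) + 1) := by
        gcongr
        norm_num
    _ = _ := by ring

open Classical in
/-- The number of solutions `z` of the congruence modulo `PC` that lie in a region, that are prime to `E` and whose cofactor `J z` in the congruence is prime to `F`. -/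
theorem abs_ncard_sub_finsum_le (hdeg : Module.finrank ℚ K = 2)
    {PC E F H W : Ideal (𝓞 K)} (hPC : PC ≠ 0) (hE : E ≠ 0) (hF : F ≠ 0) (hW : W ≠ 0)
    (J : K → Ideal (𝓞 K))
    (hJ : ∀ z ∈ D.OB, D.form z ∈ (PC : FractionalIdeal (𝓞 K)⁰ K) * D.O → ∀ c : Ideal (𝓞 K),
      c ∣ J z ↔ D.form z ∈ ((c * PC : Ideal (𝓞 K)) : FractionalIdeal (𝓞 K)⁰ K) * D.O)
    (hgood : ∀ c, c ∣ F → c ⊔ H = ⊤ → D.IsGood (c * PC))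
    (hbad : ∀ c, c ∣ F → ¬ c ⊔ H = ⊤ → ∀ z ∈ D.OB, idealOf z D.OB ⊔ E = ⊤ →
      D.form z ∉ ((c * PC : Ideal (𝓞 K)) : FractionalIdeal (𝓞 K)⁰ K) * D.O)
    (G : Ideal (𝓞 K) → Ideal (𝓞 K)) (hG : ∀ c, c ∣ F → c ⊔ H = ⊤ → G c ≠ 0 ∧
      ∀ P : HeightOneSpectrum (𝓞 K), P.asIdeal ∣ G c ↔ P.asIdeal ∣ E ∧ P.asIdeal ∣ c * PC)
    (hFW : ∀ P : HeightOneSpectrum (𝓞 K), P.asIdeal ∣ F * PC → P.asIdeal ∣ W)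
    (σ : K →+* ℂ) {S : Set ℂ} {C R : ℝ} (hC : 0 ≤ C) (hR : 0 ≤ R) (hS : WellCounted σ S C R) :
    |({z : K | z ∈ D.OB ∧ D.form z ∈ (PC : FractionalIdeal (𝓞 K)⁰ K) * D.O ∧
          idealOf z D.OB ⊔ E = ⊤ ∧ J z ⊔ F = ⊤ ∧ σ z ∈ S}.ncard : ℝ) -
        2 / √|(NumberField.discr K : ℝ)| *
          ((∑ᶠ c ∈ {c | c ∣ F ∧ c ⊔ H = ⊤}, (moebiusK c : ℝ) / (Ideal.absNorm c : ℝ) *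
            (phiStar E / phiStar (G c)) * (rootCount (c * PC) D.b (-(D.P₁ / D.PB)) : ℝ)) *
            (volume.real S / ((Ideal.absNorm PC : ℝ) * ((absNorm D.OB : ℚ) : ℝ))))| ≤
      C * 729 ^ omegaK (Ideal.span {(6 : 𝓞 K)}) * (1 + 1 / √((absNorm D.OB : ℚ) : ℝ)) *
        (2 ^ (omegaK F + omegaK E) * (D.b : ℝ) ^ omegaK W * (R / √(Ideal.absNorm PC : ℝ) + 1)) := by
  have hNOB := fractionalIdeal_absNorm_pos D.OB_ne_zero
  have hfin : {z : K | z ∈ D.OB ∧ D.form z ∈ (PC : FractionalIdeal (𝓞 K)⁰ K) * D.O ∧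
      idealOf z D.OB ⊔ E = ⊤ ∧ σ z ∈ S}.Finite :=
    (D.finite_mem_region σ hS).subset fun z hz => ⟨hz.1, hz.2.2.2⟩
  set Z := hfin.toFinset with hZ
  have h1 : {z : K | z ∈ D.OB ∧ D.form z ∈ (PC : FractionalIdeal (𝓞 K)⁰ K) * D.O ∧
      idealOf z D.OB ⊔ E = ⊤ ∧ J z ⊔ F = ⊤ ∧ σ z ∈ S} =
      (Z.filter fun z => J z ⊔ F = ⊤ : Finset K) := by
    ext z
    simp only [hZ, Finset.coe_filter, Set.Finite.mem_toFinset, Set.mem_ofPred_eq]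
    tauto
  let y : Ideal (𝓞 K) → ℝ := fun c => if c ⊔ H = ⊤ then
    2 / √|(NumberField.discr K : ℝ)| * (volume.real S / ((absNorm D.OB : ℚ) : ℝ)) *
      ((rootCount (c * PC) D.b (-(D.P₁ / D.PB)) : ℝ) / (Ideal.absNorm (c * PC) : ℝ)) *
      (phiStar E / phiStar (G c)) else 0
  have hmain : 2 / √|(NumberField.discr K : ℝ)| *
      ((∑ᶠ c ∈ {c | c ∣ F ∧ c ⊔ H = ⊤}, (moebiusK c : ℝ) / (Ideal.absNorm c : ℝ) *
            (phiStar E / phiStar (G c)) * (rootCount (c * PC) D.b (-(D.P₁ / D.PB)) : ℝ)) *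
        (volume.real S / ((Ideal.absNorm PC : ℝ) * ((absNorm D.OB : ℚ) : ℝ)))) =
      ∑ c ∈ sqfreeDivisors F, (moebiusK c : ℝ) * y c := by
    rw [finsum_mem_moebiusK_eq hF (fun c => c ⊔ H = ⊤) _ (fun c hc => by simp [hc]), Finset.sum_mul,
      Finset.mul_sum, Finset.sum_filter]
    refine Finset.sum_congr rfl fun c _ => ?_
    simp only [y]
    split_ifs with h
    · rw [map_mul, Nat.cast_mul]
      simp only [div_eq_mul_inv, mul_inv]
      ring
    · rw [mul_zero]
  rw [h1, Set.ncard_coe_finset, card_filter_coprime_eq_sum Z _ hF, hmain]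
  set B := C * 729 ^ omegaK (Ideal.span {(6 : 𝓞 K)}) * (1 + 1 / √((absNorm D.OB : ℚ) : ℝ)) *
        ((D.b : ℝ) ^ omegaK W * (R / √(Ideal.absNorm PC : ℝ) + 1)) with hB
  have hB0 : 0 ≤ B := by positivity
  refine (abs_sum_moebiusK_sub_le hF _ y (2 ^ omegaK E * B) fun c hc => ?_).trans (le_of_eq ?_)
  · have h2 : ((Z.filter fun z => c ∣ J z : Finset K) : Set K) =
        {z : K | z ∈ D.OB ∧ D.form z ∈ ((c * PC : Ideal (𝓞 K)) : FractionalIdeal (𝓞 K)⁰ K) * D.O ∧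
          idealOf z D.OB ⊔ E = ⊤ ∧ σ z ∈ S} := by
      ext z
      simp only [hZ, Finset.coe_filter, Set.Finite.mem_toFinset, Set.mem_ofPred_eq]
      constructor
      · rintro ⟨⟨h1, h2, h3, h4⟩, h5⟩
        exact ⟨h1, (hJ z h1 h2 c).mp h5, h3, h4⟩
      · rintro ⟨h1, h2, h3, h4⟩
        have h5 := coe_mul_mono_of_dvd (dvd_mul_left PC c) _ h2
        exact ⟨⟨h1, h5, h3, h4⟩, (hJ z h1 h5 c).mpr h2⟩
    rw [← Set.ncard_coe_finset, h2]
    by_cases hcH : c ⊔ H = ⊤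
    · obtain ⟨hG0, hG1⟩ := hG c hc hcH
      have h3 := D.abs_ncard_coprime_solutions_sub_le hdeg (hgood c hc hcH) hE hG0 hG1 σ hC hR hS
      simp only [y, if_pos hcH]
      refine h3.trans ?_
      gcongr
      exact D.errorBound_le hC hR (ne_zero_of_dvd_ne_zero hF hc) hPC hW fun P hP =>
        hFW P (hP.trans (mul_dvd_mul_right hc PC))
    · have h3 : {z : K | z ∈ D.OB ∧ D.form z ∈ ((c * PC : Ideal (𝓞 K)) : FractionalIdeal (𝓞 K)⁰ K) * D.O ∧
          idealOf z D.OB ⊔ E = ⊤ ∧ σ z ∈ S} = ∅ := by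
        rw [Set.eq_empty_iff_forall_notMem]
        rintro z ⟨h1, h2, h3, _⟩
        exact hbad c hc hcH z h1 h3 h2
      rw [h3]
      simp only [y, if_neg hcH, Set.ncard_empty, Nat.cast_zero, sub_zero, abs_zero]
      positivity
  · rw [hB, pow_add]
    ring

end PowerCongruence

end Inversion

/-! ### Sets of vertices and coprimality at one prime ideal -/

section Local

variable {r s t : ℕ}

lemma graph_adj_iff (v w : Vertex r s t) :
    (graph r s t).Adj v w ↔ v ≠ w ∧ (edge v w ∨ edge w v) := by
  rw [graph, SimpleGraph.fromRel_adj]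

lemma not_adj_A_B {i : Fin (r + 1)} {j : Fin (s + 1)} (hj : j ≠ 0) :
    ¬ (graph r s t).Adj (.A i) (.B j) := by
  rw [graph_adj_iff]
  simp [edge, hj]

lemma not_adj_A_C {i : Fin (r + 1)} {l : Fin (t + 1)} (hl : l ≠ 0) :
    ¬ (graph r s t).Adj (.A i) (.C l) := by
  rw [graph_adj_iff]
  simp [edge, hl]

lemma not_adj_B_C {j : Fin (s + 1)} {l : Fin (t + 1)} (hl : l ≠ 0) :
    ¬ (graph r s t).Adj (.B j) (.C l) := by
  rw [graph_adj_iff]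
  simp [edge, hl]

lemma adj_A_D_iff {i : Fin (r + 1)} : (graph r s t).Adj (.A i) .D ↔ i.val = min 1 r := by
  rw [graph_adj_iff]
  simp [edge]

lemma adj_B_D_iff {i : Fin (s + 1)} : (graph r s t).Adj (.B i) .D ↔ i.val = min 1 s := by
  rw [graph_adj_iff]
  simp [edge]

lemma adj_C_D_iff {i : Fin (t + 1)} : (graph r s t).Adj (.C i) .D ↔ i.val = min 1 t := by
  rw [graph_adj_iff]
  simp [edge]

lemma adj_B_zero_iff {j : Fin (s + 1)} (hj : j ≠ 0) :
    (graph r s t).Adj (.B 0) (.B j) ↔ j.val = s := by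
  have : j.val ≠ 0 := fun h => hj (Fin.ext h)
  rw [graph_adj_iff]
  simp [edge, branchEdge, hj, hj.symm]

lemma adj_C_zero_iff {j : Fin (t + 1)} (hj : j ≠ 0) :
    (graph r s t).Adj (.C 0) (.C j) ↔ j.val = t := by
  have : j.val ≠ 0 := fun h => hj (Fin.ext h)
  rw [graph_adj_iff]
  simp [edge, branchEdge, hj, hj.symm]

/-- The graph `G'` is a tree; in particular it contains no triangle. -/
lemma graph'_no_triangle {u v w : inner r s t} (h1 : (graph' r s t).Adj u v)
    (h2 : (graph' r s t).Adj u w) (h3 : (graph' r s t).Adj v w) : False := by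
  obtain ⟨u, hu⟩ := u
  obtain ⟨v, hv⟩ := v
  obtain ⟨w, hw⟩ := w
  simp only [graph', SimpleGraph.comap_adj, Function.Embedding.subtype_apply, graph_adj_iff] at h1 h2 h3
  rcases u with ⟨⟨i, hi⟩⟩ | ⟨⟨i, hi⟩⟩ | ⟨⟨i, hi⟩⟩ | _ <;>
  rcases v with ⟨⟨j, hj⟩⟩ | ⟨⟨j, hj⟩⟩ | ⟨⟨j, hj⟩⟩ | _ <;>
  rcases w with ⟨⟨l, hl⟩⟩ | ⟨⟨l, hl⟩⟩ | ⟨⟨l, hl⟩⟩ | _ <;>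
  simp [edge, branchEdge, inner] at h1 h2 h3 hu hv hw <;> omega

/-- The vertices of `G'` that belong to `X` are pairwise adjacent. For the set `X` of the vertices `v`
such that `𝔭 ∣ I_v`, this means that the factor of `θ_0` at `𝔭` is `1`, see
`theta0Local_eq_one_iff`. -/
def IsLocallyGood (X : Vertex r s t → Prop) : Prop :=
  ∀ v w : inner r s t, v ≠ w → X v.1 → X w.1 → (graph r s t).Adj v.1 w.1

lemma theta0Local_eq_one_iff (X : Vertex r s t → Prop) :
    theta0Local {v : inner r s t | X v.1} = 1 ↔ IsLocallyGood X := by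
  rw [theta0Local]
  constructor
  · intro h
    split_ifs at h with hc
    · intro v w hvw hv hw
      have hv' : v ∈ {v : inner r s t | X v.1} := hv
      have hw' : w ∈ {v : inner r s t | X v.1} := hw
      rcases hc with hc | ⟨u, hc⟩ | ⟨u, u', hadj, hc⟩
      · rw [hc] at hv'
        exact hv'.elim
      · rw [hc] at hv' hw'
        exact (hvw (hv'.trans hw'.symm)).elim
      · rw [hc] at hv' hw'
        have hadj' : (graph r s t).Adj u.1 u'.1 := hadj
        rcases hv' with rfl | hv' <;> rcases hw' with rfl | hw'
        · exact (hvw rfl).elim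
        · rw [Set.mem_singleton_iff.mp hw']; exact hadj'
        · rw [Set.mem_singleton_iff.mp hv']; exact hadj'.symm
        · exact (hvw (hv'.trans hw'.symm)).elim
    · exact (zero_ne_one h).elim
  · intro h
    rw [if_pos]
    rcases Set.eq_empty_or_nonempty {v : inner r s t | X v.1} with he | ⟨v, hv⟩
    · exact Or.inl he
    right
    by_cases hs : ∃ w, X w.1 ∧ w ≠ v
    · obtain ⟨w, hw, hwv⟩ := hs
      have hvw : (graph' r s t).Adj v w := h v w hwv.symm hv hw
      refine Or.inr ⟨v, w, hvw, ?_⟩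
      ext u
      constructor
      · intro hu
        by_contra hn
        rw [Set.mem_insert_iff, Set.mem_singleton_iff, not_or] at hn
        exact graph'_no_triangle hvw (h v u (Ne.symm hn.1) hv hu) (h w u (Ne.symm hn.2) hw hu)
      · rintro (rfl | rfl)
        · exact hv
        · exact hw
    · push Not at hs
      refine Or.inl ⟨v, ?_⟩
      ext u
      exact ⟨fun hu => hs u hu, fun hu => by rw [Set.mem_singleton_iff.mp hu]; exact hv⟩

lemma theta0Local_eq_zero_or_one (J : Set (inner r s t)) : theta0Local J = 0 ∨ theta0Local J = 1 := by
  rw [theta0Local]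
  split_ifs
  · exact Or.inr rfl
  · exact Or.inl rfl


end Local

section LocalConditions

variable {r s t : ℕ} {X : Vertex r s t → Prop}

lemma IsLocallyGood.not_A_B (hX : IsLocallyGood X) {i : Fin (r + 1)} {j : Fin (s + 1)} (hj : j ≠ 0)
    (hi : X (.A i)) (hj' : X (.B j)) : False :=
  not_adj_A_B hj (hX ⟨.A i, by simp [inner]⟩ ⟨.B j, by simp [inner, hj]⟩
    (fun h => by simpa using congrArg Subtype.val h) hi hj')

lemma IsLocallyGood.not_A_C (hX : IsLocallyGood X) {i : Fin (r + 1)} {l : Fin (t + 1)} (hl : l ≠ 0)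
    (hi : X (.A i)) (hl' : X (.C l)) : False :=
  not_adj_A_C hl (hX ⟨.A i, by simp [inner]⟩ ⟨.C l, by simp [inner, hl]⟩
    (fun h => by simpa using congrArg Subtype.val h) hi hl')

lemma IsLocallyGood.not_B_C (hX : IsLocallyGood X) {j : Fin (s + 1)} {l : Fin (t + 1)} (hj : j ≠ 0)
    (hl : l ≠ 0) (hj' : X (.B j)) (hl' : X (.C l)) : False :=
  not_adj_B_C hl (hX ⟨.B j, by simp [inner, hj]⟩ ⟨.C l, by simp [inner, hl]⟩
    (fun h => by simpa using congrArg Subtype.val h) hj' hl')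

lemma IsLocallyGood.A_D (hX : IsLocallyGood X) {i : Fin (r + 1)} (hi : X (.A i)) (hD : X .D) :
    i.val = min 1 r :=
  adj_A_D_iff.mp (hX ⟨.A i, by simp [inner]⟩ ⟨.D, by simp [inner]⟩
    (fun h => by simpa using congrArg Subtype.val h) hi hD)

/-- Some vertex that contributes to `Π'(I_D, I_B) Π(I_A)` lies in `X`. -/
def MeetsE (X : Vertex r s t → Prop) : Prop :=
  (s ≠ 0 ∧ (X .D ∨ ∃ j : Fin s, j.val + 1 < s ∧ X (.B j.succ))) ∨ ∃ i : Fin r, X (.A i.succ)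

/-- Some vertex that contributes to `Π'(I_D, I_C)` lies in `X`. -/
def MeetsF (X : Vertex r s t → Prop) : Prop :=
  t ≠ 0 ∧ (X .D ∨ ∃ l : Fin t, l.val + 1 < t ∧ X (.C l.succ))

/-- Some vertex that contributes to `I_{A_0} Π(I_A) Π(I_B)` lies in `X`. -/
def MeetsH (X : Vertex r s t → Prop) : Prop :=
  (∃ i, X (.A i)) ∨ ∃ j : Fin s, X (.B j.succ)

lemma MeetsE.of_A {i : Fin (r + 1)} (hi : i ≠ 0) (h : X (.A i)) : MeetsE X := by
  obtain ⟨i, rfl⟩ := Fin.exists_succ_eq.mpr hi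
  exact Or.inr ⟨i, h⟩

lemma IsLocallyGood.MeetsE_of_A_D (hX : IsLocallyGood X) (hrs : 1 ≤ r + s) {i : Fin (r + 1)}
    (hi : X (.A i)) (hD : X .D) : MeetsE X := by
  by_cases h0 : i = 0
  · have := hX.A_D hi hD
    rw [h0, Fin.val_zero] at this
    exact Or.inl ⟨by omega, Or.inl hD⟩
  · exact MeetsE.of_A h0 hi

/-- If a prime ideal divides both `Π'(I_D, I_C)` and `I_{A_0} Π(I_A) Π(I_B)`, and if `I_{B_0}` is
prime to `Π'(I_D, I_B) Π(I_A)`, then it divides exactly one of the terms of the torsor equation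
that belong to `A` and `B`. -/
lemma IsLocallyGood.false_of_meetsF_of_meetsH (hX : IsLocallyGood X) (hrs : 1 ≤ r + s)
    (hF : MeetsF X) (hH : MeetsH X) (hE : X (.B 0) → ¬ MeetsE X)
    (hAB : (∃ i, X (.A i)) ↔ ∃ j, X (.B j)) : False := by
  obtain ⟨-, hD | ⟨l, -, hl⟩⟩ := hF
  · have key : ∀ i, X (.A i) → False := fun i hi => by
      obtain ⟨j, hj⟩ := hAB.mp ⟨i, hi⟩
      by_cases h0 : j = 0
      · rw [h0] at hj
        exact hE hj (hX.MeetsE_of_A_D hrs hi hD)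
      · exact hX.not_A_B h0 hi hj
    rcases hH with ⟨i, hi⟩ | ⟨j, hj⟩
    · exact key i hi
    · obtain ⟨i, hi⟩ := hAB.mpr ⟨_, hj⟩
      exact key i hi
  · rcases hH with ⟨i, hi⟩ | ⟨j, hj⟩
    · exact hX.not_A_C (Fin.succ_ne_zero l) hi hl
    · exact hX.not_B_C (Fin.succ_ne_zero j) (Fin.succ_ne_zero l) hj hl

/-- The coprimality conditions at one prime ideal, for the set `X` of the vertices `v` such that it
divides `I_v`. -/
def LocalCoprimality (X : Vertex r s t → Prop) : Prop :=
  (∀ v w, v ≠ w → ¬ (graph r s t).Adj v w → X v → ¬ X w) ∧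
  (X .D → ∀ v ∈ ({.A 0, .B 0, .C 0} : Set (Vertex r s t)),
    ∀ w ∈ ({.A 0, .B 0, .C 0} : Set (Vertex r s t)), X v → X w → v = w)

/-- The coprimality conditions split into a condition on `G'`, one on `B_0` and one on `C_0`. The
hypotheses `hACB` and `hBCA` hold for solutions of the torsor equation: a prime ideal dividing two of
its terms divides the third. -/
lemma localCoprimality_iff (hrs : 1 ≤ r + s)
    (hACB : (∃ i, X (.A i)) → (∃ l, X (.C l)) → ∃ j, X (.B j))
    (hBCA : (∃ j, X (.B j)) → (∃ l, X (.C l)) → ∃ i, X (.A i)) :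
    LocalCoprimality X ↔ IsLocallyGood X ∧ (X (.B 0) → ¬ MeetsE X) ∧ (X (.C 0) → ¬ MeetsF X) := by
  constructor
  · rintro ⟨h1, -⟩
    have h1' : ∀ v w, v ≠ w → X v → X w → (graph r s t).Adj v w := fun v w hvw hv hw => by
      by_contra hn
      exact h1 v w hvw hn hv hw
    refine ⟨fun v w hvw => h1' v.1 w.1 (fun h => hvw (Subtype.ext h)), fun hB hE => ?_, fun hC hF => ?_⟩
    · rcases hE with ⟨hs, hD | ⟨j, hj, hjX⟩⟩ | ⟨i, hi⟩
      · have := adj_B_D_iff.mp (h1' _ _ (by simp) hB hD)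
        rw [Fin.val_zero] at this
        omega
      · have := (adj_B_zero_iff (Fin.succ_ne_zero j)).mp
          (h1' _ _ (by simp [(Fin.succ_ne_zero j).symm]) hB hjX)
        rw [Fin.val_succ] at this
        omega
      · have h := h1' (.A i.succ) (.B 0) (by simp) hi hB
        rw [graph_adj_iff] at h
        simp [edge] at h
    · obtain ⟨ht, hD | ⟨l, hl, hlX⟩⟩ := hF
      · have := adj_C_D_iff.mp (h1' _ _ (by simp) hC hD)
        rw [Fin.val_zero] at this
        omega
      · have := (adj_C_zero_iff (Fin.succ_ne_zero l)).mp
          (h1' _ _ (by simp [(Fin.succ_ne_zero l).symm]) hC hlX)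
        rw [Fin.val_succ] at this
        omega
  · rintro ⟨hX, hE, hF⟩
    -- a set that meets both `A` and `C` contains `B_0`, and no `A_i` except for `A_0`
    have noAC : ∀ i, X (.A i) → (∃ l, X (.C l)) → i = 0 ∧ X (.B 0) := by
      intro i hi hC
      obtain ⟨j, hj⟩ := hACB ⟨i, hi⟩ hC
      by_cases hj0 : j = 0
      · rw [hj0] at hj
        refine ⟨?_, hj⟩
        by_contra hi0
        exact hE hj (MeetsE.of_A hi0 hi)
      · exact (hX.not_A_B hj0 hi hj).elim
    -- the pairs that contain `B_0`
    have hB0 : ∀ w, w ≠ .B 0 → X (.B 0) → X w → (graph r s t).Adj (.B 0) w := by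
      intro w hw hB hwX
      rcases w with i | j | l | _
      · have hi : i = 0 := by
          by_contra hi0
          exact hE hB (MeetsE.of_A hi0 hwX)
        rw [hi, graph_adj_iff]
        simp [edge]
      · have hj : j ≠ 0 := fun h => hw (by rw [h])
        rw [adj_B_zero_iff hj]
        by_contra hn
        obtain ⟨j, rfl⟩ := Fin.exists_succ_eq.mpr hj
        have := j.isLt
        rw [Fin.val_succ] at hn
        exact hE hB (Or.inl ⟨by omega, Or.inr ⟨j, by omega, hwX⟩⟩)
      · by_cases hl : l = 0
        · rw [hl, graph_adj_iff]
          simp [edge]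
        · obtain ⟨i, hi⟩ := hBCA ⟨_, hB⟩ ⟨l, hwX⟩
          exact (hX.not_A_C hl hi hwX).elim
      · rw [adj_B_D_iff]
        by_contra hn
        refine hE hB (Or.inl ⟨?_, Or.inl hwX⟩)
        rintro h0
        subst h0
        exact hn (by simp)
    have hC0 : ∀ w, w ≠ .C 0 → X (.C 0) → X w → (graph r s t).Adj (.C 0) w := by
      intro w hw hC hwX
      rcases w with i | j | l | _
      · rw [(noAC i hwX ⟨0, hC⟩).1, graph_adj_iff]
        simp [edge]
      · by_cases hj : j = 0
        · rw [hj, graph_adj_iff]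
          simp [edge]
        · obtain ⟨i, hi⟩ := hBCA ⟨j, hwX⟩ ⟨0, hC⟩
          exact (hX.not_A_B hj hi hwX).elim
      · have hl : l ≠ 0 := fun h => hw (by rw [h])
        rw [adj_C_zero_iff hl]
        by_contra hn
        obtain ⟨l, rfl⟩ := Fin.exists_succ_eq.mpr hl
        have := l.isLt
        rw [Fin.val_succ] at hn
        exact hF hC ⟨by omega, Or.inr ⟨l, by omega, hwX⟩⟩
      · rw [adj_C_D_iff]
        by_contra hn
        refine hF hC ⟨?_, Or.inl hwX⟩
        rintro h0
        subst h0
        exact hn (by simp)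
    refine ⟨fun v w hvw hadj hv hw => hadj ?_, fun hD => ?_⟩
    · by_cases hvB : v = .B 0
      · subst hvB; exact hB0 w hvw.symm hv hw
      by_cases hvC : v = .C 0
      · subst hvC; exact hC0 w hvw.symm hv hw
      by_cases hwB : w = .B 0
      · subst hwB; exact (hB0 v hvw hw hv).symm
      by_cases hwC : w = .C 0
      · subst hwC; exact (hC0 v hvw hw hv).symm
      exact hX ⟨v, hvB, hvC⟩ ⟨w, hwB, hwC⟩ (fun h => hvw (congrArg Subtype.val h)) hv hw
    · have hABD : ∀ i, X (.A i) → ¬ X (.B 0) := fun i hi hB => hE hB (hX.MeetsE_of_A_D hrs hi hD)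
      have hAC : X (.A 0) → ¬ X (.C 0) := fun hA hC => hABD 0 hA (noAC 0 hA ⟨0, hC⟩).2
      have hBC : X (.B 0) → ¬ X (.C 0) := fun hB hC => by
        obtain ⟨i, hi⟩ := hBCA ⟨0, hB⟩ ⟨0, hC⟩
        exact hABD i hi hB
      rintro v (rfl | rfl | rfl) w (rfl | rfl | rfl) hv hw
      · rfl
      · exact (hABD 0 hv hw).elim
      · exact (hAC hv hw).elim
      · exact (hABD 0 hw hv).elim
      · rfl
      · exact (hBC hv hw).elim
      · exact (hAC hw hv).elim
      · exact (hBC hw hv).elim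
      · rfl

end LocalConditions

/-! ### From vertices to ideals -/

section Divisibility

variable {K : Type*} [Field K] [NumberField K] {r s t : ℕ}

open FractionalIdeal

instance : Finite (Vertex r s t) := by
  let f : Fin (r + 1) ⊕ Fin (s + 1) ⊕ Fin (t + 1) ⊕ Unit → Vertex r s t :=
    Sum.elim .A (Sum.elim .B (Sum.elim .C fun _ => .D))
  refine Finite.of_surjective f fun v => ?_
  rcases v with i | i | i | _
  · exact ⟨.inl i, rfl⟩
  · exact ⟨.inr (.inl i), rfl⟩
  · exact ⟨.inr (.inr (.inl i)), rfl⟩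
  · exact ⟨.inr (.inr (.inr ())), rfl⟩

lemma sup_eq_top_iff (x y : Ideal (𝓞 K)) :
    x ⊔ y = ⊤ ↔ ∀ P : HeightOneSpectrum (𝓞 K), P.asIdeal ∣ x → ¬ P.asIdeal ∣ y := by
  refine ⟨fun h P hx => not_dvd_of_dvd_of_sup_eq_top P h hx, fun h => ?_⟩
  by_contra hne
  obtain ⟨M, hM, hle⟩ := Ideal.exists_le_maximal _ hne
  exact h ⟨M, hM.isPrime, Ring.ne_bot_of_isMaximal_of_not_isField hM (RingOfIntegers.not_isField K)⟩
    (Ideal.dvd_iff_le.mpr (le_sup_left.trans hle)) (Ideal.dvd_iff_le.mpr (le_sup_right.trans hle))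

/-- The vertices `v` such that `P` divides the ideal `x_v J_v⁻¹`. -/
def divides (P : HeightOneSpectrum (𝓞 K)) (J : Vertex r s t → FractionalIdeal (𝓞 K)⁰ K)
    (x : Vertex r s t → K) (v : Vertex r s t) : Prop :=
  P.asIdeal ∣ idealOf (x v) (J v)

lemma theta0_eq_zero_or_one (I : inner r s t → Ideal (𝓞 K)) : theta0 I = 0 ∨ theta0 I = 1 := by
  by_cases h : ∃ P, theta0Local (divSet P I) = 0
  · by_cases hf : Function.HasFiniteMulSupport
        fun P : HeightOneSpectrum (𝓞 K) => theta0Local (divSet P I)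
    · obtain ⟨P, hP⟩ := h
      exact Or.inl (finprod_eq_zero _ P hP hf)
    · exact Or.inr (finprod_of_not_hasFiniteMulSupport hf)
  · push Not at h
    exact Or.inr (finprod_eq_one_of_forall_eq_one fun P =>
      (theta0Local_eq_zero_or_one _).resolve_left (h P))

lemma theta0_ne_zero_iff {I : inner r s t → Ideal (𝓞 K)} (hI : ∀ v, v ≠ vA 0 → I v ≠ 0) :
    theta0 I ≠ 0 ↔ ∀ P, theta0Local (divSet P I) = 1 := by
  constructor
  · intro h P
    refine (theta0Local_eq_zero_or_one _).resolve_left fun h0 => h (finprod_eq_zero _ P h0 ?_)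
    have hfin : (⋃ v ∈ {v : inner r s t | v ≠ vA 0},
        {P : HeightOneSpectrum (𝓞 K) | P.asIdeal ∣ I v}).Finite :=
      Set.Finite.biUnion (Set.toFinite _) fun v hv => finite_setOf_prime_dvd (hI v hv)
    refine hfin.subset fun P hP => ?_
    -- a factor different from `1` belongs to a prime ideal that divides `I_v` for some `v ≠ A_0`
    by_contra hn
    simp only [Set.mem_iUnion, Set.mem_ofPred_eq, not_exists] at hn
    have hsub : divSet P I ⊆ {vA 0} := fun v hv => by
      by_contra hne
      exact hn v hne hv
    refine hP ?_
    show theta0Local (divSet P I) = 1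
    rw [theta0Local, if_pos]
    rcases Set.subset_singleton_iff_eq.mp hsub with h | h
    · exact Or.inl h
    · exact Or.inr (Or.inl ⟨_, h⟩)
  · intro h
    rw [theta0, finprod_eq_one_of_forall_eq_one h]
    exact one_ne_zero

lemma prime_dvd_prod_pow_iff (P : HeightOneSpectrum (𝓞 K)) {ι : Type*} (S : Finset ι)
    (I : ι → Ideal (𝓞 K)) {e : ι → ℕ} (he : ∀ i, 0 < e i) :
    P.asIdeal ∣ ∏ i ∈ S, I i ^ e i ↔ ∃ i ∈ S, P.asIdeal ∣ I i := by
  rw [P.prime.dvd_finsetProd_iff]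
  exact exists_congr fun i => and_congr_right fun _ => P.prime.dvd_pow_iff_dvd (he i).ne'

lemma prod_mem_coe_mul_prod_iff (P : HeightOneSpectrum (𝓞 K)) {ι : Type*} (S : Finset ι) {x : ι → K}
    {J : ι → FractionalIdeal (𝓞 K)⁰ K} (hJ : ∀ i, J i ≠ 0) (hx : ∀ i, x i ∈ J i) {e : ι → ℕ}
    (he : ∀ i, 0 < e i) :
    ∏ i ∈ S, x i ^ e i ∈ (P.asIdeal : FractionalIdeal (𝓞 K)⁰ K) * ∏ i ∈ S, J i ^ e i ↔
      ∃ i ∈ S, P.asIdeal ∣ idealOf (x i) (J i) := by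
  have h := prod_mem_and_idealOf_prod S x J hJ hx e
  rw [← dvd_idealOf_iff (Finset.prod_ne_zero_iff.mpr fun i _ => pow_ne_zero _ (hJ i)) h.1, h.2,
    prime_dvd_prod_pow_iff P S _ he]

namespace TorsorData

variable (T : TorsorData K r s t)

lemma total_ne_zero : T.total ≠ 0 :=
  Finset.prod_ne_zero_iff.mpr fun _ _ => pow_ne_zero _ (T.O_ne_zero _)

section Terms

variable {T} {ξ : Vertex r s t → K} (hξ : ∀ v, ξ v ∈ T.O v)
include hξ

lemma prod_A_mem_iff (P : HeightOneSpectrum (𝓞 K)) :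
    ∏ i, ξ (.A i) ^ T.a i ∈ (P.asIdeal : FractionalIdeal (𝓞 K)⁰ K) * T.total ↔
      ∃ i, divides P T.O ξ (.A i) := by
  rw [total, prod_mem_coe_mul_prod_iff P _ (fun i => T.O_ne_zero (.A i)) (fun i => hξ (.A i)) T.a_pos]
  simp [divides]

lemma prod_B_mem_iff (P : HeightOneSpectrum (𝓞 K)) :
    ∏ i, ξ (.B i) ^ T.b i ∈ (P.asIdeal : FractionalIdeal (𝓞 K)⁰ K) * T.total ↔
      ∃ i, divides P T.O ξ (.B i) := by
  rw [total, T.O_A_eq_O_B,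
    prod_mem_coe_mul_prod_iff P _ (fun i => T.O_ne_zero (.B i)) (fun i => hξ (.B i)) T.b_pos]
  simp [divides]

lemma prod_C_mem_iff (P : HeightOneSpectrum (𝓞 K)) :
    ξ (.C 0) * ∏ i : Fin t, ξ (.C i.succ) ^ T.c i ∈
        (P.asIdeal : FractionalIdeal (𝓞 K)⁰ K) * T.total ↔ ∃ i, divides P T.O ξ (.C i) := by
  have h := prod_mem_and_idealOf_prod Finset.univ (fun i : Fin t => ξ (.C i.succ))
    (fun i : Fin t => T.O (.C i.succ)) (fun i => T.O_ne_zero _) (fun i => hξ _) T.c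
  have h0 : ∏ i : Fin t, T.O (.C i.succ) ^ T.c i ≠ 0 :=
    Finset.prod_ne_zero_iff.mpr fun _ _ => pow_ne_zero _ (T.O_ne_zero _)
  rw [total, T.O_A_eq_O_C, ← dvd_idealOf_iff (mul_ne_zero (T.O_ne_zero _) h0)
    (mul_mem_mul (hξ (.C 0)) h.1), idealOf_mul (T.O_ne_zero _) h0 (hξ _) h.1, h.2,
    P.prime.dvd_mul, prime_dvd_prod_pow_iff P _ _ T.c_pos, Fin.exists_fin_succ]
  simp [divides]

lemma localCoprimality_of_torsorEquation_iff (hrs : 1 ≤ r + s) (heq : T.TorsorEquation ξ)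
    (P : HeightOneSpectrum (𝓞 K)) :
    LocalCoprimality (divides P T.O ξ) ↔ IsLocallyGood (divides P T.O ξ) ∧
      (divides P T.O ξ (.B 0) → ¬ MeetsE (divides P T.O ξ)) ∧
      (divides P T.O ξ (.C 0) → ¬ MeetsF (divides P T.O ξ)) := by
  rw [TorsorEquation] at heq
  apply localCoprimality_iff hrs
  · rw [← prod_A_mem_iff hξ, ← prod_B_mem_iff hξ, ← prod_C_mem_iff hξ]
    intro h1 h2
    rw [add_right_comm] at heq
    rw [eq_neg_of_add_eq_zero_right heq]
    exact Submodule.neg_mem _ (Submodule.add_mem _ h1 h2)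
  · rw [← prod_A_mem_iff hξ, ← prod_B_mem_iff hξ, ← prod_C_mem_iff hξ]
    intro h1 h2
    rw [add_assoc] at heq
    rw [eq_neg_of_add_eq_zero_left heq]
    exact Submodule.neg_mem _ (Submodule.add_mem _ h1 h2)

end Terms

lemma coprimality_iff (ξ : Vertex r s t → K) :
    T.Coprimality ξ ↔ ∀ P, LocalCoprimality (divides P T.O ξ) := by
  simp only [Coprimality, sup_eq_top_iff]
  constructor
  · intro h P
    exact ⟨fun v w hvw hadj => h.1 v w hvw hadj P, fun hD => h.2 P hD⟩
  · intro h
    exact ⟨fun v w hvw hadj P => (h P).1 v w hvw hadj, fun P hD => (h P).2 hD⟩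

section Inner

variable {T} {η : inner r s t → K}

lemma idealsOf_ne_zero (hη : η ∈ T.dom) {v : inner r s t} (hv : v ≠ vA 0) :
    T.idealsOf η v ≠ 0 := by
  rw [idealsOf, Ne, idealOf_eq_zero_iff (T.O_ne_zero _) (hη v).1]
  intro h
  rcases (hη v).2 h with h | h | h
  · exact v.2.1 h
  · exact v.2.2 h
  · exact hv (Subtype.ext h.1)

lemma PiA_ne_zero (hη : η ∈ T.dom) : T.PiA (T.idealsOf η) ≠ 0 :=
  Finset.prod_ne_zero_iff.mpr fun i _ => pow_ne_zero _ (idealsOf_ne_zero hη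
    fun h => by simpa [vA] using congrArg Subtype.val h)

lemma PiC_ne_zero (hη : η ∈ T.dom) : T.PiC (T.idealsOf η) ≠ 0 :=
  Finset.prod_ne_zero_iff.mpr fun i _ => pow_ne_zero _ (idealsOf_ne_zero hη
    fun h => by simpa [vA, vC] using congrArg Subtype.val h)

lemma idealsOf_D_ne_zero (hη : η ∈ T.dom) : T.idealsOf η vD ≠ 0 :=
  idealsOf_ne_zero hη fun h => by simpa [vA, vD] using congrArg Subtype.val h

lemma PiB'_ne_zero (hη : η ∈ T.dom) : PiB' (T.idealsOf η) ≠ 0 := by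
  rw [PiB']
  split_ifs
  · exact one_ne_zero
  · exact mul_ne_zero (idealsOf_D_ne_zero hη) (Finset.prod_ne_zero_iff.mpr fun i _ =>
      idealsOf_ne_zero hη fun h => by simpa [vA, vB] using congrArg Subtype.val h)

lemma PiC'_ne_zero (hη : η ∈ T.dom) : PiC' (T.idealsOf η) ≠ 0 := by
  rw [PiC']
  split_ifs
  · exact one_ne_zero
  · exact mul_ne_zero (idealsOf_D_ne_zero hη) (Finset.prod_ne_zero_iff.mpr fun i _ =>
      idealsOf_ne_zero hη fun h => by simpa [vA, vC] using congrArg Subtype.val h)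

section Full

variable {ξ : Vertex r s t → K} (P : HeightOneSpectrum (𝓞 K)) (hξ : ∀ v : inner r s t, ξ v.1 = η v)
include hξ

lemma dvd_idealsOf_iff (v : inner r s t) :
    P.asIdeal ∣ T.idealsOf η v ↔ divides P T.O ξ v.1 := by
  rw [divides, hξ, idealsOf]

lemma dvd_PiA_iff : P.asIdeal ∣ T.PiA (T.idealsOf η) ↔ ∃ i : Fin r, divides P T.O ξ (.A i.succ) := by
  rw [PiA, prime_dvd_prod_pow_iff P _ _ fun i : Fin r => T.a_pos i.succ]
  simp only [Finset.mem_univ, true_and, dvd_idealsOf_iff P hξ]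
  rfl

lemma dvd_PiB_iff : P.asIdeal ∣ T.PiB (T.idealsOf η) ↔ ∃ i : Fin s, divides P T.O ξ (.B i.succ) := by
  rw [PiB, prime_dvd_prod_pow_iff P _ _ fun i : Fin s => T.b_pos i.succ]
  simp only [Finset.mem_univ, true_and, dvd_idealsOf_iff P hξ]
  rfl

lemma dvd_PiC_iff : P.asIdeal ∣ T.PiC (T.idealsOf η) ↔ ∃ i : Fin t, divides P T.O ξ (.C i.succ) := by
  rw [PiC, prime_dvd_prod_pow_iff P _ _ T.c_pos]
  simp only [Finset.mem_univ, true_and, dvd_idealsOf_iff P hξ]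
  rfl

lemma dvd_PiB'_mul_PiA_iff :
    P.asIdeal ∣ PiB' (T.idealsOf η) * T.PiA (T.idealsOf η) ↔ MeetsE (divides P T.O ξ) := by
  rw [P.prime.dvd_mul, dvd_PiA_iff P hξ, MeetsE, PiB']
  refine or_congr_left ?_
  split_ifs with h
  · exact iff_of_false P.prime.not_dvd_one fun h' => h'.1 h
  · rw [P.prime.dvd_mul, P.prime.dvd_finsetProd_iff]
    simp only [Finset.mem_filter, Finset.mem_univ, true_and, dvd_idealsOf_iff P hξ]
    simp only [h, ne_eq, not_false_eq_true, true_and]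
    rfl

lemma dvd_PiC'_iff : P.asIdeal ∣ PiC' (T.idealsOf η) ↔ MeetsF (divides P T.O ξ) := by
  rw [MeetsF, PiC']
  split_ifs with h
  · exact iff_of_false P.prime.not_dvd_one fun h' => h'.1 h
  · rw [P.prime.dvd_mul, P.prime.dvd_finsetProd_iff]
    simp only [Finset.mem_filter, Finset.mem_univ, true_and, dvd_idealsOf_iff P hξ]
    simp only [h, ne_eq, not_false_eq_true, true_and]
    rfl

lemma dvd_A_mul_PiA_mul_PiB_iff :
    P.asIdeal ∣ T.idealsOf η (vA 0) * T.PiA (T.idealsOf η) * T.PiB (T.idealsOf η) ↔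
      MeetsH (divides P T.O ξ) := by
  rw [P.prime.dvd_mul, P.prime.dvd_mul, dvd_PiA_iff P hξ, dvd_PiB_iff P hξ,
    dvd_idealsOf_iff P hξ, MeetsH, Fin.exists_fin_succ]
  rfl

lemma theta0_ne_zero_iff_isLocallyGood (hη : η ∈ T.dom) :
    theta0 (T.idealsOf η) ≠ 0 ↔ ∀ P, IsLocallyGood (divides P T.O ξ) := by
  rw [theta0_ne_zero_iff fun v hv => idealsOf_ne_zero hη hv]
  refine forall_congr' fun P => ?_
  rw [← theta0Local_eq_one_iff]
  have : divSet P (T.idealsOf η) = {v : inner r s t | divides P T.O ξ v.1} :=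
    Set.ext fun v => dvd_idealsOf_iff P hξ v
  rw [this]

end Full

end Inner

end TorsorData

end Divisibility

/-! ### The solutions of the torsor equation over a point of the base -/

section Fibers

variable {K : Type*} [Field K] [NumberField K] {r s t : ℕ}

open FractionalIdeal

lemma mem_spanSingleton_mul_iff {g y : K} (hg : g ≠ 0) (J : FractionalIdeal (𝓞 K)⁰ K) :
    y ∈ spanSingleton (𝓞 K)⁰ g * J ↔ y / g ∈ J := by
  rw [mem_singleton_mul]
  constructor
  · rintro ⟨y', hy', rfl⟩
    rwa [mul_div_cancel_left₀ _ hg]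
  · intro h
    exact ⟨_, h, (mul_div_cancel₀ _ hg).symm⟩

namespace TorsorData

variable (T : TorsorData K r s t)

open Classical in
/-- The point with coordinates `η` at the vertices of `G'` and `z` at `B_0`; the coordinate at `C_0` is
determined by the torsor equation. -/
def point (η : inner r s t → K) (z : K) (v : Vertex r s t) : K :=
  if h : v ∈ inner r s t then η ⟨v, h⟩ else if v = .B 0 then z else
    -((η (vA 0) ^ T.a 0 * T.PiA η + z ^ T.b 0 * T.PiB η) / T.PiC η)

lemma point_inner (η : inner r s t → K) (z : K) (v : inner r s t) : T.point η z v.1 = η v := by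
  rw [point, dif_pos v.2]

lemma point_B_zero (η : inner r s t → K) (z : K) : T.point η z (.B 0) = z := by
  rw [point, dif_neg (by simp [inner]), if_pos rfl]

lemma point_C_zero (η : inner r s t → K) (z : K) : T.point η z (.C 0) =
    -((η (vA 0) ^ T.a 0 * T.PiA η + z ^ T.b 0 * T.PiB η) / T.PiC η) := by
  rw [point, dif_neg (by simp [inner]), if_neg (by simp)]

lemma prod_A_eq {ξ : Vertex r s t → K} {η : inner r s t → K} (h : ∀ v : inner r s t, ξ v.1 = η v) :
    ∏ i, ξ (.A i) ^ T.a i = η (vA 0) ^ T.a 0 * T.PiA η := by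
  rw [Fin.prod_univ_succ, PiA, ← h]
  simp only [← h]
  rfl

lemma prod_B_eq {ξ : Vertex r s t → K} {η : inner r s t → K} (h : ∀ v : inner r s t, ξ v.1 = η v) :
    ∏ i, ξ (.B i) ^ T.b i = ξ (.B 0) ^ T.b 0 * T.PiB η := by
  rw [Fin.prod_univ_succ, PiB]
  simp only [← h]
  rfl

lemma prod_C_eq {ξ : Vertex r s t → K} {η : inner r s t → K} (h : ∀ v : inner r s t, ξ v.1 = η v) :
    ∏ i : Fin t, ξ (.C i.succ) ^ T.c i = T.PiC η := by
  rw [PiC]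
  simp only [← h]
  rfl

section Base

variable {T} {η : inner r s t → K} (hη : η ∈ T.dom)
include hη

lemma apply_ne_zero {v : inner r s t} (hv : v ≠ vA 0) : η v ≠ 0 := by
  intro h
  apply idealsOf_ne_zero hη hv
  rw [idealsOf, idealOf_eq_zero_iff (T.O_ne_zero _) (hη v).1, h]

lemma PiB_apply_ne_zero : T.PiB η ≠ 0 :=
  Finset.prod_ne_zero_iff.mpr fun i _ => pow_ne_zero _ (apply_ne_zero hη
    fun h => by simpa [vA, vB] using congrArg Subtype.val h)

lemma PiC_apply_ne_zero : T.PiC η ≠ 0 :=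
  Finset.prod_ne_zero_iff.mpr fun i _ => pow_ne_zero _ (apply_ne_zero hη
    fun h => by simpa [vA, vC] using congrArg Subtype.val h)

lemma A_term_mem_and_idealOf : η (vA 0) ^ T.a 0 * T.PiA η ∈ T.total ∧
    idealOf (η (vA 0) ^ T.a 0 * T.PiA η) T.total =
      T.idealsOf η (vA 0) ^ T.a 0 * T.PiA (T.idealsOf η) := by
  have h := prod_mem_and_idealOf_prod Finset.univ (fun i => η (vA i)) (fun i => T.O (.A i))
    (fun i => T.O_ne_zero _) (fun i => (hη (vA i)).1) T.a
  rw [Fin.prod_univ_succ (fun i => η (vA i) ^ T.a i), Fin.prod_univ_succ (fun i => idealOf _ _ ^ _)] at h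
  exact h

lemma PiB_mem_and_idealOf : T.PiB η ∈ ∏ i : Fin s, T.O (.B i.succ) ^ T.b i.succ ∧
    idealOf (T.PiB η) (∏ i : Fin s, T.O (.B i.succ) ^ T.b i.succ) = T.PiB (T.idealsOf η) :=
  prod_mem_and_idealOf_prod Finset.univ (fun i => η (vB i)) (fun i : Fin s => T.O (.B i.succ))
    (fun _ => T.O_ne_zero _) (fun i => (hη (vB i)).1) fun i => T.b i.succ

lemma coe_PiC_mul_total : ((T.PiC (T.idealsOf η) : Ideal (𝓞 K)) :
        FractionalIdeal (𝓞 K)⁰ K) * T.total =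
    spanSingleton _ (T.PiC η) * T.O (.C 0) := by
  have h := prod_mem_and_idealOf_prod Finset.univ (fun i => η (vC i)) (fun i : Fin t => T.O (.C i.succ))
    (fun i => T.O_ne_zero _) (fun i => (hη (vC i)).1) T.c
  have h0 : ∏ i : Fin t, T.O (.C i.succ) ^ T.c i ≠ 0 :=
    Finset.prod_ne_zero_iff.mpr fun _ _ => pow_ne_zero _ (T.O_ne_zero _)
  have e1 : T.PiC (T.idealsOf η) = idealOf (T.PiC η) (∏ i : Fin t, T.O (.C i.succ) ^ T.c i) := h.2.symm
  rw [e1, total, T.O_A_eq_O_C, mul_left_comm, mul_comm]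
  exact congrArg (· * T.O (.C 0)) (coe_idealOf_mul h0 h.1)

/-- The congruence for the coordinate at `B_0` over the point `η`. -/
def congruence {𝔄 : Ideal (𝓞 K)} {P₁ P₂ : K} (h : T.Admissible η 𝔄 P₁ P₂) : PowerCongruence K where
  b := T.b 0
  b_ne_zero := (T.b_pos 0).ne'
  OB := T.O (.B 0)
  O := T.total
  OP := ∏ i : Fin s, T.O (.B i.succ) ^ T.b i.succ
  OB_ne_zero := T.O_ne_zero _
  O_ne_zero := T.total_ne_zero
  OP_ne_zero := Finset.prod_ne_zero_iff.mpr fun _ _ => pow_ne_zero _ (T.O_ne_zero _)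
  O_eq := by rw [total, T.O_A_eq_O_B, Fin.prod_univ_succ]
  A := η (vA 0) ^ T.a 0 * T.PiA η
  PB := T.PiB η
  P₁ := P₁
  P₂ := P₂
  A_mem := (A_term_mem_and_idealOf hη).1
  PB_mem := (PiB_mem_and_idealOf hη).1
  PB_ne_zero := PiB_apply_ne_zero hη
  P₂_mem := coeIdeal_mul_le _ _ h.2.2.2.1
  A_eq := h.2.2.1

/-- Over a point with `θ_0 ≠ 0`, a prime ideal that divides the modulus `𝔠 Π(I_C)` does not divide
`I_{A_0} Π(I_A) Π(I_B)`. -/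
lemma not_dvd_of_dvd_modulus (h0 : theta0 (T.idealsOf η) ≠ 0) {c : Ideal (𝓞 K)}
    (hc : c ∈ T.divisorSet (T.idealsOf η)) (P : HeightOneSpectrum (𝓞 K))
    (hP : P.asIdeal ∣ c * T.PiC (T.idealsOf η)) :
    ¬ P.asIdeal ∣ T.idealsOf η (vA 0) * T.PiA (T.idealsOf η) * T.PiB (T.idealsOf η) := by
  rcases dvd_or_dvd_of_dvd_mul P hP with h | h
  · exact not_dvd_of_dvd_of_sup_eq_top P hc.2 h
  · have hξ := T.point_inner η 0
    have hX := (theta0_ne_zero_iff_isLocallyGood hξ hη).mp h0 P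
    rw [dvd_PiC_iff P hξ] at h
    rw [dvd_A_mul_PiA_mul_PiB_iff P hξ]
    obtain ⟨l, hl⟩ := h
    rintro (⟨i, hi⟩ | ⟨j, hj⟩)
    · exact hX.not_A_C (Fin.succ_ne_zero l) hi hl
    · exact hX.not_B_C (Fin.succ_ne_zero j) (Fin.succ_ne_zero l) hj hl

lemma modulus_ne_zero {c : Ideal (𝓞 K)} (hc : c ∣ PiC' (T.idealsOf η)) :
    c * T.PiC (T.idealsOf η) ≠ 0 :=
  mul_ne_zero (ne_zero_of_dvd_ne_zero (PiC'_ne_zero hη) hc) (PiC_ne_zero hη)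

/-- Writing `L = 𝒪 (𝔄 𝒪_{B_0})^{-b_0}`, one has `Π(η_B) ∈ L` with ideal `𝔄^{b_0} Π(I_B)`, and the
ideals of `Π_1 ∈ L` and `Π_2 ∈ 𝔄 𝒪_{B_0}` divide `I_{A_0}^{a_0} Π(I_A)`. All of these are prime to the
modulus. -/
lemma congruence_isGood {𝔄 : Ideal (𝓞 K)} {P₁ P₂ : K} (h : T.Admissible η 𝔄 P₁ P₂)
    (h0 : theta0 (T.idealsOf η) ≠ 0) {c : Ideal (𝓞 K)} (hc : c ∈ T.divisorSet (T.idealsOf η)) :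
    (congruence hη h).IsGood (c * T.PiC (T.idealsOf η)) := by
  obtain ⟨hA0, hAco, heq, hP₂, hP₁⟩ := id h
  set q := c * T.PiC (T.idealsOf η) with hq
  have hq0 : q ≠ 0 := modulus_ne_zero hη hc.1
  have hH := not_dvd_of_dvd_modulus hη h0 hc
  set J : FractionalIdeal (𝓞 K)⁰ K := (𝔄 : FractionalIdeal (𝓞 K)⁰ K) * T.O (.B 0) with hJ
  set L := T.total * (J ^ T.b 0)⁻¹ with hL
  have hA0' : (𝔄 : FractionalIdeal (𝓞 K)⁰ K) ≠ 0 := coeIdeal_ne_zero.mpr hA0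
  have hJ0 : J ≠ 0 := mul_ne_zero hA0' (T.O_ne_zero _)
  have hJb : J ^ T.b 0 ≠ 0 := pow_ne_zero _ hJ0
  have hL0 : L ≠ 0 := mul_ne_zero T.total_ne_zero (inv_ne_zero hJb)
  have hLJ : L * J ^ T.b 0 = T.total := by rw [hL, mul_assoc, inv_mul_cancel₀ hJb, mul_one]
  have hOP : (𝔄 : FractionalIdeal (𝓞 K)⁰ K) ^ T.b 0 * L =
      ∏ i : Fin s, T.O (.B i.succ) ^ T.b i.succ := by
    have e : T.O (.B 0) ^ T.b 0 * ∏ i : Fin s, T.O (.B i.succ) ^ T.b i.succ = T.total :=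
      (congruence hη h).O_eq
    have hb : T.O (.B 0) ^ T.b 0 ≠ 0 := pow_ne_zero _ (T.O_ne_zero _)
    apply mul_left_cancel₀ hb
    rw [e, ← hLJ, hJ, mul_pow]
    ring
  have hAq : ∀ P : HeightOneSpectrum (𝓞 K), P.asIdeal ∣ q → ¬ P.asIdeal ∣ 𝔄 := fun P hP hPA =>
    not_dvd_of_dvd_of_sup_eq_top P hAco hPA (hP.trans (mul_dvd_mul_right hc.1 _))
  -- the ideals of `P₁` and `P₂`
  have hprod : idealOf P₁ L * idealOf P₂ J ^ T.b 0 =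
      T.idealsOf η (vA 0) ^ T.a 0 * T.PiA (T.idealsOf η) := by
    rw [← (A_term_mem_and_idealOf hη).2, heq, ← hLJ, idealOf_mul hL0 hJb hP₁
      (pow_mem_pow_fractionalIdeal hP₂ _), idealOf_pow hJ0 hP₂]
  have hnot : ∀ P : HeightOneSpectrum (𝓞 K), P.asIdeal ∣ q →
      ¬ P.asIdeal ∣ idealOf P₁ L * idealOf P₂ J ^ T.b 0 := fun P hP hd => by
    rw [hprod] at hd
    apply hH P hP
    rcases dvd_or_dvd_of_dvd_mul P hd with hd | hd
    · exact (P.prime.dvd_of_dvd_pow hd).mul_right _ |>.mul_right _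
    · exact (hd.mul_left _).mul_right _
  have hPB := PiB_mem_and_idealOf hη
  have hPBL : T.PiB η ∈ L := by
    have := hPB.1
    rw [← hOP, ← coeIdeal_pow] at this
    exact coeIdeal_mul_le _ _ this
  have hPBL' : idealOf (T.PiB η) L = 𝔄 ^ T.b 0 * T.PiB (T.idealsOf η) := by
    apply idealOf_eq_of_coe_mul hL0
    rw [coeIdeal_mul, coeIdeal_pow, mul_right_comm, hOP, mul_comm, ← hPB.2]
    exact coe_idealOf_mul (congruence hη h).OP_ne_zero hPB.1
  refine ⟨hq0, ?_, ?_, ?_⟩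
  · have e : idealOf P₂ (T.O (.B 0)) = 𝔄 * idealOf P₂ J := by
      apply idealOf_eq_of_coe_mul (T.O_ne_zero _)
      rw [coeIdeal_mul, mul_right_comm, ← hJ, mul_comm]
      exact coe_idealOf_mul hJ0 hP₂
    show idealOf P₂ (T.O (.B 0)) ⊔ q = ⊤
    rw [e, sup_comm]
    refine sup_eq_top_of_forall_not_dvd hq0 fun P hP hd => ?_
    rcases dvd_or_dvd_of_dvd_mul P hd with hd | hd
    · exact hAq P hP hd
    · exact hnot P hP ((hd.trans (dvd_pow_self _ (T.b_pos 0).ne')).mul_left _)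
  · show idealOf (T.PiB η) (∏ i : Fin s, T.O (.B i.succ) ^ T.b i.succ) ⊔ q = ⊤
    rw [hPB.2, sup_comm]
    exact sup_eq_top_of_forall_not_dvd hq0 fun P hP hd => hH P hP (hd.mul_left _)
  · refine invertibleMod_div hL0 hP₁ hPBL ?_ ?_
    · rw [sup_comm]
      exact sup_eq_top_of_forall_not_dvd hq0 fun P hP hd => hnot P hP (hd.mul_right _)
    · rw [hPBL', sup_comm]
      refine sup_eq_top_of_forall_not_dvd hq0 fun P hP hd => ?_
      rcases dvd_or_dvd_of_dvd_mul P hd with hd | hd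
      · exact hAq P hP (P.prime.dvd_of_dvd_pow hd)
      · exact hH P hP (hd.mul_left _)

section Points

variable {𝔄 : Ideal (𝓞 K)} {P₁ P₂ : K} (h : T.Admissible η 𝔄 P₁ P₂)

lemma form_mem_iff_point_C_zero_mem (c : Ideal (𝓞 K)) (z : K) :
    (congruence hη h).form z ∈ ((c * T.PiC (T.idealsOf η) : Ideal (𝓞 K)) :
        FractionalIdeal (𝓞 K)⁰ K) * T.total ↔
      T.point η z (.C 0) ∈ (c : FractionalIdeal (𝓞 K)⁰ K) * T.O (.C 0) := by
  rw [coeIdeal_mul, mul_assoc, coe_PiC_mul_total hη, mul_left_comm,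
    mem_spanSingleton_mul_iff (PiC_apply_ne_zero hη), point_C_zero]
  exact (Submodule.neg_mem_iff _).symm

lemma form_mem_coe_PiC_iff (z : K) :
    (congruence hη h).form z ∈ ((T.PiC (T.idealsOf η) : Ideal (𝓞 K)) :
        FractionalIdeal (𝓞 K)⁰ K) * T.total ↔
      T.point η z (.C 0) ∈ T.O (.C 0) := by
  have := form_mem_iff_point_C_zero_mem hη h 1 z
  rwa [one_mul, Ideal.one_eq_top, coeIdeal_top, one_mul] at this

lemma point_mem {z : K} (hz : z ∈ T.O (.B 0)) (hC : T.point η z (.C 0) ∈ T.O (.C 0))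
    (v : Vertex r s t) : T.point η z v ∈ T.O v := by
  by_cases hB : v = .B 0
  · subst hB; rwa [point_B_zero]
  by_cases hvC : v = .C 0
  · subst hvC; exact hC
  have := (hη ⟨v, hB, hvC⟩).1
  rwa [← T.point_inner η z] at this

lemma torsorEquation_point (z : K) : T.TorsorEquation (T.point η z) := by
  rw [TorsorEquation, T.prod_A_eq (T.point_inner η z), T.prod_B_eq (T.point_inner η z),
    T.prod_C_eq (T.point_inner η z), point_B_zero, point_C_zero]
  have := PiC_apply_ne_zero hη
  field_simp
  ring

/-- Divisors that are not prime to `I_{A_0} Π(I_A) Π(I_B)` do not contribute. -/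
lemma form_notMem_of_not_sup_eq_top (hrs : 1 ≤ r + s) (h0 : theta0 (T.idealsOf η) ≠ 0)
    {c : Ideal (𝓞 K)} (hc : c ∣ PiC' (T.idealsOf η))
    (hcH : ¬ c ⊔ T.idealsOf η (vA 0) * T.PiA (T.idealsOf η) * T.PiB (T.idealsOf η) = ⊤)
    {z : K} (hz : z ∈ T.O (.B 0))
    (hzE : idealOf z (T.O (.B 0)) ⊔ PiB' (T.idealsOf η) * T.PiA (T.idealsOf η) = ⊤) :
    (congruence hη h).form z ∉ ((c * T.PiC (T.idealsOf η) : Ideal (𝓞 K)) :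
        FractionalIdeal (𝓞 K)⁰ K) * T.total := by
  intro hf
  rw [sup_eq_top_iff] at hcH
  push Not at hcH
  obtain ⟨P, hPc, hPH⟩ := hcH
  have hC := (form_mem_coe_PiC_iff hη h z).mp (coe_mul_mono_of_dvd (dvd_mul_left _ _) _ hf)
  have hξ := T.point_inner η z
  have hξm := point_mem hη hz hC
  have hX := (theta0_ne_zero_iff_isLocallyGood hξ hη).mp h0 P
  have hfP : (congruence hη h).form z ∈ (P.asIdeal : FractionalIdeal (𝓞 K)⁰ K) * T.total :=
    coe_mul_mono_of_dvd (hPc.mul_right _) _ hf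
  have hfeq : (congruence hη h).form z =
      ∏ i, T.point η z (.A i) ^ T.a i + ∏ i, T.point η z (.B i) ^ T.b i := by
    rw [T.prod_A_eq hξ, T.prod_B_eq hξ, point_B_zero]
    rfl
  rw [dvd_A_mul_PiA_mul_PiB_iff P hξ] at hPH
  refine hX.false_of_meetsF_of_meetsH hrs ((dvd_PiC'_iff P hξ).mp (hPc.trans hc)) hPH
    (fun hB hE => ?_) ?_
  · rw [← dvd_PiB'_mul_PiA_iff P hξ] at hE
    rw [divides, point_B_zero] at hB
    exact not_dvd_of_dvd_of_sup_eq_top P hzE hB hE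
  · rw [← prod_A_mem_iff hξm, ← prod_B_mem_iff hξm]
    rw [hfeq] at hfP
    exact ⟨fun hA => (Submodule.add_mem_iff_right _ hA).mp hfP,
      fun hB => (Submodule.add_mem_iff_left _ hB).mp hfP⟩

/-- The coprimality conditions for a point over `η`, in the form in which they are removed by Möbius
inversion. -/
lemma coprimality_point_iff (hrs : 1 ≤ r + s) {z : K} (hz : z ∈ T.O (.B 0))
    (hC : T.point η z (.C 0) ∈ T.O (.C 0)) :
    T.Coprimality (T.point η z) ↔ theta0 (T.idealsOf η) ≠ 0 ∧
      idealOf z (T.O (.B 0)) ⊔ PiB' (T.idealsOf η) * T.PiA (T.idealsOf η) = ⊤ ∧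
      idealOf (T.point η z (.C 0)) (T.O (.C 0)) ⊔ PiC' (T.idealsOf η) = ⊤ := by
  have hξ := T.point_inner η z
  have hB : ∀ P : HeightOneSpectrum (𝓞 K), P.asIdeal ∣ idealOf z (T.O (.B 0)) ↔
      divides P T.O (T.point η z) (.B 0) := fun P => by rw [divides, point_B_zero]
  rw [T.coprimality_iff, theta0_ne_zero_iff_isLocallyGood hξ hη, sup_eq_top_iff, sup_eq_top_iff]
  simp only [localCoprimality_of_torsorEquation_iff (point_mem hη hz hC) hrs
    (torsorEquation_point hη z), forall_and, dvd_PiB'_mul_PiA_iff _ hξ, dvd_PiC'_iff _ hξ, hB]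
  rfl

end Points

end Base

end TorsorData

end Fibers

/-! ### Summation over the base -/

section Summation

variable {K : Type*} [Field K] [NumberField K] {r s t : ℕ}

open FractionalIdeal MeasureTheory

namespace TorsorData

variable {T : TorsorData K r s t}

section OnePoint

variable {η : inner r s t → K} (hη : η ∈ T.dom) {𝔄 : Ideal (𝓞 K)} {P₁ P₂ : K}
  (h : T.Admissible η 𝔄 P₁ P₂)
include hη

/-- The part of `M(B)` over `η`, in terms of the coordinate `z` at `B_0`. -/
lemma point_mem_solutions_iff (hrs : 1 ≤ r + s) (σ : K →+* ℂ)
    (ℛ : Set ((inner r s t → ℂ) × ℂ)) (z : K) :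
    T.point η z ∈ T.solutions σ ℛ ↔ theta0 (T.idealsOf η) ≠ 0 ∧ z ∈ T.O (.B 0) ∧
      (congruence hη h).form z ∈ ((T.PiC (T.idealsOf η) : Ideal (𝓞 K)) :
        FractionalIdeal (𝓞 K)⁰ K) * T.total ∧
      idealOf z (T.O (.B 0)) ⊔ PiB' (T.idealsOf η) * T.PiA (T.idealsOf η) = ⊤ ∧
      idealOf (T.point η z (.C 0)) (T.O (.C 0)) ⊔ PiC' (T.idealsOf η) = ⊤ ∧
      σ z ∈ fiber σ ℛ η := by
  have hfib : (fun v : inner r s t => T.point η z v.1) = η := funext (T.point_inner η z)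
  rw [form_mem_coe_PiC_iff hη h]
  constructor
  · rintro ⟨hmem, -, hσ, hcop⟩
    have hz := (hmem (.B 0)).1
    rw [point_B_zero] at hz hσ
    have hC := (hmem (.C 0)).1
    rw [hfib] at hσ
    obtain ⟨h1, h2, h3⟩ := (coprimality_point_iff hη hrs hz hC).mp hcop
    exact ⟨h1, hz, hC, h2, h3, hσ⟩
  · rintro ⟨h1, hz, hC, h2, h3, hσ⟩
    refine ⟨fun v => ?_, torsorEquation_point hη z, ?_,
      (coprimality_point_iff hη hrs hz hC).mpr ⟨h1, h2, h3⟩⟩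
    · by_cases hv : v ∈ inner r s t
      · have := hη ⟨v, hv⟩
        rwa [← T.point_inner η z ⟨v, hv⟩] at this
      · refine ⟨point_mem hη hz hC v, fun _ => ?_⟩
        rw [inner, Set.mem_ofPred_eq, not_and_or, not_not, not_not] at hv
        exact hv.imp_right Or.inl
    · rwa [point_B_zero, hfib]

include h

lemma finite_setOf_point_mem_solutions (hrs : 1 ≤ r + s) (σ : K →+* ℂ)
    (ℛ : Set ((inner r s t → ℂ) × ℂ)) {C R : ℝ} (hS : WellCounted σ (fiber σ ℛ η) C R) :
    {z | T.point η z ∈ T.solutions σ ℛ}.Finite := by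
  refine ((congruence hη h).finite_mem_region σ hS).subset fun z hz => ?_
  obtain ⟨-, hz, -, -, -, hσ⟩ := (point_mem_solutions_iff hη h hrs σ ℛ z).mp hz
  exact ⟨hz, hσ⟩

/-- The number of solutions over one point `η` of the base. -/
theorem abs_ncard_point_sub_le (hdeg : Module.finrank ℚ K = 2) (hrs : 1 ≤ r + s) (σ : K →+* ℂ)
    (ℛ : Set ((inner r s t → ℂ) × ℂ)) {C R : ℝ} (hC : 0 ≤ C) (hR : 0 ≤ R)
    (hS : WellCounted σ (fiber σ ℛ η) C R) :
    |({z | T.point η z ∈ T.solutions σ ℛ}.ncard : ℝ) -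
        2 / √|(NumberField.discr K : ℝ)| * (T.theta1 η P₁ * T.V1 σ ℛ η)| ≤
      C * 729 ^ omegaK (Ideal.span {(6 : 𝓞 K)}) * (1 + 1 / √((absNorm (T.O (.B 0)) : ℚ) : ℝ)) *
        T.errorTerm η R := by
  rcases theta0_eq_zero_or_one (T.idealsOf η) with h0 | h1
  · have e1 : {z | T.point η z ∈ T.solutions σ ℛ} = ∅ :=
      Set.eq_empty_of_forall_notMem fun z hz =>
        ((point_mem_solutions_iff hη h hrs σ ℛ z).mp hz).1 h0
    have e2 : T.theta1 η P₁ = 0 := by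
      simp only [theta1, thetaTilde1, h0, zero_mul, mul_zero, finsum_zero]
    rw [e1, e2, Set.ncard_empty, Nat.cast_zero, zero_mul, mul_zero, sub_zero, abs_zero]
    rw [errorTerm]
    positivity
  have h0 : theta0 (T.idealsOf η) ≠ 0 := by rw [h1]; exact one_ne_zero
  have hξ := T.point_inner η 0
  have hPC := PiC_ne_zero hη
  have hW : T.idealsOf η vD * T.PiC (T.idealsOf η) ≠ 0 := mul_ne_zero (idealsOf_D_ne_zero hη) hPC
  have main := (congruence hη h).abs_ncard_sub_finsum_le hdeg hPC
    (E := PiB' (T.idealsOf η) * T.PiA (T.idealsOf η)) (F := PiC' (T.idealsOf η))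
    (H := T.idealsOf η (vA 0) * T.PiA (T.idealsOf η) * T.PiB (T.idealsOf η))
    (W := T.idealsOf η vD * T.PiC (T.idealsOf η))
    (mul_ne_zero (PiB'_ne_zero hη) (PiA_ne_zero hη)) (PiC'_ne_zero hη) hW
    (fun z => idealOf (T.point η z (.C 0)) (T.O (.C 0)))
    (fun z _ hf c => by
      rw [dvd_idealOf_iff (T.O_ne_zero _) ((form_mem_coe_PiC_iff hη h z).mp hf)]
      exact (form_mem_iff_point_C_zero_mem hη h c z).symm)
    (fun c hc hcH => congruence_isGood hη h h0 ⟨hc, hcH⟩)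
    (fun c hc hcH z hz hzE => form_notMem_of_not_sup_eq_top hη h hrs h0 hc hcH hz hzE)
    (fun c => PiB' (T.idealsOf η) ⊔ c * T.PiC (T.idealsOf η))
    (fun c hc hcH => by
      have hq0 := modulus_ne_zero hη hc
      refine ⟨fun hz => hq0 (le_bot_iff.mp (le_sup_right.trans hz.le)), fun P => ?_⟩
      rw [Ideal.dvd_iff_le, sup_le_iff, ← Ideal.dvd_iff_le, ← Ideal.dvd_iff_le]
      refine and_congr_left fun hP => ?_
      rw [P.prime.dvd_mul]
      refine (or_iff_left fun hA => ?_).symm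
      exact not_dvd_of_dvd_modulus hη h0 ⟨hc, hcH⟩ P hP ((hA.mul_left _).mul_right _))
    (fun P hP => by
      rcases dvd_or_dvd_of_dvd_mul P hP with hP | hP
      · rw [dvd_PiC'_iff P hξ] at hP
        rcases hP with ⟨-, hD | ⟨l, -, hl⟩⟩
        · exact ((dvd_idealsOf_iff P hξ vD).mpr hD).mul_right _
        · exact ((dvd_PiC_iff P hξ).mpr ⟨l, hl⟩).mul_left _
      · exact hP.mul_left _)
    σ hC hR hS
  have e1 : {z | T.point η z ∈ T.solutions σ ℛ} = {z : K | z ∈ (congruence hη h).OB ∧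
      (congruence hη h).form z ∈ ((T.PiC (T.idealsOf η) : Ideal (𝓞 K)) :
        FractionalIdeal (𝓞 K)⁰ K) * (congruence hη h).O ∧
      idealOf z (congruence hη h).OB ⊔ PiB' (T.idealsOf η) * T.PiA (T.idealsOf η) = ⊤ ∧
      idealOf (T.point η z (.C 0)) (T.O (.C 0)) ⊔ PiC' (T.idealsOf η) = ⊤ ∧
      σ z ∈ fiber σ ℛ η} := by
    ext z
    exact (point_mem_solutions_iff hη h hrs σ ℛ z).trans (and_iff_right h0)
  have e2 : T.V1 σ ℛ η = volume.real (fiber σ ℛ η) /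
      ((Ideal.absNorm (T.PiC (T.idealsOf η)) : ℝ) * ((absNorm (T.O (.B 0)) : ℚ) : ℝ)) := by
    rw [V1, setIntegral_const, smul_eq_mul, absNorm_coe_mul, mul_one_div]
  have e3 : T.theta1 η P₁ = ∑ᶠ c ∈ {c | c ∣ PiC' (T.idealsOf η) ∧
        c ⊔ T.idealsOf η (vA 0) * T.PiA (T.idealsOf η) * T.PiB (T.idealsOf η) = ⊤},
      (moebiusK c : ℝ) / (Ideal.absNorm c : ℝ) *
        (phiStar (PiB' (T.idealsOf η) * T.PiA (T.idealsOf η)) /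
          phiStar (PiB' (T.idealsOf η) ⊔ c * T.PiC (T.idealsOf η))) *
        (rootCount (c * T.PiC (T.idealsOf η)) (T.b 0) (-(P₁ / T.PiB η)) : ℝ) := by
    simp only [theta1, thetaTilde1, h1, one_mul]
    rfl
  rw [e1, e2, e3]
  exact main

end OnePoint

lemma restrict_mem_dom {σ : K →+* ℂ} {ℛ : Set ((inner r s t → ℂ) × ℂ)} {ξ : Vertex r s t → K}
    (hξ : ξ ∈ T.solutions σ ℛ) : (fun v : inner r s t => ξ v.1) ∈ T.dom := fun v => hξ.1 v.1

lemma eq_point {σ : K →+* ℂ} {ℛ : Set ((inner r s t → ℂ) × ℂ)} {ξ : Vertex r s t → K}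
    (hξ : ξ ∈ T.solutions σ ℛ) : T.point (fun v : inner r s t => ξ v.1) (ξ (.B 0)) = ξ := by
  set η : inner r s t → K := fun v => ξ v.1 with hη
  have hr : ∀ v : inner r s t, ξ v.1 = η v := fun _ => rfl
  have heq := hξ.2.1
  rw [TorsorEquation, T.prod_A_eq hr, T.prod_B_eq hr, T.prod_C_eq hr] at heq
  have h0 := PiC_apply_ne_zero (restrict_mem_dom hξ)
  funext v
  by_cases hB : v = .B 0
  · subst hB; rw [point_B_zero]
  by_cases hC : v = .C 0
  · subst hC
    rw [point_C_zero, ← neg_div, div_eq_iff h0]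
    linear_combination -heq
  exact T.point_inner η _ ⟨v, hB, hC⟩

lemma point_injective (η : inner r s t → K) : Function.Injective (T.point η) := fun z z' h => by
  rw [← T.point_B_zero η z, h, point_B_zero]

lemma one_le_errorTerm (η : inner r s t → K) {R : ℝ} (hR : 0 ≤ R) : 1 ≤ T.errorTerm η R := by
  have hb : (1 : ℝ) ≤ T.b 0 := Nat.one_le_cast.mpr (T.b_pos 0)
  have h1 : (1 : ℝ) ≤ R / √(Ideal.absNorm (T.PiC (T.idealsOf η)) : ℝ) + 1 :=
    le_add_of_nonneg_left (by positivity)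
  rw [errorTerm]
  exact one_le_mul_of_one_le_of_one_le
    (one_le_mul_of_one_le_of_one_le (one_le_pow₀ one_le_two) (one_le_pow₀ hb)) h1

/-- This makes the base finite: the error term of every point that contributes is at least `1`. -/
lemma finite_of_summable_one_le {ι : Type*} {f : ι → ℝ} (hf : Summable f) (h : ∀ i, 1 ≤ f i) :
    Finite ι := by
  have h1 := hf.tendsto_cofinite_zero.eventually (gt_mem_nhds one_pos)
  rw [Filter.eventually_cofinite] at h1
  refine Set.finite_univ_iff.mp (h1.subset fun i _ => not_lt.mpr (h i))

/-- The estimates over the single points of the base add up. -/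
theorem abs_ncard_solutions_sub_tsum_le {σ : K →+* ℂ} {ℛ : Set ((inner r s t → ℂ) × ℂ)}
    {M E : (inner r s t → K) → ℝ} {c C : ℝ}
    (hfin : {η | η ∈ T.dom ∧ (fiber σ ℛ η).Nonempty}.Finite)
    (hM : ∀ η, ¬ (fiber σ ℛ η).Nonempty → M η = 0)
    (hZfin : ∀ η ∈ T.dom, (fiber σ ℛ η).Nonempty →
      {z | T.point η z ∈ T.solutions σ ℛ}.Finite)
    (hZ : ∀ η ∈ T.dom, (fiber σ ℛ η).Nonempty →
      |({z | T.point η z ∈ T.solutions σ ℛ}.ncard : ℝ) - c * M η| ≤ C * E η) :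
    (T.solutions σ ℛ).Finite ∧ Summable (fun η : T.dom => M η.1) ∧
      |((T.solutions σ ℛ).ncard : ℝ) - c * ∑' η : T.dom, M η.1| ≤
        C * ∑' η : {η | η ∈ T.dom ∧ (fiber σ ℛ η).Nonempty}, E η.1 := by
  classical
  set N := {η | η ∈ T.dom ∧ (fiber σ ℛ η).Nonempty} with hN
  have hres : ∀ ξ ∈ T.solutions σ ℛ, (fun v : inner r s t => ξ v.1) ∈ N := fun ξ hξ =>
    ⟨restrict_mem_dom hξ, _, hξ.2.2.1⟩
  have hsol : (T.solutions σ ℛ).Finite := by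
    refine (hfin.biUnion fun η hη => (hZfin η hη.1 hη.2).image (T.point η)).subset fun ξ hξ => ?_
    refine Set.mem_biUnion (hres ξ hξ) ⟨ξ (.B 0), ?_, eq_point hξ⟩
    rw [Set.mem_ofPred_eq, eq_point hξ]
    exact hξ
  have hind : ∀ η ∉ hfin.toFinset, T.dom.indicator M η = 0 := fun η hη => by
    by_cases hd : η ∈ T.dom
    · rw [Set.indicator_of_mem hd]
      exact hM η fun hne => hη (hfin.mem_toFinset.mpr ⟨hd, hne⟩)
    · exact Set.indicator_of_notMem hd _
  have hcard : ((T.solutions σ ℛ).ncard : ℝ) =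
      ∑ η ∈ hfin.toFinset, ({z | T.point η z ∈ T.solutions σ ℛ}.ncard : ℝ) := by
    rw [Set.ncard_eq_toFinset_card _ hsol, Finset.card_eq_sum_card_fiberwise
      (f := fun ξ => fun v : inner r s t => ξ v.1) (t := hfin.toFinset)
      fun ξ hξ => hfin.mem_toFinset.mpr (hres ξ (hsol.mem_toFinset.mp hξ)), Nat.cast_sum]
    refine Finset.sum_congr rfl fun η hη => ?_
    congr 1
    rw [← Set.ncard_image_of_injective _ (T.point_injective η), ← Set.ncard_coe_finset]
    congr 1
    ext ξ
    simp only [Finset.coe_filter, hsol.mem_toFinset, Set.mem_ofPred_eq, Set.mem_image]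
    constructor
    · rintro ⟨hξ, rfl⟩
      exact ⟨ξ (.B 0), by rw [eq_point hξ]; exact hξ, eq_point hξ⟩
    · rintro ⟨z, hz, rfl⟩
      exact ⟨hz, funext (T.point_inner η z)⟩
  refine ⟨hsol, ?_, ?_⟩
  · exact (summable_subtype_iff_indicator (f := M) (s := T.dom)).mpr
      (summable_of_ne_finset_zero (s := hfin.toFinset) hind)
  have e1 : ∑' η : T.dom, M η.1 = ∑ η ∈ hfin.toFinset, M η := by
    rw [tsum_subtype T.dom M, tsum_eq_sum hind]
    exact Finset.sum_congr rfl fun η hη =>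
      Set.indicator_of_mem (hfin.mem_toFinset.mp hη).1 _
  have e2 : ∑' η : N, E η.1 = ∑ η ∈ hfin.toFinset, E η := by
    rw [tsum_subtype N E, tsum_eq_sum (s := hfin.toFinset) fun η hη =>
      Set.indicator_of_notMem (fun h => hη (hfin.mem_toFinset.mpr h)) _]
    exact Finset.sum_congr rfl fun η hη => Set.indicator_of_mem (hfin.mem_toFinset.mp hη) _
  rw [e1, e2, hcard, Finset.mul_sum, Finset.mul_sum, ← Finset.sum_sub_distrib]
  refine (Finset.abs_sum_le_sum_abs _ _).trans (Finset.sum_le_sum fun η hη => ?_)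
  obtain ⟨h1, h2⟩ := hfin.mem_toFinset.mp hη
  exact hZ η h1 h2

end TorsorData

end Summation

end FirstSummation

end

theorem mainTheorem3 (K : Type*) [Field K] [NumberField K]
    (hdeg : Module.finrank ℚ K = 2) (him : IsTotallyComplex K) (σ : K →+* ℂ)
    (k m : ℕ) (OB : FractionalIdeal (𝓞 K)⁰ K) (hOB : OB ≠ 0) :
    ∃ C : ℝ, 0 < C ∧
      ∀ (r s t : ℕ) (_hrs : 1 ≤ r + s)
        (T : FirstSummation.TorsorData K r s t) (_hT : T.O (.B 0) = OB)
        (𝔄 : (FirstSummation.inner r s t → K) → Ideal (𝓞 K))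
        (P₁ P₂ : (FirstSummation.inner r s t → K) → K)
        (_hadm : ∀ η ∈ T.dom, T.Admissible η (𝔄 η) (P₁ η) (P₂ η))
        (ℛ : ℝ → Set ((FirstSummation.inner r s t → ℂ) × ℂ))
        (R : (FirstSummation.inner r s t → K) → ℝ → ℝ)
        (_hclass : ∀ B : ℝ, 0 < B → ∀ η ∈ T.dom,
          FirstSummation.IsOfClass m (FirstSummation.TorsorData.fiber σ (ℛ B) η))
        (_hballs : ∀ B : ℝ, 0 < B → ∀ η ∈ T.dom, ∃ p : Fin k → ℂ,
          FirstSummation.TorsorData.fiber σ (ℛ B) η ⊆ ⋃ i, Metric.closedBall (p i) (R η B)),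
        (∀ η ∈ T.dom, FirstSummation.theta0 (T.idealsOf η) ≠ 0 →
          ∀ 𝔠 ∈ T.divisorSet (T.idealsOf η),
            FirstSummation.InvertibleMod (𝔠 * T.PiC (T.idealsOf η)) (P₁ η / T.PiB η)) ∧
        ∀ B : ℝ, 0 < B →
          -- if the sum of the error terms diverges, the estimate is void
          Summable (fun η : {η | η ∈ T.dom ∧
            (FirstSummation.TorsorData.fiber σ (ℛ B) η).Nonempty} =>
              T.errorTerm η.1 (R η.1 B)) →
          (T.solutions σ (ℛ B)).Finite ∧
          Summable (fun η : T.dom => T.theta1 η.1 (P₁ η.1) * T.V1 σ (ℛ B) η.1) ∧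
          |((T.solutions σ (ℛ B)).ncard : ℝ) -
              2 / √|(NumberField.discr K : ℝ)| *
                ∑' η : T.dom, T.theta1 η.1 (P₁ η.1) * T.V1 σ (ℛ B) η.1| ≤
            C * ∑' η : {η | η ∈ T.dom ∧
              (FirstSummation.TorsorData.fiber σ (ℛ B) η).Nonempty},
                T.errorTerm η.1 (R η.1 B) := by
  obtain ⟨C, hC, hlat⟩ := FirstSummation.exists_ideal_lattice_bound hdeg him σ k m
  have hN := FirstSummation.fractionalIdeal_absNorm_pos hOB
  refine ⟨C * 729 ^ FirstSummation.omegaK (Ideal.span {(6 : 𝓞 K)}) *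
    (1 + 1 / √((FractionalIdeal.absNorm OB : ℚ) : ℝ)), by positivity, ?_⟩
  intro r s t hrs T hT 𝔄 P₁ P₂ hadm ℛ R hclass hballs
  subst hT
  refine ⟨fun η hη h0 c hc => (FirstSummation.TorsorData.congruence_isGood hη (hadm η hη) h0
    hc).invertible, fun B hB hsum => ?_⟩
  have hR : ∀ η ∈ T.dom, (FirstSummation.TorsorData.fiber σ (ℛ B) η).Nonempty → 0 ≤ R η B := by
    rintro η hη ⟨z, hz⟩
    obtain ⟨p, hp⟩ := hballs B hB η hη
    obtain ⟨i, hi⟩ := Set.mem_iUnion.mp (hp hz)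
    exact dist_nonneg.trans hi
  have hS : ∀ η ∈ T.dom, (FirstSummation.TorsorData.fiber σ (ℛ B) η).Nonempty →
      FirstSummation.WellCounted σ (FirstSummation.TorsorData.fiber σ (ℛ B) η) C (R η B) := by
    intro η hη hne J hJ x
    obtain ⟨p, hp⟩ := hballs B hB η hη
    exact hlat J hJ x _ (hclass B hB η hη).1 (hclass B hB η hη).2.1 _ (hR η hη hne) p hp
  have hfin := FirstSummation.TorsorData.finite_of_summable_one_le hsum fun η =>
    T.one_le_errorTerm η.1 (hR η.1 η.2.1 η.2.2)
  refine FirstSummation.TorsorData.abs_ncard_solutions_sub_tsum_le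
    (M := fun η => T.theta1 η (P₁ η) * T.V1 σ (ℛ B) η) (E := fun η => T.errorTerm η (R η B))
    (Set.toFinite _) (fun η hne => ?_)
    (fun η hη hne => FirstSummation.TorsorData.finite_setOf_point_mem_solutions hη (hadm η hη) hrs σ
      (ℛ B) (hS η hη hne))
    (fun η hη hne => FirstSummation.TorsorData.abs_ncard_point_sub_le hη (hadm η hη) hdeg hrs σ
      (ℛ B) hC.le (hR η hη hne) (hS η hη hne))
  rw [Set.not_nonempty_iff_eq_empty] at hne
  have hV : T.V1 σ (ℛ B) η = 0 := by
    rw [FirstSummation.TorsorData.V1, hne, MeasureTheory.setIntegral_empty]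
  exact mul_eq_zero_of_right _ hV
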